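/- All graphs are finite and simple. The Euler genus of a closed (compact, connected) surface $\Sigma$ is $2-\chi(\Sigma)$, where $\chi$ is the Euler characteristic; the Euler genus of a graph $G$ is the minimum Euler genus of a closed surface in which $G$ embeds. A 3-dimensional grid drawing of $G$ represents the vertices by distinct points of $\mathbb{Z}^3$ and each edge by the open straight-line segment between its endpoints, such that no two edges intersect and no edge contains a vertex. Its volume is the number of grid points in the smallest axis-aligned box that encloses the drawing. Theorem. There is an absolute constant $C$ such that every $n$-vertex graph of Euler genus $g$ has a 3-dimensional grid drawing of volume at most $$C\,\hat g^{7/2}\,(\hat g+\log n)\,n,\qquad\text{where } \hat g=\max\{g,1\}$$ (for $n=0$ the bound is read as $0$). In particular the volume is $O(g^{7/2}(g+\log n)n)$ for $g\ge 1$, and $O((1+\log n)\,n)$ for planar graphs ($g=0$). -/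

import Mathlib

/-- A closed surface (compact, connected, without boundary, orientable or not) presented by a finite
cell decomposition, i.e. a multigraph (loops and parallel edges allowed, at least one edge)
cellularly embedded in the surface.

The decomposition is recorded by its flags: a flag is an incident triple (vertex, side of an edge
at that end, corner of a face), equivalently a triangle of the barycentric subdivision.  Each flag
`x` has exactly one neighbour `swapVertex x` differing from it in the vertex only, one neighbour
`swapEdge x` differing from it in the edge only, and one neighbour `swapFace x` differing from it
in the face only. The surface is recovered by gluing one triangle per flag along these three
involutions. Absence of fixed points says that there is no boundary; the conditions on
`swapVertex` and `swapFace` say that every edge consists of exactly four flags. -/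
structure CellularSurface where
  Flag : Type
  [finite_flag : Finite Flag]
  [nonempty_flag : Nonempty Flag]
  swapVertex : Flag → Flag
  swapEdge : Flag → Flag
  swapFace : Flag → Flag
  swapVertex_invol : ∀ x, swapVertex (swapVertex x) = x
  swapEdge_invol : ∀ x, swapEdge (swapEdge x) = x
  swapFace_invol : ∀ x, swapFace (swapFace x) = x
  swapVertex_ne : ∀ x, swapVertex x ≠ x
  swapEdge_ne : ∀ x, swapEdge x ≠ x
  swapFace_ne : ∀ x, swapFace x ≠ x
  swap_comm : ∀ x, swapVertex (swapFace x) = swapFace (swapVertex x)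
  swapVertex_ne_swapFace : ∀ x, swapVertex x ≠ swapFace x
  /-- The surface is connected. -/
  connected : ∀ x y, Relation.EqvGen
    (fun a b => b = swapVertex a ∨ b = swapEdge a ∨ b = swapFace a) x y

namespace CellularSurface

/-- Vertices: classes of flags under changing the edge and the face. -/
def Vertex (S : CellularSurface) : Type :=
  Quot fun a b : S.Flag => b = S.swapEdge a ∨ b = S.swapFace a

/-- Edges: classes of flags under changing the vertex and the face. -/
def Edge (S : CellularSurface) : Type :=
  Quot fun a b : S.Flag => b = S.swapVertex a ∨ b = S.swapFace a

/-- Faces: classes of flags under changing the vertex and the edge. -/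
def Face (S : CellularSurface) : Type :=
  Quot fun a b : S.Flag => b = S.swapVertex a ∨ b = S.swapEdge a

/-- The vertex of a flag. -/
def vertexOf (S : CellularSurface) (x : S.Flag) : S.Vertex := Quot.mk _ x

/-- The Euler characteristic `|V| - |E| + |F|`. -/
noncomputable def eulerChar (S : CellularSurface) : ℤ :=
  (Nat.card S.Vertex : ℤ) - (Nat.card S.Edge : ℤ) + (Nat.card S.Face : ℤ)

/-- The Euler genus of a surface is `2 - χ`. -/
noncomputable def eulerGenus (S : CellularSurface) : ℤ := 2 - S.eulerChar

end CellularSurface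

namespace SimpleGraph

variable {V : Type*}

/-- `G` is drawn in the surface as a subgraph of the multigraph of the cell decomposition: distinct
vertices of `G` are distinct vertices of the decomposition, and each edge `uv` of `G` is an edge of
the decomposition with ends `u` and `v`. (As `G` is simple, distinct edges of `G` have distinct end
pairs, so they are automatically distinct edges of the decomposition.) -/
def EmbedsInCells (G : SimpleGraph V) (S : CellularSurface) : Prop :=
  ∃ f : V → S.Vertex, Function.Injective f ∧
    ∀ u v, G.Adj u v → ∃ x : S.Flag, S.vertexOf x = f u ∧ S.vertexOf (S.swapVertex x) = f v

/-- `G` embeds in some surface of Euler genus `g`. The cell decomposition may have vertices and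
edges that are not in `G`, so the embedding of `G` itself need not be cellular and `G` need not be
connected. -/
def EmbedsInEulerGenus (G : SimpleGraph V) (g : ℕ) : Prop :=
  ∃ S : CellularSurface, S.eulerGenus = (g : ℤ) ∧ G.EmbedsInCells S

/-- `G` has Euler genus `g`: the least Euler genus of a surface in which `G` embeds is `g`. -/
def HasEulerGenus (G : SimpleGraph V) (g : ℕ) : Prop :=
  IsLeast {h : ℕ | G.EmbedsInEulerGenus h} g

end SimpleGraph

/-- A grid point of `ℤ³` as a point of `ℝ³`. -/
def gridToReal (q : Fin 3 → ℤ) : Fin 3 → ℝ := fun i => (q i : ℝ)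

/-- A 3-dimensional (straight-line) grid drawing of `G`: vertices are distinct points of `ℤ³`, each
edge is the open segment between its ends, no two distinct edges intersect, and no edge passes
through a vertex. -/
structure GridDrawing {V : Type*} (G : SimpleGraph V) where
  pos : V → Fin 3 → ℤ
  pos_injective : Function.Injective pos
  edges_disjoint : ∀ u v x y, G.Adj u v → G.Adj x y → s(u, v) ≠ s(x, y) →
    Disjoint (openSegment ℝ (gridToReal (pos u)) (gridToReal (pos v)))
      (openSegment ℝ (gridToReal (pos x)) (gridToReal (pos y)))
  vertex_not_mem_edge : ∀ u v w, G.Adj u v →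
    gridToReal (pos w) ∉ openSegment ℝ (gridToReal (pos u)) (gridToReal (pos v))

namespace GridDrawing

variable {V : Type*} {G : SimpleGraph V}

/-- The grid points of the smallest axis-aligned box enclosing the drawing: those whose every
coordinate lies between the least and the greatest such coordinate of a vertex. -/
def box (D : GridDrawing G) : Set (Fin 3 → ℤ) :=
  {q | ∀ i, (∃ v, D.pos v i ≤ q i) ∧ (∃ v, q i ≤ D.pos v i)}

/-- The volume: the number of grid points in the smallest enclosing box. -/
noncomputable def volume (D : GridDrawing G) : ℕ := D.box.ncard

end GridDrawing

/-! Surface. Fix a breadth-first spanning tree of a cell decomposition of Euler genus `g`. Removing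
a tree from a surface does not disconnect it (`related_of_isAncestor`), so the dual graph has a
spanning tree, the cotree, that crosses no tree edge; by Euler's formula exactly `g` excess edges
are in neither. The ancestors of their ends form a set `X` with at most `2g` vertices in each layer.
Cutting each face boundary open where the cotree enters it and joining the resulting paths along the
cotree turns the flags into the nodes of a tree. A flag receives the ancestors of three vertices,
hence at most three vertices of each layer. For `v ∉ X` the flags that receive `v` form a subtree,
because no excess edge has an end below `v` (`bag_connected`). Thus, apart from `X`, there is a tree
decomposition of layered width 3.

Tracks. Adjacent vertices lie in equal or consecutive layers, so layers matter only modulo 3. Index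
within the layer and residue of the layer put `X` on `6g` tracks. The rest falls into nine
independent groups (residue times a 3-colour of the layer), and recursive halving by separators
(`exists_levels`) cuts each group into `3L` tracks, `L = log₂ n + 1`. Ordering by layer and then by
separator excludes crossings between any two tracks (`exists_trackLayout`).

Drawing. Group `i` lies in the plane `x = i`, over a short interval near a point of a parabola; its
tracks are cut into columns parallel to the z-axis. The tracks of `X` are vertical lines far away,
over another parabola. Using one plane per group, and not per track, keeps the box small. Two edges
are kept apart by (a) the absence of crossings, between the same two columns or lines; (b) different
slopes `K (i + 1)` at which the groups rise (`eq_of_slope_windows`), between the same two groups;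
(c) steepness of the groups (`not_meet_of_steep`), if they share one group only; (d) the moment
curve modulo 11 or modulo a prime `p > m`, for four groups or four lines; (e) the projection to the
xy-plane in most mixed cases. With `m` lines the box is `O(m) × O(m (m + L)) × O(m n)`. Taking `m =
6ĝ` gives `O(ĝ³ (ĝ + log n) n)`, which is stronger than the exponent `7/2`. -/

/-! ### Orbits of two involutions, and breadth-first search -/

/-- The walk `x, a x, b (a x), a (b (a x)), …`. -/
def alternatingWalk {α : Type*} (a b : α → α) (x : α) : ℕ → α
  | 0 => x
  | n + 1 => if Even n then a (alternatingWalk a b x n) else b (alternatingWalk a b x n)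

section Dihedral

variable {α : Type*} {a b : α → α}

theorem alternatingWalk_succ_even (x : α) {n : ℕ} (h : Even n) :
    alternatingWalk a b x (n + 1) = a (alternatingWalk a b x n) := by
  simp [alternatingWalk, h]

theorem alternatingWalk_succ_odd (x : α) {n : ℕ} (h : ¬ Even n) :
    alternatingWalk a b x (n + 1) = b (alternatingWalk a b x n) := by
  simp [alternatingWalk, h]

theorem alternatingWalk_pred (ha : ∀ x, a (a x) = x) (hb : ∀ x, b (b x) = x) (x : α) {j k : ℕ}
    (hp : Even j ↔ Even k)
    (h : alternatingWalk a b x (j + 1) = alternatingWalk a b x (k + 1)) :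
    alternatingWalk a b x j = alternatingWalk a b x k := by
  by_cases hj : Even j
  · rw [alternatingWalk_succ_even x hj, alternatingWalk_succ_even x (hp.1 hj)] at h
    simpa [ha] using congrArg a h
  · rw [alternatingWalk_succ_odd x hj, alternatingWalk_succ_odd x (fun h' => hj (hp.2 h'))] at h
    simpa [hb] using congrArg b h

/-- A coincidence at odd distance can be shrunk from both ends: the first step and the last step
apply the same involution. It ends as a fixed point of `a` or `b`. -/
theorem alternatingWalk_ne (ha : ∀ x, a (a x) = x) (hb : ∀ x, b (b x) = x) (ha' : ∀ x, a x ≠ x)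
    (hb' : ∀ x, b x ≠ x) (x : α) (d j : ℕ) :
    alternatingWalk a b x j ≠ alternatingWalk a b x (j + 2 * d + 1) := by
  induction d generalizing j with
  | zero =>
    by_cases hj : Even j
    · rw [Nat.mul_zero, Nat.add_zero, alternatingWalk_succ_even x hj]
      exact (ha' _).symm
    · rw [Nat.mul_zero, Nat.add_zero, alternatingWalk_succ_odd x hj]
      exact (hb' _).symm
  | succ d ih =>
    intro h
    apply ih (j + 1)
    have e : j + 1 + 2 * d + 1 = j + 2 * (d + 1) := by ring
    rw [e]
    have hp : Even (j + 2 * (d + 1)) ↔ Even j := by simp [Nat.even_add]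
    by_cases hj : Even j
    · rw [alternatingWalk_succ_even x hj, h, alternatingWalk_succ_even x (hp.2 hj), ha]
    · rw [alternatingWalk_succ_odd x hj, h, alternatingWalk_succ_odd x (fun h' => hj (hp.1 h')), hb]

/-- The orbit of `x₀` under two fixed-point-free involutions `a` and `b` is a cycle; cutting it at
the `b`-edge of `x₀` gives a path starting at `x₀`, and `rk` is the position on that path. -/
theorem exists_rank_of_involutions [Finite α] (ha : ∀ x, a (a x) = x) (hb : ∀ x, b (b x) = x)
    (ha' : ∀ x, a x ≠ x) (hb' : ∀ x, b x ≠ x) (x₀ : α) :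
    ∃ rk : α → ℕ, rk x₀ = 0 ∧
      ∀ x, Relation.EqvGen (fun u v => v = a u ∨ v = b u) x₀ x →
        (rk x = 0 → x = x₀) ∧ (Even (rk x) → rk (a x) = rk x + 1) ∧
        (¬ Even (rk x) → rk (a x) + 1 = rk x) ∧
        (Even (rk x) → rk x ≠ 0 → rk (b x) + 1 = rk x) ∧
        (¬ Even (rk x) → b x = x₀ ∨ rk (b x) = rk x + 1) := by
  classical
  set y := alternatingWalk a b x₀ with hy
  have hy0 : y 0 = x₀ := rfl
  -- A coincidence can be slid back to time 0. Hence the first repetition of the walk is a return to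
  -- `x₀`, at an even time `K`.
  have back : ∀ j e, y j = y (j + e) → Even e ∧ y 0 = y e := by
    intro j e h
    have he : Even e := by
      by_contra ho
      obtain ⟨d, rfl⟩ := Nat.not_even_iff_odd.1 ho
      exact alternatingWalk_ne ha hb ha' hb' x₀ d j h
    refine ⟨he, ?_⟩
    induction j with
    | zero => simpa using h
    | succ j ih =>
      apply ih
      apply alternatingWalk_pred ha hb
      · simp [Nat.even_add, he]
      · rw [Nat.add_right_comm] at h
        exact h
  have hex : ∃ K, 0 < K ∧ y K = x₀ := by
    obtain ⟨j, k, hjk, hne⟩ : ∃ j k, y j = y k ∧ j ≠ k := by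
      have := not_injective_infinite_finite y
      simpa [Function.Injective] using this
    rcases lt_or_gt_of_ne hne with hlt | hlt
    · refine ⟨k - j, by omega, ?_⟩
      rw [← hy0]
      exact ((back j (k - j)) (by rw [hjk]; congr 1; omega)).2.symm
    · refine ⟨j - k, by omega, ?_⟩
      rw [← hy0]
      exact ((back k (j - k)) (by rw [← hjk]; congr 1; omega)).2.symm
  obtain ⟨hK0, hK⟩ := Nat.find_spec hex
  have hmin := fun k hk => Nat.find_min hex (m := k) hk
  set K := Nat.find hex
  clear_value K
  have hKe : Even K := (back 0 K (by rw [Nat.zero_add, hK, hy0])).1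
  have inj : ∀ j k, j < K → k < K → y j = y k → j = k := by
    have key : ∀ j k, j < k → k < K → y j ≠ y k := by
      intro j k hjk hk h
      refine hmin (k - j) (by omega) ⟨by omega, ?_⟩
      rw [← hy0]
      exact ((back j (k - j)) (by rw [h]; congr 1; omega)).2.symm
    intro j k hj hk h
    rcases lt_trichotomy j k with h1 | h1 | h1
    · exact absurd h (key j k h1 hk)
    · exact h1
    · exact absurd h.symm (key k j h1 hj)
  -- As `K` is even, the walk returns to `x₀` by a `b`-step; this is the step that is cut.
  have hKpred : b x₀ = y (K - 1) := by
    have h1 : ¬ Even (K - 1) := by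
      have := Nat.even_sub (show 1 ≤ K by omega)
      simp [this, hKe]
    have h2 := alternatingWalk_succ_odd (a := a) (b := b) x₀ h1
    rw [show K - 1 + 1 = K by omega] at h2
    rw [← hK, hy, h2, hb]
  have stepa_even : ∀ j, Even j → a (y j) = y (j + 1) :=
    fun j hj => (alternatingWalk_succ_even x₀ hj).symm
  have stepb_odd : ∀ j, ¬ Even j → b (y j) = y (j + 1) :=
    fun j hj => (alternatingWalk_succ_odd x₀ hj).symm
  have stepa_odd : ∀ j, Even j → a (y (j + 1)) = y j :=
    fun j hj => by rw [← stepa_even j hj, ha]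
  have stepb_even : ∀ j, ¬ Even j → b (y (j + 1)) = y j :=
    fun j hj => by rw [← stepb_odd j hj, hb]
  have closed : ∀ x, (∃ j < K, y j = x) → (∃ j < K, y j = a x) ∧ (∃ j < K, y j = b x) := by
    rintro _ ⟨j, hj, rfl⟩
    by_cases hje : Even j
    · refine ⟨⟨j + 1, ?_, (stepa_even j hje).symm⟩, ?_⟩
      · rcases Nat.lt_or_ge (j + 1) K with h | h
        · exact h
        · obtain rfl : K = j + 1 := by omega
          exact absurd hje (by simpa [Nat.even_add_one] using hKe)
      · rcases j with _ | j
        · exact ⟨K - 1, by omega, hKpred.symm⟩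
        · exact ⟨j, by omega, (stepb_even j (by simpa [Nat.even_add_one] using hje)).symm⟩
    · refine ⟨?_, ?_⟩
      · rcases j with _ | j
        · simp at hje
        · exact ⟨j, by omega, (stepa_odd j (by simpa [Nat.even_add_one] using hje)).symm⟩
      · rcases Nat.lt_or_ge (j + 1) K with h | h
        · exact ⟨j + 1, h, (stepb_odd j hje).symm⟩
        · refine ⟨0, hK0, ?_⟩
          obtain rfl : K = j + 1 := by omega
          rw [stepb_odd j hje, hK, hy0]
  have cover : ∀ u v, Relation.EqvGen (fun u v => v = a u ∨ v = b u) u v →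
      ((∃ j < K, y j = u) ↔ (∃ j < K, y j = v)) := by
    intro u v h
    induction h with
    | rel u v h =>
      rcases h with rfl | rfl
      · exact ⟨fun h => (closed _ h).1, fun h => by simpa [ha] using (closed _ h).1⟩
      · exact ⟨fun h => (closed _ h).2, fun h => by simpa [hb] using (closed _ h).2⟩
    | refl => exact Iff.rfl
    | symm _ _ _ ih => exact ih.symm
    | trans _ _ _ _ _ ih1 ih2 => exact ih1.trans ih2
  set rk : α → ℕ := fun x => if h : ∃ j < K, y j = x then h.choose else 0 with hrk
  have rky : ∀ j < K, rk (y j) = j := by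
    intro j hj
    have h : ∃ k < K, y k = y j := ⟨j, hj, rfl⟩
    have e : rk (y j) = h.choose := by simp only [hrk]; rw [dif_pos h]
    rw [e]
    exact inj _ _ h.choose_spec.1 hj h.choose_spec.2
  refine ⟨rk, by simpa [hy0] using rky 0 hK0, fun x hx => ?_⟩
  obtain ⟨j, hj, rfl⟩ := (cover x₀ x hx).1 ⟨0, hK0, hy0⟩
  rw [rky j hj]
  refine ⟨fun h => by rw [h, hy0], fun h => ?_, fun h => ?_, fun h h0 => ?_, fun h => ?_⟩
  · rw [stepa_even j h]
    apply rky
    rcases Nat.lt_or_ge (j + 1) K with h' | h'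
    · exact h'
    · obtain rfl : K = j + 1 := by omega
      exact absurd h (by simpa [Nat.even_add_one] using hKe)
  · rcases j with _ | j
    · simp at h
    · rw [stepa_odd j (by simpa [Nat.even_add_one] using h), rky j (by omega)]
  · rcases j with _ | j
    · simp at h0
    · rw [stepb_even j (by simpa [Nat.even_add_one] using h), rky j (by omega)]
  · rcases Nat.lt_or_ge (j + 1) K with h' | h'
    · right
      rw [stepb_odd j h, rky _ h']
    · left
      obtain rfl : K = j + 1 := by omega
      rw [stepb_odd j h, hK]

end Dihedral

/-- Breadth-first search from `r` in a connected symmetric relation. -/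
theorem exists_bfs_depth {α : Type*} (R : α → α → Prop) (hsymm : ∀ x y, R x y → R y x) (r : α)
    (hconn : ∀ x, Relation.ReflTransGen R r x) :
    ∃ d : α → ℕ, d r = 0 ∧ (∀ x, d x = 0 → x = r) ∧ (∀ x y, R x y → d x ≤ d y + 1) ∧
      ∀ x, x ≠ r → ∃ y, R x y ∧ d y + 1 = d x := by
  let G : SimpleGraph α := SimpleGraph.fromRel R
  have hreach : ∀ x, G.Reachable r x := by
    intro x
    induction hconn x with
    | refl => exact SimpleGraph.Reachable.refl r
    | @tail y z _ h ih =>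
      by_cases hyz : y = z
      · exact hyz ▸ ih
      · exact ih.trans (SimpleGraph.Adj.reachable (by
          simp only [G, SimpleGraph.fromRel_adj]; exact ⟨hyz, Or.inl h⟩))
  have hG : G.Connected := by
    have : Nonempty α := ⟨r⟩
    exact SimpleGraph.Connected.mk fun x y => (hreach x).symm.trans (hreach y)
  have hadj : ∀ x y, R x y → G.dist r x ≤ G.dist r y + 1 := by
    intro x y h
    by_cases hxy : x = y
    · subst hxy; omega
    · have hA : G.Adj y x := by
        simp only [G, SimpleGraph.fromRel_adj]
        exact ⟨fun e => hxy e.symm, Or.inr h⟩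
      have h1 := hG.dist_triangle (u := r) (v := y) (w := x)
      rw [SimpleGraph.dist_eq_one_iff_adj.2 hA] at h1
      exact h1
  refine ⟨fun x => G.dist r x, by simp, fun x hx => ?_, hadj, fun x hx => ?_⟩
  · exact ((hreach x).dist_eq_zero_iff.1 hx).symm
  · obtain ⟨p, hp⟩ := (hreach x).exists_walk_length_eq_dist
    have hnil : ¬ p.reverse.Nil := by
      intro h
      exact hx h.eq
    have hA := p.reverse.adj_snd hnil
    have hR : R x p.reverse.snd := by
      simp only [G, SimpleGraph.fromRel_adj] at hA
      rcases hA.2 with h | h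
      · exact h
      · exact hsymm _ _ h
    refine ⟨_, hR, ?_⟩
    have h1 := hadj _ _ hR
    have h2 : G.dist r p.reverse.snd ≤ p.reverse.tail.length := by
      rw [SimpleGraph.dist_comm]
      exact SimpleGraph.dist_le _
    have h3 := SimpleGraph.Walk.length_tail_add_one hnil
    rw [SimpleGraph.Walk.length_reverse] at h3
    change G.dist r _ + 1 = G.dist r x
    omega

/-! ### The breadth-first tree and the connectedness of its complement -/

namespace CellularSurface

variable (S : CellularSurface)

instance : Finite S.Flag := S.finite_flag
instance : Finite S.Vertex := inferInstanceAs (Finite (Quot _))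
instance : Finite S.Edge := inferInstanceAs (Finite (Quot _))
instance : Finite S.Face := inferInstanceAs (Finite (Quot _))

/-- The edge of a flag. -/
def edgeOf (x : S.Flag) : S.Edge := Quot.mk _ x

/-- The face of a flag. -/
def faceOf (x : S.Flag) : S.Face := Quot.mk _ x

variable {S}

@[simp] theorem vertexOf_swapEdge (x : S.Flag) : S.vertexOf (S.swapEdge x) = S.vertexOf x := by
  symm; apply Quot.sound; exact Or.inl rfl

@[simp] theorem vertexOf_swapFace (x : S.Flag) : S.vertexOf (S.swapFace x) = S.vertexOf x := by
  symm; apply Quot.sound; exact Or.inr rfl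

@[simp] theorem edgeOf_swapFace (x : S.Flag) : S.edgeOf (S.swapFace x) = S.edgeOf x := by
  symm; apply Quot.sound; exact Or.inr rfl

@[simp] theorem faceOf_swapVertex (x : S.Flag) : S.faceOf (S.swapVertex x) = S.faceOf x := by
  symm; apply Quot.sound; exact Or.inl rfl

@[simp] theorem faceOf_swapEdge (x : S.Flag) : S.faceOf (S.swapEdge x) = S.faceOf x := by
  symm; apply Quot.sound; exact Or.inr rfl

theorem vertexOf_surjective : Function.Surjective S.vertexOf := Quot.mk_surjective

theorem faceOf_surjective : Function.Surjective S.faceOf := Quot.mk_surjective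

theorem eqvGen_of_vertexOf_eq {x y : S.Flag} (h : S.vertexOf x = S.vertexOf y) :
    Relation.EqvGen (fun u v => v = S.swapEdge u ∨ v = S.swapFace u) x y :=
  Quot.eqvGen_exact h

theorem eqvGen_of_faceOf_eq {x y : S.Flag} (h : S.faceOf x = S.faceOf y) :
    Relation.EqvGen (fun u v => v = S.swapVertex u ∨ v = S.swapEdge u) x y :=
  Quot.eqvGen_exact h

/-- An edge consists of at most four flags. -/
theorem eq_or_of_edgeOf_eq {x y : S.Flag} (h : S.edgeOf x = S.edgeOf y) :
    y = x ∨ y = S.swapVertex x ∨ y = S.swapFace x ∨ y = S.swapVertex (S.swapFace x) := by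
  have h' : Relation.EqvGen (fun u v => v = S.swapVertex u ∨ v = S.swapFace u) x y :=
    Quot.eqvGen_exact h
  induction h' with
  | rel x y h => tauto
  | refl => simp
  | symm x y _ ih =>
    rcases ih (Quot.eqvGen_sound ‹_›) with rfl | rfl | rfl | rfl <;>
      simp [S.swapVertex_invol, S.swapFace_invol, S.swap_comm]
  | trans x y z h1 h2 ih1 ih2 =>
    rcases ih1 (Quot.eqvGen_sound h1) with rfl | rfl | rfl | rfl <;>
    rcases ih2 (Quot.eqvGen_sound h2) with rfl | rfl | rfl | rfl <;>
    simp [S.swapVertex_invol, S.swapFace_invol, S.swap_comm]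

/-- A breadth-first spanning tree of the graph of the cell decomposition: `flag v` is a flag at `v`
of the edge joining `v` to its parent. -/
structure BFSTree (S : CellularSurface) where
  root : S.Vertex
  depth : S.Vertex → ℕ
  flag : S.Vertex → S.Flag
  depth_root : depth root = 0
  eq_root : ∀ v, depth v = 0 → v = root
  depth_le : ∀ x, depth (S.vertexOf x) ≤ depth (S.vertexOf (S.swapVertex x)) + 1
  vertexOf_flag : ∀ v, v ≠ root → S.vertexOf (flag v) = v
  depth_flag : ∀ v, v ≠ root → depth (S.vertexOf (S.swapVertex (flag v))) + 1 = depth v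

theorem exists_bfsTree (S : CellularSurface) : Nonempty S.BFSTree := by
  classical
  obtain ⟨x₀⟩ := S.nonempty_flag
  let R : S.Vertex → S.Vertex → Prop := fun u v =>
    ∃ x, S.vertexOf x = u ∧ S.vertexOf (S.swapVertex x) = v
  have hsymm : ∀ u v, R u v → R v u := by
    rintro u v ⟨x, rfl, rfl⟩
    exact ⟨S.swapVertex x, rfl, by rw [S.swapVertex_invol]⟩
  have hconn : ∀ v, Relation.ReflTransGen R (S.vertexOf x₀) v := by
    intro v
    obtain ⟨y, rfl⟩ := vertexOf_surjective v
    have key : ∀ x y, Relation.EqvGen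
        (fun a b => b = S.swapVertex a ∨ b = S.swapEdge a ∨ b = S.swapFace a) x y →
        Relation.ReflTransGen R (S.vertexOf x) (S.vertexOf y) := by
      intro x y h
      have : Std.Symm R := ⟨hsymm⟩
      induction h with
      | rel x y h =>
        rcases h with rfl | rfl | rfl
        · exact Relation.ReflTransGen.single ⟨x, rfl, rfl⟩
        · rw [vertexOf_swapEdge]
        · rw [vertexOf_swapFace]
      | refl => exact Relation.ReflTransGen.refl
      | symm _ _ _ ih => exact Std.Symm.symm _ _ ih
      | trans _ _ _ _ _ ih1 ih2 => exact ih1.trans ih2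
    exact key _ _ (S.connected x₀ y)
  obtain ⟨d, h0, h0', hle, hpar⟩ := exists_bfs_depth R hsymm _ hconn
  have hflag : ∀ v, ∃ x, v ≠ S.vertexOf x₀ →
      S.vertexOf x = v ∧ d (S.vertexOf (S.swapVertex x)) + 1 = d v := by
    intro v
    by_cases hv : v = S.vertexOf x₀
    · exact ⟨x₀, fun h => absurd hv h⟩
    · obtain ⟨_, ⟨x, hx, rfl⟩, h⟩ := hpar v hv
      exact ⟨x, fun _ => ⟨hx, h⟩⟩
  choose fl hfl using hflag
  exact ⟨⟨S.vertexOf x₀, d, fl, h0, h0', fun x => hle _ _ ⟨x, rfl, rfl⟩,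
    fun v hv => (hfl v hv).1, fun v hv => (hfl v hv).2⟩⟩

namespace BFSTree

variable (T : S.BFSTree)

open Classical in
/-- The parent of a vertex; the root is its own parent. -/
noncomputable def parent (v : S.Vertex) : S.Vertex :=
  if v = T.root then T.root else S.vertexOf (S.swapVertex (T.flag v))

/-- `v` is an ancestor of `w` (possibly `w` itself). -/
def IsAncestor (v w : S.Vertex) : Prop := ∃ k, T.parent^[k] w = v

/-- The edges of the tree. -/
def edges : Set S.Edge := (fun v => S.edgeOf (T.flag v)) '' {v | v ≠ T.root}

variable {T}

theorem parent_root : T.parent T.root = T.root := by simp [parent]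

theorem parent_of_ne {v : S.Vertex} (h : v ≠ T.root) :
    T.parent v = S.vertexOf (S.swapVertex (T.flag v)) := by simp [parent, h]

theorem depth_parent {v : S.Vertex} : T.depth (T.parent v) = T.depth v - 1 := by
  by_cases h : v = T.root
  · rw [h, parent_root, T.depth_root]
  · rw [parent_of_ne h, ← T.depth_flag v h]
    simp

theorem depth_iterate_parent (k : ℕ) (v : S.Vertex) :
    T.depth (T.parent^[k] v) = T.depth v - k := by
  induction k with
  | zero => simp
  | succ k ih => rw [Function.iterate_succ_apply', depth_parent, ih]; omega

theorem IsAncestor.refl (v : S.Vertex) : T.IsAncestor v v := ⟨0, rfl⟩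

theorem IsAncestor.trans {u v w : S.Vertex} (h1 : T.IsAncestor u v) (h2 : T.IsAncestor v w) :
    T.IsAncestor u w := by
  obtain ⟨k, rfl⟩ := h1
  obtain ⟨l, rfl⟩ := h2
  exact ⟨k + l, by rw [Function.iterate_add_apply]⟩

theorem isAncestor_parent (v : S.Vertex) : T.IsAncestor (T.parent v) v := ⟨1, rfl⟩

theorem isAncestor_root (v : S.Vertex) : T.IsAncestor T.root v :=
  ⟨T.depth v, T.eq_root _ (by rw [depth_iterate_parent]; simp)⟩

/-- An ancestor is determined by its depth. -/
theorem IsAncestor.eq_iterate {v w : S.Vertex} (h : T.IsAncestor v w) :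
    v = T.parent^[T.depth w - T.depth v] w := by
  obtain ⟨k, rfl⟩ := h
  rw [depth_iterate_parent]
  by_cases hk : k ≤ T.depth w
  · rw [show T.depth w - (T.depth w - k) = k by omega]
  · have h1 : T.parent^[k] w = T.root := T.eq_root _ (by rw [depth_iterate_parent]; omega)
    have h2 : T.parent^[T.depth w - (T.depth w - k)] w = T.root :=
      T.eq_root _ (by rw [depth_iterate_parent]; omega)
    rw [h1, h2]

/-- An ancestor other than the vertex itself is an ancestor via a child. -/
theorem IsAncestor.eq_or_exists_child {v w : S.Vertex} (h : T.IsAncestor v w) :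
    w = v ∨ ∃ c, c ≠ T.root ∧ T.parent c = v ∧ T.IsAncestor c w := by
  obtain ⟨k, hk⟩ := h
  induction k generalizing v with
  | zero => exact Or.inl hk
  | succ k ih =>
    rw [Function.iterate_succ_apply'] at hk
    by_cases hr : T.parent^[k] w = T.root
    · apply ih
      rw [hr, ← hk, hr, parent_root]
    · exact Or.inr ⟨_, hr, hk, k, rfl⟩

/-- If two vertices had the same parent edge, each would be the parent of the other, against the
depths. -/
theorem edgeOf_flag_injOn : Set.InjOn (fun v => S.edgeOf (T.flag v)) {v | v ≠ T.root} := by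
  have key : ∀ v w, v ≠ T.root → w ≠ T.root → S.edgeOf (T.flag v) = S.edgeOf (T.flag w) →
      w ≠ v → T.depth w + 1 = T.depth v := by
    intro v w hv hw h hne
    have hd := T.depth_flag v hv
    have hvv := T.vertexOf_flag v hv
    have hww := T.vertexOf_flag w hw
    rcases eq_or_of_edgeOf_eq h with e | e | e | e
    · exact absurd (by rw [← hww, e, hvv]) hne
    · rw [← e, hww] at hd
      exact hd
    · exact absurd (by rw [← hww, e, vertexOf_swapFace, hvv]) hne
    · rw [S.swap_comm] at e
      rw [← vertexOf_swapFace, ← e, hww] at hd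
      exact hd
  intro v hv w hw h
  by_contra hne
  have h1 := key v w hv hw h (fun e => hne e.symm)
  have h2 := key w v hw hv h.symm hne
  omega

theorem ncard_edges : T.edges.ncard + 1 = Nat.card S.Vertex := by
  rw [edges, Set.InjOn.ncard_image edgeOf_flag_injOn]
  have := Set.ncard_add_ncard_compl {T.root}
  rw [Set.ncard_singleton] at this
  rw [← this, add_comm]
  rfl

/-- The flags at the descendants of a vertex are related by every equivalence relation that is
closed under moving along edges and round corners and under crossing edges not in the tree. -/
theorem related_of_isAncestor (v : S.Vertex) (R : S.Flag → S.Flag → Prop) (hR : Equivalence R)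
    (hV : ∀ x, T.IsAncestor v (S.vertexOf x) → R x (S.swapVertex x))
    (hE : ∀ x, T.IsAncestor v (S.vertexOf x) → R x (S.swapEdge x))
    (hF : ∀ x, T.IsAncestor v (S.vertexOf x) → S.edgeOf x ∉ T.edges → R x (S.swapFace x))
    {x y : S.Flag} (hx : T.IsAncestor v (S.vertexOf x)) (hy : T.IsAncestor v (S.vertexOf y)) :
    R x y := by
  obtain ⟨N, hN⟩ : ∃ N, ∀ v, T.depth v ≤ N := by
    obtain ⟨N, hN⟩ := (Set.finite_range T.depth).bddAbove
    exact ⟨N, fun v => hN ⟨v, rfl⟩⟩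
  -- Induction from the deepest vertices upwards: `ihc` walks around the subtree of a child.
  induction hm : N - T.depth v using Nat.strong_induction_on generalizing v x y with
  | _ m ih =>
  subst hm
  have ihc : ∀ c, c ≠ T.root → T.parent c = v → ∀ x y, T.IsAncestor c (S.vertexOf x) →
      T.IsAncestor c (S.vertexOf y) → R x y := by
    intro c hc hcv x y hx hy
    have hvc : T.IsAncestor v c := hcv ▸ isAncestor_parent c
    have hd : T.depth v + 1 = T.depth c := by
      rw [← T.depth_flag c hc, ← parent_of_ne hc, hcv]
    have := hN c
    exact ih _ (by omega) c (fun x h => hV x (hvc.trans h)) (fun x h => hE x (hvc.trans h))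
      (fun x h => hF x (hvc.trans h)) hx hy rfl
  have base : ∃ x₀, S.vertexOf x₀ = v ∧ (v ≠ T.root → x₀ = T.flag v) := by
    by_cases hv : v = T.root
    · obtain ⟨x, hx⟩ := vertexOf_surjective v
      exact ⟨x, hx, fun h => absurd hv h⟩
    · exact ⟨T.flag v, T.vertexOf_flag v hv, fun _ => rfl⟩
  obtain ⟨x₀, hx₀, hx₀'⟩ := base
  -- Every edge end at `v` except the one at `x₀` can be passed: an edge outside the tree by
  -- crossing it, the edge to a child by going round the whole subtree of the child.
  have hVF : ∀ x, S.vertexOf x = v → x ≠ x₀ → x ≠ S.swapFace x₀ → R x (S.swapFace x) := by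
    intro x hx h1 h2
    by_cases he : S.edgeOf x ∈ T.edges
    · obtain ⟨w, hw, hwe⟩ := he
      have hw' : w ≠ T.root := hw
      have hvw := T.vertexOf_flag w hw'
      have hside : S.vertexOf (S.swapVertex x) = w → T.parent w = v → R x (S.swapFace x) := by
        intro hxw hv
        have hA : T.IsAncestor v (S.vertexOf x) := by rw [hx]; exact IsAncestor.refl v
        have hA' : T.IsAncestor v (S.vertexOf (S.swapFace x)) := by
          rw [vertexOf_swapFace]; exact hA
        refine hR.trans (hV x hA) (hR.trans ?_ (hR.symm (hV _ hA')))
        apply ihc w hw' hv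
        · rw [hxw]; exact IsAncestor.refl w
        · rw [S.swap_comm, vertexOf_swapFace, hxw]; exact IsAncestor.refl w
      rcases eq_or_of_edgeOf_eq hwe with e | e | e | e
      · exfalso
        have : w = v := by rw [← hvw, ← e, hx]
        subst this
        exact h1 (by rw [e, hx₀' hw'])
      · apply hside
        · rw [e, S.swapVertex_invol, hvw]
        · rw [parent_of_ne hw', ← hx, e]
      · exfalso
        have : w = v := by rw [← hvw, ← vertexOf_swapFace, ← e, hx]
        subst this
        exact h2 (by rw [e, hx₀' hw'])
      · apply hside
        · rw [e, S.swapVertex_invol, vertexOf_swapFace, hvw]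
        · rw [parent_of_ne hw', ← hx, e, S.swap_comm, vertexOf_swapFace]
    · exact hF x (by rw [hx]; exact IsAncestor.refl v) he
  -- The flags at `v` form a cycle. Only its link between `x₀` and `S.swapFace x₀`, across the
  -- parent edge, may be missing, and a cycle without one link is still connected. At the root the
  -- omitted link is arbitrary.
  have atv : ∀ x, S.vertexOf x = v → R x x₀ := by
    obtain ⟨rk, hrk0, hrk⟩ := exists_rank_of_involutions S.swapEdge_invol S.swapFace_invol
      S.swapEdge_ne S.swapFace_ne x₀
    have key : ∀ n x, S.vertexOf x = v → rk x = n → R x x₀ := by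
      intro n
      induction n with
      | zero =>
        intro x hx h0
        rw [(hrk x (eqvGen_of_vertexOf_eq (hx₀.trans hx.symm))).1 h0]
        exact hR.refl _
      | succ n ihn =>
        intro x hx hn
        obtain ⟨-, -, h3, h4, -⟩ := hrk x (eqvGen_of_vertexOf_eq (hx₀.trans hx.symm))
        by_cases hev : Even (rk x)
        · have h5 := h4 hev (by omega)
          refine hR.trans (hVF x hx ?_ ?_) (ihn (S.swapFace x) (by simpa using hx) (by omega))
          · rintro rfl
            omega
          · rintro rfl
            rw [S.swapFace_invol, hrk0] at h5
            rw [← h5] at hev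
            simp at hev
        · exact hR.trans (hE x (by rw [hx]; exact IsAncestor.refl v))
            (ihn (S.swapEdge x) (by simpa using hx) (by have := h3 hev; omega))
    exact fun x hx => key _ x hx rfl
  have all : ∀ x, T.IsAncestor v (S.vertexOf x) → R x x₀ := by
    intro x hx
    rcases hx.eq_or_exists_child with h | ⟨c, hc, hcv, hcx⟩
    · exact atv x h
    · have hcf := T.vertexOf_flag c hc
      have hvc : T.IsAncestor v c := hcv ▸ isAncestor_parent c
      refine hR.trans (ihc c hc hcv x (T.flag c) hcx (by rw [hcf]; exact IsAncestor.refl c)) ?_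
      refine hR.trans (hV _ (by rw [hcf]; exact hvc)) (atv _ ?_)
      rw [← parent_of_ne hc, hcv]
  exact hR.trans (all x hx) (hR.symm (all y hy))

end BFSTree

end CellularSurface

/-! ### The cotree and the excess edges -/

namespace CellularSurface

variable {S : CellularSurface}

namespace BFSTree

variable (T : S.BFSTree)

/-- A spanning tree of the dual graph that avoids the edges of `T`: `entry f` is a flag of the face
`f` on the edge leading to the parent of `f`. -/
structure Cotree where
  root : S.Face
  depth : S.Face → ℕ
  entry : S.Face → S.Flag
  faceOf_entry : ∀ f, S.faceOf (entry f) = f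
  depth_entry : ∀ f, f ≠ root → depth (S.faceOf (S.swapFace (entry f))) + 1 = depth f
  edgeOf_entry : ∀ f, f ≠ root → S.edgeOf (entry f) ∉ T.edges

/-- `related_of_isAncestor` at the root shows that the dual graph without the edges crossing `T` is
connected; breadth-first search in it gives the cotree. -/
theorem exists_cotree : Nonempty T.Cotree := by
  classical
  obtain ⟨x₀⟩ := S.nonempty_flag
  let R : S.Face → S.Face → Prop := fun f f' =>
    ∃ x, S.edgeOf x ∉ T.edges ∧ S.faceOf x = f ∧ S.faceOf (S.swapFace x) = f'
  have hsymm : ∀ u v, R u v → R v u := by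
    rintro u v ⟨x, hx, rfl, rfl⟩
    exact ⟨S.swapFace x, by simpa using hx, rfl, by rw [S.swapFace_invol]⟩
  have hconn : ∀ f, Relation.ReflTransGen R (S.faceOf x₀) f := by
    intro f
    obtain ⟨y, rfl⟩ := faceOf_surjective f
    have : Std.Symm R := ⟨hsymm⟩
    apply related_of_isAncestor (T := T) T.root
      (fun x y => Relation.ReflTransGen R (S.faceOf x) (S.faceOf y))
      ⟨fun _ => Relation.ReflTransGen.refl, fun h => Std.Symm.symm _ _ h, fun h h' => h.trans h'⟩
    · intro x _
      rw [faceOf_swapVertex]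
    · intro x _
      rw [faceOf_swapEdge]
    · intro x _ hx
      exact Relation.ReflTransGen.single ⟨x, hx, rfl, rfl⟩
    · exact isAncestor_root _
    · exact isAncestor_root _
  obtain ⟨d, -, -, -, hpar⟩ := exists_bfs_depth R hsymm _ hconn
  have hflag : ∀ f, ∃ x, S.faceOf x = f ∧ (f ≠ S.faceOf x₀ →
      d (S.faceOf (S.swapFace x)) + 1 = d f ∧ S.edgeOf x ∉ T.edges) := by
    intro f
    by_cases hf : f = S.faceOf x₀
    · exact ⟨x₀, hf.symm, fun h => absurd hf h⟩
    · obtain ⟨_, ⟨x, hx, hxf, rfl⟩, h⟩ := hpar f hf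
      exact ⟨x, hxf, fun _ => ⟨h, hx⟩⟩
  choose fl hfl using hflag
  exact ⟨⟨S.faceOf x₀, d, fl, fun f => (hfl f).1, fun f hf => ((hfl f).2 hf).1,
    fun f hf => ((hfl f).2 hf).2⟩⟩

end BFSTree

namespace BFSTree.Cotree

variable {T : S.BFSTree} (D : T.Cotree)

/-- The edges crossed by the cotree. -/
def edges : Set S.Edge := (fun f => S.edgeOf (D.entry f)) '' {f | f ≠ D.root}

theorem ncard_edges : D.edges.ncard + 1 = Nat.card S.Face := by
  have hinj : Set.InjOn (fun f => S.edgeOf (D.entry f)) {f | f ≠ D.root} := by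
    have key : ∀ v w, v ≠ D.root → S.edgeOf (D.entry v) = S.edgeOf (D.entry w) →
        w ≠ v → D.depth w + 1 = D.depth v := by
      intro v w hv h hne
      have hd := D.depth_entry v hv
      have hvv := D.faceOf_entry v
      have hww := D.faceOf_entry w
      rcases eq_or_of_edgeOf_eq h with e | e | e | e
      · exact absurd (by rw [← hww, e, hvv]) hne
      · exact absurd (by rw [← hww, e, faceOf_swapVertex, hvv]) hne
      · rw [← e, hww] at hd
        exact hd
      · rw [← faceOf_swapVertex, ← e, hww] at hd
        exact hd
    intro v hv w hw h
    by_contra hne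
    have h1 := key v w hv h (fun e => hne e.symm)
    have h2 := key w v hw h.symm hne
    omega
  rw [edges, Set.InjOn.ncard_image hinj]
  have := Set.ncard_add_ncard_compl {D.root}
  rw [Set.ncard_singleton] at this
  rw [← this, add_comm]
  rfl

/-- The edges that are neither in the tree nor crossed by the cotree. -/
def excess : Set S.Edge := (T.edges ∪ D.edges)ᶜ

/-- The number of excess edges is the Euler genus. -/
theorem ncard_excess : (D.excess.ncard : ℤ) = S.eulerGenus := by
  have hdisj : Disjoint T.edges D.edges := by
    rw [Set.disjoint_right]
    rintro _ ⟨f, hf, rfl⟩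
    exact D.edgeOf_entry f hf
  have h1 := Set.ncard_add_ncard_compl (T.edges ∪ D.edges)
  rw [Set.ncard_union_eq hdisj] at h1
  have h2 := T.ncard_edges
  have h3 := D.ncard_edges
  -- The excess is `|E| - (|V| - 1) - (|F| - 1) = 2 - χ`, since tree and cotree share no edge.
  rw [eulerGenus, eulerChar, excess, ← h1, ← h2, ← h3]
  push_cast
  ring

/-- The vertices that are ancestors of an end of an excess edge. -/
def cutSet : Set S.Vertex := {v | ∃ x, S.edgeOf x ∈ D.excess ∧ T.IsAncestor v (S.vertexOf x)}

/-- A vertex has at most one ancestor at a given depth, and each excess edge has two ends. -/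
theorem ncard_cutSet_depth_le (l : ℕ) :
    {v | v ∈ D.cutSet ∧ T.depth v = l}.ncard ≤ 2 * D.excess.ncard := by
  have hsub : {v | v ∈ D.cutSet ∧ T.depth v = l} ⊆
      (fun e => T.parent^[T.depth (S.vertexOf e.out) - l] (S.vertexOf e.out)) '' D.excess ∪
      (fun e => T.parent^[T.depth (S.vertexOf (S.swapVertex e.out)) - l]
        (S.vertexOf (S.swapVertex e.out))) '' D.excess := by
    rintro v ⟨⟨x, hx, hv⟩, rfl⟩
    have h := hv.eq_iterate
    have he : S.edgeOf (S.edgeOf x).out = S.edgeOf x := Quot.out_eq _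
    have hends : S.vertexOf x = S.vertexOf (S.edgeOf x).out ∨
        S.vertexOf x = S.vertexOf (S.swapVertex (S.edgeOf x).out) := by
      rcases eq_or_of_edgeOf_eq he with e | e | e | e
      · exact Or.inl (congrArg _ e)
      · exact Or.inr (congrArg _ e)
      · exact Or.inl ((congrArg _ e).trans (vertexOf_swapFace _))
      · rw [S.swap_comm] at e
        exact Or.inr ((congrArg _ e).trans (vertexOf_swapFace _))
    rcases hends with e | e
    · exact Or.inl ⟨_, hx, by simp only [← e]; exact h.symm⟩
    · exact Or.inr ⟨_, hx, by simp only [← e]; exact h.symm⟩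
  refine (Set.ncard_le_ncard hsub (Set.toFinite _)).trans ((Set.ncard_union_le _ _).trans ?_)
  have h1 := Set.ncard_image_le (s := D.excess) (Set.toFinite _)
    (f := fun e => T.parent^[T.depth (S.vertexOf e.out) - l] (S.vertexOf e.out))
  have h2 := Set.ncard_image_le (s := D.excess) (Set.toFinite _)
    (f := fun e => T.parent^[T.depth (S.vertexOf (S.swapVertex e.out)) - l]
        (S.vertexOf (S.swapVertex e.out)))
  omega

/-- The boundary of a face is an orbit of `swapVertex` and `swapEdge`. It is cut at the corner of
the entry flag, so that each flag has a position on a path that starts there. -/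
theorem exists_rank : ∃ rk : S.Flag → ℕ, (∀ f, rk (D.entry f) = 0) ∧
    (∀ x, rk x = 0 → x = D.entry (S.faceOf x)) ∧
    (∀ x, Even (rk x) → rk (S.swapVertex x) = rk x + 1) ∧
    (∀ x, ¬ Even (rk x) → rk (S.swapVertex x) + 1 = rk x) ∧
    (∀ x, Even (rk x) → rk x ≠ 0 → rk (S.swapEdge x) + 1 = rk x) ∧
    (∀ x, ¬ Even (rk x) → S.swapEdge x = D.entry (S.faceOf x) ∨
      rk (S.swapEdge x) = rk x + 1) := by
  choose r hr0 hr using fun f => exists_rank_of_involutions S.swapVertex_invol S.swapEdge_invol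
    S.swapVertex_ne S.swapEdge_ne (D.entry f)
  have hr' := fun x => hr (S.faceOf x) x (eqvGen_of_faceOf_eq (D.faceOf_entry _))
  refine ⟨fun x => r (S.faceOf x) x, fun f => ?_, fun x => (hr' x).1, fun x => ?_, fun x => ?_,
    fun x => ?_, fun x => ?_⟩
  · simp only [D.faceOf_entry]
    exact hr0 f
  · simpa only [faceOf_swapVertex] using (hr' x).2.1
  · simpa only [faceOf_swapVertex] using (hr' x).2.2.1
  · simpa only [faceOf_swapEdge] using (hr' x).2.2.2.1
  · simpa only [faceOf_swapEdge] using (hr' x).2.2.2.2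

end BFSTree.Cotree

end CellularSurface

/-! ### The tree of flags and its bags -/

namespace CellularSurface.BFSTree.Cotree

variable {S : CellularSurface} {T : S.BFSTree} (D : T.Cotree)

/-- The flags whose bag contains the vertex `v`: the bag of `x` consists of the ancestors of the
ends of the edge of `x` and of the vertex at which the face of `x` is entered. -/
def bag (v : S.Vertex) : Set S.Flag :=
  {x | T.IsAncestor v (S.vertexOf x) ∨ T.IsAncestor v (S.vertexOf (S.swapVertex x)) ∨
    T.IsAncestor v (S.vertexOf (D.entry (S.faceOf x)))}

theorem ncard_bag_depth_le (x : S.Flag) (l : ℕ) :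
    {v | x ∈ D.bag v ∧ T.depth v = l}.ncard ≤ 3 := by
  let up : S.Vertex → S.Vertex := fun w => T.parent^[T.depth w - l] w
  have hsub : {v | x ∈ D.bag v ∧ T.depth v = l} ⊆ {up (S.vertexOf x),
      up (S.vertexOf (S.swapVertex x)), up (S.vertexOf (D.entry (S.faceOf x)))} := by
    rintro v ⟨hx, rfl⟩
    rcases hx with h | h | h
    · exact Or.inl h.eq_iterate
    · exact Or.inr (Or.inl h.eq_iterate)
    · exact Or.inr (Or.inr h.eq_iterate)
  refine (Set.ncard_le_ncard hsub (Set.toFinite _)).trans ?_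
  refine (Set.ncard_insert_le _ _).trans ?_
  have := Set.ncard_insert_le (up (S.vertexOf (S.swapVertex x)))
    {up (S.vertexOf (D.entry (S.faceOf x)))}
  rw [Set.ncard_singleton] at this
  omega

open Classical in
/-- The parent in the tree obtained from the face boundaries, each cut open at its entry flag, by
joining every face to its parent in the cotree. -/
noncomputable def flagParent (rk : S.Flag → ℕ) (x : S.Flag) : S.Flag :=
  if rk x = 0 then if S.faceOf x = D.root then x else S.swapFace x
  else if Even (rk x) then S.swapEdge x else S.swapVertex x

/-- Being joined inside the bag is an equivalence to which `related_of_isAncestor` applies: around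
the subtree below `v`, each move along an edge, round a corner or across a non-tree edge can be made
within the bag. Hence all flags at descendants of `v` are joined, and every other flag of the bag is
joined to one of them. -/
theorem bag_connected {v : S.Vertex} (hv : v ∉ D.cutSet) (rk : S.Flag → ℕ)
    (hr1 : ∀ f, rk (D.entry f) = 0) (hr2 : ∀ x, rk x = 0 → x = D.entry (S.faceOf x))
    (hr3 : ∀ x, Even (rk x) → rk (S.swapVertex x) = rk x + 1)
    (hr4 : ∀ x, ¬ Even (rk x) → rk (S.swapVertex x) + 1 = rk x)
    (hr5 : ∀ x, Even (rk x) → rk x ≠ 0 → rk (S.swapEdge x) + 1 = rk x)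
    (hr6 : ∀ x, ¬ Even (rk x) → S.swapEdge x = D.entry (S.faceOf x) ∨
      rk (S.swapEdge x) = rk x + 1) {x y : S.Flag} (hx : x ∈ D.bag v) (hy : y ∈ D.bag v) :
    Relation.EqvGen (fun a b => a ∈ D.bag v ∧ b ∈ D.bag v ∧ b = D.flagParent rk a) x y := by
  set C := Relation.EqvGen (fun a b => a ∈ D.bag v ∧ b ∈ D.bag v ∧ b = D.flagParent rk a) with hC
  have hEq : Equivalence C := Relation.EqvGen.is_equivalence _
  have hstep : ∀ a b, a ∈ D.bag v → b ∈ D.bag v → b = D.flagParent rk a → C a b :=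
    fun a b ha hb h => Relation.EqvGen.rel _ _ ⟨ha, hb, h⟩
  have hsv : ∀ x, x ∈ D.bag v → S.swapVertex x ∈ D.bag v := by
    intro x hx
    simp only [bag, Set.mem_ofPred_eq, S.swapVertex_invol, faceOf_swapVertex] at hx ⊢
    tauto
  have hp_odd : ∀ x, ¬ Even (rk x) → D.flagParent rk x = S.swapVertex x := by
    intro x h
    have h0 : rk x ≠ 0 := fun h0 => h (by simp [h0])
    simp [flagParent, h0, h]
  have hp_even : ∀ x, Even (rk x) → rk x ≠ 0 → D.flagParent rk x = S.swapEdge x := by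
    intro x h h0
    simp [flagParent, h0, h]
  have hp_zero : ∀ x, rk x = 0 → S.faceOf x ≠ D.root → D.flagParent rk x = S.swapFace x := by
    intro x h h0
    simp [flagParent, h0, h]
  have c1 : ∀ x, x ∈ D.bag v → C x (S.swapVertex x) := by
    intro x hx
    by_cases h : Even (rk x)
    · refine hEq.symm (hstep _ _ (hsv x hx) hx ?_)
      rw [hp_odd, S.swapVertex_invol]
      rw [hr3 x h, Nat.even_add_one]
      exact fun h' => h' h
    · exact hstep _ _ hx (hsv x hx) (hp_odd x h).symm
  -- If the entry vertex of a face lies below `v`, all flags of that face are in the bag, and the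
  -- whole path down to the entry flag is available.
  have c2 : ∀ n x, rk x = n → T.IsAncestor v (S.vertexOf (D.entry (S.faceOf x))) →
      C x (D.entry (S.faceOf x)) := by
    intro n
    induction n with
    | zero =>
      intro x h _
      rw [← hr2 x h]
      exact hEq.refl x
    | succ n ih =>
      intro x h hA
      have hxb : x ∈ D.bag v := Or.inr (Or.inr hA)
      by_cases he : Even (rk x)
      · have h1 := hr5 x he (by omega)
        have h2 := ih (S.swapEdge x) (by omega) (by rwa [faceOf_swapEdge])
        rw [faceOf_swapEdge] at h2
        refine hEq.trans (hstep _ _ hxb ?_ (hp_even x he (by omega)).symm) h2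
        exact Or.inr (Or.inr (by rwa [faceOf_swapEdge]))
      · have h1 := hr4 x he
        have h2 := ih (S.swapVertex x) (by omega) (by rwa [faceOf_swapVertex])
        rw [faceOf_swapVertex] at h2
        exact hEq.trans (hstep _ _ hxb (hsv x hxb) (hp_odd x he).symm) h2
  have c2' : ∀ x, T.IsAncestor v (S.vertexOf (D.entry (S.faceOf x))) →
      C x (S.swapEdge x) := by
    intro x hA
    refine hEq.trans (c2 _ x rfl hA) (hEq.symm ?_)
    have := c2 _ (S.swapEdge x) rfl (by rwa [faceOf_swapEdge])
    rwa [faceOf_swapEdge] at this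
  -- A corner is a link of the tree of flags unless it is the one at which the face was cut open. In
  -- that case the entry vertex lies below `v`, and the detour round the face stays in the bag.
  have c3 : ∀ x, T.IsAncestor v (S.vertexOf x) → C x (S.swapEdge x) := by
    intro x hA
    have hxb : x ∈ D.bag v := Or.inl hA
    have hxb' : S.swapEdge x ∈ D.bag v := Or.inl (by rwa [vertexOf_swapEdge])
    by_cases he : Even (rk x)
    · by_cases h0 : rk x = 0
      · apply c2'
        rwa [← hr2 x h0]
      · exact hstep _ _ hxb hxb' (hp_even x he h0).symm
    · rcases hr6 x he with h | h
      · apply c2'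
        rwa [← h, vertexOf_swapEdge]
      · refine hEq.symm (hstep _ _ hxb' hxb ?_)
        rw [hp_even, S.swapEdge_invol]
        · rw [h, Nat.even_add_one]
          exact he
        · omega
  have c4 : ∀ x, T.IsAncestor v (S.vertexOf x) → S.edgeOf x ∉ T.edges → C x (S.swapFace x) := by
    intro x hA hnT
    have hxb : x ∈ D.bag v := Or.inl hA
    have hxb' : S.swapFace x ∈ D.bag v := Or.inl (by rwa [vertexOf_swapFace])
    -- The only use of `v ∉ D.cutSet`: an edge with an end below `v` is not excess. So the cotree
    -- crosses it, at one of its four flags.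
    have hD : S.edgeOf x ∈ D.edges := by
      by_contra hnD
      exact hv ⟨x, fun h => h.elim hnT hnD, hA⟩
    obtain ⟨f, hf, hfe⟩ := hD
    have hpar : D.flagParent rk (D.entry f) = S.swapFace (D.entry f) :=
      hp_zero _ (hr1 f) (by rw [D.faceOf_entry]; exact hf)
    rcases eq_or_of_edgeOf_eq hfe with e | e | e | e
    · exact hstep _ _ hxb hxb' (by rw [e, hpar])
    · have e' : S.swapVertex x = D.entry f := by rw [e, S.swapVertex_invol]
      refine hEq.trans (c1 x hxb) (hEq.trans (hstep _ (S.swapVertex (S.swapFace x)) (hsv x hxb)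
        (hsv _ hxb') ?_) (hEq.symm (c1 _ hxb')))
      rw [e', hpar, ← e', S.swap_comm]
    · exact hEq.symm (hstep _ _ hxb' hxb (by rw [e, S.swapFace_invol, hpar]))
    · have e' : S.swapVertex (S.swapFace x) = D.entry f := by
        rw [e, S.swap_comm (D.entry f), S.swapFace_invol, S.swapVertex_invol]
      refine hEq.trans (c1 x hxb) (hEq.trans (hEq.symm (hstep (S.swapVertex (S.swapFace x))
        (S.swapVertex x) (hsv _ hxb') (hsv x hxb) ?_)) (hEq.symm (c1 _ hxb')))
      rw [e', hpar, ← e', S.swap_comm, S.swapFace_invol]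
  have hdesc : ∀ x, x ∈ D.bag v → ∃ y, T.IsAncestor v (S.vertexOf y) ∧ C x y := by
    intro x hx
    rcases hx with h | h | h
    · exact ⟨x, h, hEq.refl x⟩
    · exact ⟨_, h, c1 x (Or.inr (Or.inl h))⟩
    · exact ⟨_, h, c2 _ x rfl h⟩
  obtain ⟨x', hx', hxx'⟩ := hdesc x hx
  obtain ⟨y', hy', hyy'⟩ := hdesc y hy
  exact hEq.trans hxx' (hEq.trans (related_of_isAncestor v C hEq (fun x h => c1 x (Or.inl h)) c3 c4
    hx' hy') (hEq.symm hyy'))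

end CellularSurface.BFSTree.Cotree

/-! ### Layered tree decompositions -/

/-- A tree on `N`, given by the parent function `parent` with root `root`, together with subtrees
`bag v` of the vertices `v ∉ X` of `G`, and a layering of `G`. Adjacent vertices outside `X` have
intersecting subtrees, every node is in at most three subtrees from each layer, and every layer has
at most `k` vertices in `X`. -/
structure SimpleGraph.LayeredTreeDecomposition {V : Type*} (G : SimpleGraph V) (k : ℕ) where
  N : Type
  finite_N : Finite N
  parent : N → N
  depth : N → ℕ
  root : N
  parent_root : parent root = root
  depth_parent_lt : ∀ x, x ≠ root → depth (parent x) < depth x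
  layer : V → ℕ
  X : Set V
  bag : V → Set N
  layer_le : ∀ u v, G.Adj u v → layer u ≤ layer v + 1
  ncard_X_le : ∀ l, {v | v ∈ X ∧ layer v = l}.ncard ≤ k
  bag_nonempty : ∀ v, (bag v).Nonempty
  bag_connected : ∀ v, v ∉ X → ∀ x ∈ bag v, ∀ y ∈ bag v,
    Relation.EqvGen (fun a b => a ∈ bag v ∧ b ∈ bag v ∧ b = parent a) x y
  bag_inter : ∀ u v, G.Adj u v → (bag u ∩ bag v).Nonempty
  ncard_bag_le : ∀ x l, {v | x ∈ bag v ∧ layer v = l}.ncard ≤ 3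

-- The layers are the depths in the breadth-first tree. A flag on an edge of `G` has both ends of
-- that edge in its bag, which gives `bag_inter`.
open CellularSurface BFSTree in
theorem SimpleGraph.EmbedsInEulerGenus.exists_layeredTreeDecomposition {V : Type*}
    {G : SimpleGraph V} {g : ℕ} (h : G.EmbedsInEulerGenus g) :
    Nonempty (G.LayeredTreeDecomposition (2 * g)) := by
  obtain ⟨S, hg, f, hf, hadj⟩ := h
  obtain ⟨T⟩ := exists_bfsTree S
  obtain ⟨D⟩ := T.exists_cotree
  obtain ⟨rk, hr1, hr2, hr3, hr4, hr5, hr6⟩ := D.exists_rank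
  obtain ⟨M, hM⟩ : ∃ M, ∀ x, rk x < M := by
    obtain ⟨M, hM⟩ := (Set.finite_range rk).bddAbove
    exact ⟨M + 1, fun x => Nat.lt_succ_of_le (hM ⟨x, rfl⟩)⟩
  have hcard : ∀ s : Set S.Vertex, {v | f v ∈ s}.ncard ≤ s.ncard := fun s =>
    Set.ncard_le_ncard_of_injOn f (fun v hv => hv) hf.injOn (Set.toFinite _)
  -- The depth is lexicographic: first the depth of the face in the cotree, then the position on its
  -- boundary. Passing to the parent face may increase the position, but by less than `M`.
  refine ⟨⟨S.Flag, inferInstance, D.flagParent rk, fun x => D.depth (S.faceOf x) * M + rk x,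
    D.entry D.root, ?_, ?_, fun v => T.depth (f v), {v | f v ∈ D.cutSet}, fun v => D.bag (f v),
    ?_, ?_, ?_, ?_, ?_, ?_⟩⟩
  · simp [Cotree.flagParent, hr1, D.faceOf_entry]
  · intro x hx
    by_cases h0 : rk x = 0
    · by_cases hroot : S.faceOf x = D.root
      · exact absurd (by rw [hr2 x h0, hroot]) hx
      · have e : D.flagParent rk x = S.swapFace x := by simp [Cotree.flagParent, h0, hroot]
        have hd := D.depth_entry _ hroot
        rw [← hr2 x h0] at hd
        rw [e, ← hd]
        have := hM (S.swapFace x)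
        rw [add_mul]
        omega
    · by_cases he : Even (rk x)
      · have e : D.flagParent rk x = S.swapEdge x := by simp [Cotree.flagParent, h0, he]
        have := hr5 x he h0
        rw [e, faceOf_swapEdge]
        omega
      · have e : D.flagParent rk x = S.swapVertex x := by simp [Cotree.flagParent, h0, he]
        have := hr4 x he
        rw [e, faceOf_swapVertex]
        omega
  · intro u v huv
    obtain ⟨x, hx, hx'⟩ := hadj u v huv
    rw [← hx, ← hx']
    exact T.depth_le x
  · intro l
    have h1 := D.ncard_cutSet_depth_le l
    have h2 := D.ncard_excess
    have h3 : D.excess.ncard = g := by exact_mod_cast h2.trans hg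
    rw [h3] at h1
    exact (hcard {v | v ∈ D.cutSet ∧ T.depth v = l}).trans h1
  · intro v
    obtain ⟨x, hx⟩ := vertexOf_surjective (f v)
    exact ⟨x, Or.inl (by rw [hx]; exact IsAncestor.refl _)⟩
  · intro v hv x hx y hy
    exact D.bag_connected hv rk hr1 hr2 hr3 hr4 hr5 hr6 hx hy
  · intro u v huv
    obtain ⟨x, hx, hx'⟩ := hadj u v huv
    exact ⟨x, Or.inl (by rw [hx]; exact IsAncestor.refl _),
      Or.inr (Or.inl (by rw [hx']; exact IsAncestor.refl _))⟩
  · intro x l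
    exact (hcard {v | x ∈ D.bag v ∧ T.depth v = l}).trans (D.ncard_bag_depth_le x l)

/-- If every layer of `s` has at most `k` elements, then `s` can be indexed by `k` numbers such that
the elements of each layer get different indices. -/
theorem exists_index_injOn_layers {V : Type*} [Finite V] (s : Set V) (layer : V → ℕ) (k : ℕ)
    (h : ∀ l, {v | v ∈ s ∧ layer v = l}.ncard ≤ k) :
    ∃ idx : V → ℕ, (∀ v ∈ s, idx v < k) ∧
      ∀ u ∈ s, ∀ v ∈ s, layer u = layer v → idx u = idx v → u = v := by
  classical
  let t : ℕ → Set V := fun l => {v | v ∈ s ∧ layer v = l}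
  let f : ℕ → V → ℕ := fun l v => if hv : v ∈ t l then Finite.equivFin (t l) ⟨v, hv⟩ else 0
  have hf : ∀ l v (hv : v ∈ t l), f l v = Finite.equivFin (t l) ⟨v, hv⟩ := fun l v hv => dif_pos hv
  refine ⟨fun v => f (layer v) v, fun v hv => ?_, fun u hu v hv hl he => ?_⟩
  · simp only [hf (layer v) v ⟨hv, rfl⟩]
    exact (Fin.isLt _).trans_le (h (layer v))
  · simp only [hl] at he
    rw [hf (layer v) u ⟨hu, hl⟩, hf (layer v) v ⟨hv, rfl⟩] at he
    exact congrArg Subtype.val ((Finite.equivFin (t (layer v))).injective (Fin.ext he))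

/-- Greedy colouring of a 2-degenerate graph. -/
theorem SimpleGraph.exists_three_colouring {V : Type*} [Finite V] (H : SimpleGraph V)
    (h : ∀ A : Finset V, A.Nonempty → ∃ v ∈ A, {u | u ∈ A ∧ H.Adj v u}.ncard ≤ 2) :
    ∃ col : V → ℕ, (∀ v, col v < 3) ∧ ∀ u v, H.Adj u v → col u ≠ col v := by
  classical
  have key : ∀ n, ∀ A : Finset V, A.card = n →
      ∃ col : V → ℕ, (∀ v, col v < 3) ∧ ∀ u ∈ A, ∀ v ∈ A, H.Adj u v → col u ≠ col v := by
    intro n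
    induction n with
    | zero =>
      intro A hA
      rw [Finset.card_eq_zero] at hA
      exact ⟨fun _ => 0, by simp, by simp [hA]⟩
    | succ n ih =>
      intro A hA
      obtain ⟨v, hv, hdeg⟩ := h A (Finset.card_pos.1 (by omega))
      obtain ⟨col, hc, hcol⟩ := ih (A.erase v) (by rw [Finset.card_erase_of_mem hv]; omega)
      obtain ⟨c, hc3, hcn⟩ : ∃ c < 3, ∀ u ∈ A, H.Adj v u → col u ≠ c := by
        by_contra hcon
        push Not at hcon
        have hsub : (Finset.range 3 : Set ℕ) ⊆ col '' {u | u ∈ A ∧ H.Adj v u} := by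
          intro c hcr
          obtain ⟨u, hu, ha, he⟩ := hcon c (by simpa using hcr)
          exact ⟨u, ⟨hu, ha⟩, he⟩
        have h1 := Set.ncard_le_ncard hsub (Set.toFinite _)
        have h2 := Set.ncard_image_le (s := {u | u ∈ A ∧ H.Adj v u}) (Set.toFinite _) (f := col)
        rw [Set.ncard_coe_finset, Finset.card_range] at h1
        omega
      refine ⟨Function.update col v c, fun u => ?_, fun u hu w hw ha => ?_⟩
      · by_cases huv : u = v
        · rw [huv, Function.update_self]; exact hc3
        · rw [Function.update_of_ne huv]; exact hc u
      · by_cases huv : u = v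
        · have hwv : w ≠ v := fun e => ha.ne (huv.trans e.symm)
          rw [huv, Function.update_self, Function.update_of_ne hwv]
          exact (hcn w hw (huv ▸ ha)).symm
        · by_cases hwv : w = v
          · rw [hwv, Function.update_self, Function.update_of_ne huv]
            exact hcn u hu (hwv ▸ ha.symm)
          · rw [Function.update_of_ne huv, Function.update_of_ne hwv]
            exact hcol u (Finset.mem_erase.2 ⟨huv, hu⟩) w (Finset.mem_erase.2 ⟨hwv, hw⟩) ha
  have := Fintype.ofFinite V
  obtain ⟨col, h1, h2⟩ := key _ Finset.univ rfl
  exact ⟨col, h1, fun u v => h2 u (Finset.mem_univ u) v (Finset.mem_univ v)⟩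

/-! ### Subtrees, colouring of layers and recursive separation -/

namespace SimpleGraph.LayeredTreeDecomposition

variable {V : Type*} {G : SimpleGraph V} {k : ℕ} (D : G.LayeredTreeDecomposition k)

instance : Finite D.N := D.finite_N

/-- The descendants of a node, including the node itself. -/
def desc (t : D.N) : Set D.N := {x | ∃ j, D.parent^[j] x = t}

variable {D}

theorem depth_parent_le (x : D.N) : D.depth (D.parent x) ≤ D.depth x := by
  by_cases h : x = D.root
  · rw [h, D.parent_root]
  · exact (D.depth_parent_lt x h).le

theorem depth_iterate_le (j : ℕ) (x : D.N) : D.depth (D.parent^[j] x) ≤ D.depth x := by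
  induction j with
  | zero => exact le_rfl
  | succ j ih =>
    rw [Function.iterate_succ_apply']
    exact (depth_parent_le _).trans ih

theorem mem_desc_root (x : D.N) : x ∈ D.desc D.root := by
  induction h : D.depth x using Nat.strong_induction_on generalizing x with
  | _ n ih =>
    by_cases hx : x = D.root
    · exact ⟨0, hx⟩
    · obtain ⟨j, hj⟩ := ih _ (h ▸ D.depth_parent_lt x hx) (D.parent x) rfl
      exact ⟨j + 1, hj⟩

theorem mem_desc_of_parent {x t : D.N} (h : D.parent x ∈ D.desc t) : x ∈ D.desc t := by
  obtain ⟨j, hj⟩ := h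
  exact ⟨j + 1, hj⟩

theorem parent_mem_desc {x t : D.N} (h : x ∈ D.desc t) (hx : x ≠ t) : D.parent x ∈ D.desc t := by
  obtain ⟨_ | j, hj⟩ := h
  · exact absurd hj hx
  · exact ⟨j, hj⟩

/-- A node of a subtree whose parent is not in the subtree is the top of the subtree. -/
theorem bag_subset_desc {v : V} (hv : v ∉ D.X) {x : D.N} (hx : x ∈ D.bag v)
    (hp : D.parent x ∉ D.bag v) : D.bag v ⊆ D.desc x := by
  have key : ∀ y z, Relation.EqvGen
      (fun a b => a ∈ D.bag v ∧ b ∈ D.bag v ∧ b = D.parent a) y z →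
      (y ∈ D.desc x ↔ z ∈ D.desc x) := by
    intro y z h
    induction h with
    | rel y z h =>
      obtain ⟨hy, hz, rfl⟩ := h
      refine ⟨fun h => parent_mem_desc h ?_, mem_desc_of_parent⟩
      rintro rfl
      exact hp hz
    | refl => exact Iff.rfl
    | symm _ _ _ ih => exact ih.symm
    | trans _ _ _ _ _ ih1 ih2 => exact ih1.trans ih2
  intro y hy
  exact (key x y (D.bag_connected v hv x hx y hy)).1 ⟨0, rfl⟩

theorem exists_top (D : G.LayeredTreeDecomposition k) (v : V) :
    ∃ x ∈ D.bag v, ∀ y ∈ D.bag v, D.depth x ≤ D.depth y :=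
  Set.exists_min_image _ D.depth (Set.toFinite _) (D.bag_nonempty v)

theorem bag_subset_desc_top {v : V} (hv : v ∉ D.X) {x : D.N} (hx : x ∈ D.bag v)
    (hmin : ∀ y ∈ D.bag v, D.depth x ≤ D.depth y) : D.bag v ⊆ D.desc x := by
  by_cases hr : x = D.root
  · rw [hr]
    exact fun y _ => mem_desc_root y
  · exact bag_subset_desc hv hx fun h => absurd (hmin _ h) (not_le.2 (D.depth_parent_lt x hr))

/-- If two subtrees intersect, then the deeper of their tops is in both. -/
theorem top_mem_bag {u v : V} (hu : u ∉ D.X) (hv : v ∉ D.X) {x y : D.N} (hx : x ∈ D.bag u)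
    (hy : y ∈ D.bag v) (hymin : ∀ z ∈ D.bag v, D.depth y ≤ D.depth z)
    (hxy : D.depth x ≤ D.depth y) (hint : (D.bag u ∩ D.bag v).Nonempty) : y ∈ D.bag u := by
  obtain ⟨z, hzu, hzv⟩ := hint
  obtain ⟨n, hn⟩ := bag_subset_desc_top hv hy hymin hzv
  -- Climbing from a common node towards `y` cannot leave `D.bag u` before `y`: the node of exit
  -- would be the top of that subtree, hence no deeper than `x`, but it is strictly below `y`.
  have key : ∀ n z, z ∈ D.bag u → D.parent^[n] z = y → y ∈ D.bag u := by
    intro n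
    induction n with
    | zero => rintro z hz rfl; exact hz
    | succ n ih =>
      intro z hz hn
      by_cases hp : D.parent z ∈ D.bag u
      · exact ih _ hp hn
      · exfalso
        obtain ⟨j, hj⟩ := bag_subset_desc hu hz hp hx
        have h1 : D.depth z ≤ D.depth x := hj ▸ depth_iterate_le j x
        have h2 : D.depth y ≤ D.depth (D.parent z) := by
          rw [← hn]
          exact depth_iterate_le n _
        have h3 : z ≠ D.root := by
          rintro rfl
          rw [D.parent_root] at hp
          exact hp hz
        have := D.depth_parent_lt z h3
        omega
  exact key n z hzu hn

/-- Take the vertex of `A` with the deepest top. By `top_mem_bag` its neighbours in its layer all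
have that top in their bags, so there are at most two of them: the layers are 2-degenerate. -/
theorem exists_layer_colouring [Finite V] (D : G.LayeredTreeDecomposition k) :
    ∃ col : V → ℕ, (∀ v, col v < 3) ∧
      ∀ u v, u ∉ D.X → v ∉ D.X → G.Adj u v → D.layer u = D.layer v → col u ≠ col v := by
  classical
  let H : SimpleGraph V :=
    { Adj := fun u v => G.Adj u v ∧ u ∉ D.X ∧ v ∉ D.X ∧ D.layer u = D.layer v
      symm := ⟨fun u v h => ⟨h.1.symm, h.2.2.1, h.2.1, h.2.2.2.symm⟩⟩
      loopless := ⟨fun u h => h.1.ne rfl⟩ }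
  obtain ⟨col, h1, h2⟩ := H.exists_three_colouring (by
    intro A hA
    choose top htop hmin using D.exists_top
    obtain ⟨v, hv, hmax⟩ := A.exists_max_image (fun v => D.depth (top v)) hA
    refine ⟨v, hv, ?_⟩
    have hsub : {u | u ∈ A ∧ H.Adj v u} ⊆
        {u | top v ∈ D.bag u ∧ D.layer u = D.layer v} \ {v} := by
      rintro u ⟨huA, hvu, hvX, huX, hl⟩
      refine ⟨⟨?_, hl.symm⟩, fun e => hvu.ne e.symm⟩
      exact top_mem_bag huX hvX (htop u) (htop v) (hmin v) (hmax u huA) (D.bag_inter u v hvu.symm)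
    have hle := Set.ncard_le_ncard hsub (Set.toFinite _)
    rw [Set.ncard_sdiff_singleton_of_mem (by exact ⟨htop v, rfl⟩)] at hle
    have := D.ncard_bag_le (top v) (D.layer v)
    omega)
  exact ⟨col, h1, fun u v hu hv ha hl => h2 u v ⟨ha, hu, hv, hl⟩⟩

open Classical in
/-- The part of the tree without `t` in which the node `x ≠ t` lies: the child of `t` below which
`x` lies, or `none` if `x` is not below `t`. -/
noncomputable def part (D : G.LayeredTreeDecomposition k) (t x : D.N) : Option D.N :=
  if x ∈ D.desc t then some (D.parent^[sInf {j | D.parent^[j] x = t} - 1] x) else none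

theorem sInf_iterate_parent {t x : D.N} (hx : x ≠ t) (h : D.parent x ∈ D.desc t) :
    sInf {j | D.parent^[j] x = t} = sInf {j | D.parent^[j] (D.parent x) = t} + 1 := by
  apply le_antisymm
  · apply Nat.sInf_le
    exact Nat.sInf_mem (s := {j | D.parent^[j] (D.parent x) = t}) h
  · have hne : {j | D.parent^[j] x = t}.Nonempty := mem_desc_of_parent h
    have hmem := Nat.sInf_mem hne
    generalize sInf {j | D.parent^[j] x = t} = n at hmem
    rcases n with _ | n
    · exact absurd hmem hx
    · exact Nat.succ_le_succ (Nat.sInf_le hmem)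

theorem part_parent {t x : D.N} (hx : x ≠ t) (hp : D.parent x ≠ t) :
    D.part t (D.parent x) = D.part t x := by
  by_cases h : D.parent x ∈ D.desc t
  · have h' := mem_desc_of_parent h
    have e := sInf_iterate_parent hx h
    obtain ⟨n, hn⟩ : ∃ n, sInf {j | D.parent^[j] (D.parent x) = t} = n + 1 := by
      refine Nat.exists_eq_succ_of_ne_zero fun h0 => hp ?_
      have := Nat.sInf_mem (s := {j | D.parent^[j] (D.parent x) = t}) h
      rw [h0] at this
      exact this
    rw [part, part, if_pos h, if_pos h', e, hn]
    rfl
  · have h' : x ∉ D.desc t := fun h' => h (parent_mem_desc h' hx)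
    rw [part, part, if_neg h, if_neg h']

/-- A connected bag that avoids `t` stays in one component of the tree without `t`. So deleting the
vertices whose bags contain `t` leaves no edge between different parts. -/
theorem part_eq_of_mem_bag {t : D.N} {v : V} (hv : v ∉ D.X) (ht : t ∉ D.bag v) {x y : D.N}
    (hx : x ∈ D.bag v) (hy : y ∈ D.bag v) : D.part t x = D.part t y := by
  have key : ∀ x y, Relation.EqvGen
      (fun a b => a ∈ D.bag v ∧ b ∈ D.bag v ∧ b = D.parent a) x y → D.part t x = D.part t y := by
    intro x y h
    induction h with
    | rel x y h =>
      obtain ⟨hx, hy, rfl⟩ := h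
      refine (part_parent ?_ ?_).symm
      · rintro rfl
        exact ht hx
      · rintro rfl
        exact ht hy
    | refl => rfl
    | symm _ _ _ ih => exact ih.symm
    | trans _ _ _ _ _ ih1 ih2 => exact ih1.trans ih2
  exact key x y (D.bag_connected v hv x hx y hy)

/-- The case `x = t` must be excluded: there the truncated subtraction makes `part` return `some t`.
-/
theorem part_eq_some {t x c : D.N} (hx : x ≠ t) (h : D.part t x = some c) :
    x ∈ D.desc c ∧ D.parent c = t ∧ c ≠ t := by
  by_cases hd : x ∈ D.desc t
  · rw [part, if_pos hd, Option.some_inj] at h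
    have hmem := Nat.sInf_mem (s := {j | D.parent^[j] x = t}) hd
    have hlt := fun m => Nat.notMem_of_lt_sInf (s := {j | D.parent^[j] x = t}) (m := m)
    generalize sInf {j | D.parent^[j] x = t} = n at hmem hlt h
    rcases n with _ | n
    · exact absurd hmem hx
    · refine ⟨⟨n, h⟩, ?_, ?_⟩
      · rw [← h]
        exact (Function.iterate_succ_apply' _ _ _).symm.trans hmem
      · rw [← h]
        exact hlt n (Nat.lt_succ_self n)
  · rw [part, if_neg hd] at h
    simp at h

/-- Balanced separators. -/
theorem exists_balanced_separator (D : G.LayeredTreeDecomposition k) (node : V → D.N)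
    (hnode : ∀ v, node v ∈ D.bag v) (A : Finset V) (hA : A.Nonempty) :
    ∃ t, ∀ q, 2 * {v | v ∈ A ∧ t ∉ D.bag v ∧ D.part t (node v) = q}.ncard ≤ A.card := by
  classical
  let W : D.N → ℕ := fun t => (A.filter fun v => node v ∈ D.desc t).card
  have hroot : W D.root = A.card := by
    simp only [W]
    rw [Finset.filter_true_of_mem fun v _ => mem_desc_root _]
  have hApos := hA.card_pos
  -- The deepest node with more than half of `A` below it. Less than half lies outside its subtree,
  -- and at most half lies below each child by maximality.
  obtain ⟨t, ht, hmax⟩ := Set.exists_max_image {t | A.card < 2 * W t} D.depth (Set.toFinite _)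
    ⟨D.root, by simp only [Set.mem_ofPred_eq, hroot]; omega⟩
  refine ⟨t, fun q => ?_⟩
  rcases q with _ | c
  · have h1 : {v | v ∈ A ∧ t ∉ D.bag v ∧ D.part t (node v) = none} ⊆
        (A.filter fun v => ¬ node v ∈ D.desc t : Finset V) := by
      rintro v ⟨hv, -, h⟩
      simp only [Finset.coe_filter, Set.mem_ofPred_eq]
      refine ⟨hv, fun hd => ?_⟩
      rw [part, if_pos hd] at h
      simp at h
    have h2 := Set.ncard_le_ncard h1 (Finset.finite_toSet _)
    rw [Set.ncard_coe_finset] at h2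
    have h3 := A.card_filter_add_card_filter_not (fun v => node v ∈ D.desc t)
    have h4 : A.card < 2 * W t := ht
    simp only [W] at h4
    omega
  · by_cases hex : ∃ v, v ∈ A ∧ t ∉ D.bag v ∧ D.part t (node v) = some c
    · have hne : ∀ v, t ∉ D.bag v → node v ≠ t := fun v hv e => hv (e ▸ hnode v)
      have hc : D.parent c = t ∧ c ≠ t := by
        obtain ⟨v, -, hv, h⟩ := hex
        exact (part_eq_some (hne v hv) h).2
      have h1 : {v | v ∈ A ∧ t ∉ D.bag v ∧ D.part t (node v) = some c} ⊆
          (A.filter fun v => node v ∈ D.desc c : Finset V) := by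
        rintro v ⟨hv, htv, h⟩
        simp only [Finset.coe_filter, Set.mem_ofPred_eq]
        exact ⟨hv, (part_eq_some (hne v htv) h).1⟩
      have h2 := Set.ncard_le_ncard h1 (Finset.finite_toSet _)
      rw [Set.ncard_coe_finset] at h2
      by_contra hlt
      have hcW : A.card < 2 * W c := by simp only [W]; omega
      have h3 := hmax c hcW
      have h4 : c ≠ D.root := by
        rintro rfl
        rw [D.parent_root] at hc
        exact hc.2 hc.1
      have h5 := D.depth_parent_lt c h4
      rw [hc.1] at h5
      omega
    · have : {v | v ∈ A ∧ t ∉ D.bag v ∧ D.part t (node v) = some c} = ∅ := by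
        ext v
        simp only [Set.mem_ofPred_eq, Set.mem_empty_iff_false, iff_false]
        exact fun h => hex ⟨v, h⟩
      rw [this]
      simp

/-- Recursive separation: `lev` is the depth in the recursion, `pos` orders the separators of the
same depth, and `idx` distinguishes the vertices of a layer in the same separator. -/
theorem exists_levels [Finite V] (D : G.LayeredTreeDecomposition k) (n : ℕ) (A : Finset V)
    (hA : ∀ v ∈ A, v ∉ D.X) (hn : A.card < 2 ^ n) :
    ∃ lev pos idx : V → ℕ, (∀ v ∈ A, lev v < n ∧ idx v < 3) ∧
      (∀ u ∈ A, ∀ v ∈ A, D.layer u = D.layer v → lev u = lev v → pos u = pos v →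
        idx u = idx v → u = v) ∧
      ∀ u ∈ A, ∀ v ∈ A, ∀ u' ∈ A, ∀ v' ∈ A, G.Adj u v → G.Adj u' v' → lev u = lev u' →
        lev v = lev v' → pos u < pos u' → pos v ≤ pos v' := by
  classical
  induction n generalizing A with
  | zero =>
    have : A = ∅ := by simpa using hn
    subst this
    exact ⟨fun _ => 0, fun _ => 0, fun _ => 0, by simp, by simp, by simp⟩
  | succ n ih =>
    rcases A.eq_empty_or_nonempty with rfl | hne
    · exact ⟨fun _ => 0, fun _ => 0, fun _ => 0, by simp, by simp, by simp⟩
    choose node hnode using D.bag_nonempty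
    obtain ⟨t, ht⟩ := D.exists_balanced_separator node hnode A hne
    let q : V → Option D.N := fun v => D.part t (node v)
    have hq : ∀ u ∈ A, ∀ v ∈ A, t ∉ D.bag u → t ∉ D.bag v → G.Adj u v → q u = q v := by
      intro u hu v hv htu htv ha
      obtain ⟨z, hzu, hzv⟩ := D.bag_inter u v ha
      exact (part_eq_of_mem_bag (hA u hu) htu (hnode u) hzu).trans
        (part_eq_of_mem_bag (hA v hv) htv hzv (hnode v))
    have hrec : ∀ r : Option D.N, _ := fun r =>
      ih (A.filter fun v => t ∉ D.bag v ∧ q v = r)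
        (fun v hv => hA v (Finset.mem_filter.1 hv).1) (by
          have h1 := ht r
          have h2 : {v | v ∈ A ∧ t ∉ D.bag v ∧ D.part t (node v) = r} =
              (A.filter fun v => t ∉ D.bag v ∧ q v = r : Finset V) := by
            ext v
            simp [q]
          rw [h2, Set.ncard_coe_finset] at h1
          rw [pow_succ] at hn
          omega)
    choose lev pos idx hbd hinj hord using hrec
    obtain ⟨i₀, hi₀, hi₀'⟩ := exists_index_injOn_layers {v | t ∈ D.bag v} D.layer 3
      (fun l => D.ncard_bag_le t l)
    -- Positions inside one part are less than `M`, so that adding `e r * M` gives different parts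
    -- disjoint blocks of positions.
    obtain ⟨M, hM⟩ : ∃ M, ∀ r v, pos r v < M := by
      obtain ⟨M, hM⟩ := (Set.finite_range fun z : Option D.N × V => pos z.1 z.2).bddAbove
      exact ⟨M + 1, fun r v => Nat.lt_succ_of_le (hM ⟨(r, v), rfl⟩)⟩
    obtain ⟨e, he⟩ : ∃ e : Option D.N → ℕ, Function.Injective e :=
      ⟨fun r => Finite.equivFin _ r, fun a b h => (Finite.equivFin _).injective (Fin.ext h)⟩
    have hmem : ∀ v ∈ A, t ∉ D.bag v → v ∈ A.filter fun w => t ∉ D.bag w ∧ q w = q v :=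
      fun v hv htv => Finset.mem_filter.2 ⟨hv, htv, rfl⟩
    have hmem' : ∀ u v, q u = q v → v ∈ A → t ∉ D.bag v →
        v ∈ A.filter fun w => t ∉ D.bag w ∧ q w = q u :=
      fun u v h hv htv => Finset.mem_filter.2 ⟨hv, htv, h.symm⟩
    have hblock : ∀ r r' v v', e r * M + pos r v ≤ e r' * M + pos r' v' → e r ≤ e r' := by
      intro r r' v v' h
      by_contra hlt
      have h1 : (e r' + 1) * M ≤ e r * M := Nat.mul_le_mul_right M (by omega)
      have h2 := hM r' v'
      rw [add_mul] at h1
      omega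
    have hblock' : ∀ r r' v v', e r < e r' → e r * M + pos r v < e r' * M + pos r' v' := by
      intro r r' v v' h
      by_contra hlt
      have := hblock r' r v' v (by omega)
      omega
    -- The separator vertices form level 0 at the single position 0, where nothing can cross. The
    -- others keep their recursive data, one level deeper and in the block of their part.
    refine ⟨fun v => if t ∈ D.bag v then 0 else lev (q v) v + 1,
      fun v => if t ∈ D.bag v then 0 else e (q v) * M + pos (q v) v,
      fun v => if t ∈ D.bag v then i₀ v else idx (q v) v, fun v hv => ?_,
      fun u hu v hv hl h1 h2 h3 => ?_, fun u hu v hv u' hu' v' hv' ha ha' h1 h2 h3 => ?_⟩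
    · by_cases htv : t ∈ D.bag v
      · simpa [htv] using hi₀ v htv
      · simpa [htv] using hbd _ v (hmem v hv htv)
    · by_cases htu : t ∈ D.bag u <;> by_cases htv : t ∈ D.bag v
      · simp only [htu, htv, if_true] at h3
        exact hi₀' u htu v htv hl h3
      · simp [htu, htv] at h1
      · simp [htu, htv] at h1
      · simp only [htu, htv, if_false] at h1 h2 h3
        have hqq : q u = q v := he (le_antisymm (hblock _ _ _ _ h2.le) (hblock _ _ _ _ h2.ge))
        rw [← hqq] at h1 h2 h3
        exact hinj (q u) u (hmem u hu htu) v (hmem' u v hqq hv htv) hl (by omega) (by omega) h3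
    · by_cases htu : t ∈ D.bag u
      · by_cases htu' : t ∈ D.bag u'
        · simp [htu, htu'] at h3
        · simp [htu, htu'] at h1
      by_cases htu' : t ∈ D.bag u'
      · simp [htu, htu'] at h1
      by_cases htv : t ∈ D.bag v
      · simp [htv]
      by_cases htv' : t ∈ D.bag v'
      · simp [htv, htv'] at h2
      simp only [htu, htu', htv, htv', if_false] at h1 h2 h3 ⊢
      have e1 := hq u hu v hv htu htv ha
      have e2 := hq u' hu' v' hv' htu' htv' ha'
      rw [← e1, ← e2] at h2 ⊢
      rcases (hblock _ _ _ _ h3.le).lt_or_eq with hlt | heq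
      · exact (hblock' _ _ _ _ hlt).le
      · have hqq := he heq
        rw [← hqq] at h1 h2 h3 ⊢
        have := hord (q u) u (hmem u hu htu) v (hmem' u v e1 hv htv) u' (hmem' u u' hqq hu' htu')
          v' (hmem' u v' (hqq.trans e2) hv' htv') ha ha' (by omega) (by omega) (by omega)
        omega

end SimpleGraph.LayeredTreeDecomposition

/-! ### Track layouts -/

/-- A layout of `G` on tracks. The vertices in `X` lie on `m` tracks, numbered by `line`. The other
vertices lie in nine independent sets, numbered by `grp`, each of which is divided into `t` tracks,
numbered by `trk`. The vertices of each track are ordered by `ord` and no two edges between the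
same two tracks cross. -/
structure SimpleGraph.TrackLayout {V : Type*} (G : SimpleGraph V) (m t : ℕ) where
  X : Set V
  line : V → ℕ
  grp : V → ℕ
  trk : V → ℕ
  ord : V → ℕ
  line_lt : ∀ v ∈ X, line v < m
  grp_lt : ∀ v, v ∉ X → grp v < 9
  trk_lt : ∀ v, v ∉ X → trk v < t
  eq_of_line_eq : ∀ u ∈ X, ∀ v ∈ X, line u = line v → ord u = ord v → u = v
  eq_of_trk_eq : ∀ u, u ∉ X → ∀ v, v ∉ X → grp u = grp v → trk u = trk v → ord u = ord v → u = v
  line_ne : ∀ u ∈ X, ∀ v ∈ X, G.Adj u v → line u ≠ line v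
  grp_ne : ∀ u, u ∉ X → ∀ v, v ∉ X → G.Adj u v → grp u ≠ grp v
  ord_le : ∀ u v u' v', G.Adj u v → G.Adj u' v' →
    (u ∈ X ∧ u' ∈ X ∧ line u = line u' ∨
      u ∉ X ∧ u' ∉ X ∧ grp u = grp u' ∧ trk u = trk u') →
    (v ∈ X ∧ v' ∈ X ∧ line v = line v' ∨
      v ∉ X ∧ v' ∉ X ∧ grp v = grp v' ∧ trk v = trk v') →
    ord u < ord u' → ord v ≤ ord v'

-- An edge changes the layer by -1, 0 or 1, and the residues modulo 3 at its ends tell which. Two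
-- edges between the same tracks therefore change it equally: if they start in different layers,
-- they end in the same order of layers. If they start in the same layer, `exists_levels` decides.
open SimpleGraph.LayeredTreeDecomposition in
theorem SimpleGraph.LayeredTreeDecomposition.exists_trackLayout {V : Type*} [Finite V]
    {G : SimpleGraph V} {k : ℕ} (D : G.LayeredTreeDecomposition k) (L : ℕ)
    (hL : Nat.card V < 2 ^ L) : Nonempty (G.TrackLayout (3 * k) (3 * L)) := by
  classical
  have := Fintype.ofFinite V
  obtain ⟨i, hik, hi⟩ := exists_index_injOn_layers D.X D.layer k D.ncard_X_le
  obtain ⟨col, hcol3, hcol⟩ := D.exists_layer_colouring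
  obtain ⟨lev, pos, idx, hlt, hinj, hord⟩ := D.exists_levels L (Finset.univ.filter (· ∉ D.X))
    (fun v hv => (Finset.mem_filter.1 hv).2) (by
      refine (Finset.card_le_univ _).trans_lt ?_
      rwa [← Nat.card_eq_fintype_card])
  have hmem : ∀ v, v ∉ D.X → v ∈ Finset.univ.filter (· ∉ D.X) :=
    fun v hv => Finset.mem_filter.2 ⟨Finset.mem_univ v, hv⟩
  obtain ⟨M, hM⟩ : ∃ M, ∀ v, pos v < M := by
    obtain ⟨M, hM⟩ := (Set.finite_range pos).bddAbove
    exact ⟨M + 1, fun v => Nat.lt_succ_of_le (hM ⟨v, rfl⟩)⟩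
  -- `exists_levels` says nothing about `X`. There the track and the layer already determine the
  -- vertex, so position 0 will do.
  let pos' : V → ℕ := fun v => if v ∈ D.X then 0 else pos v
  have hpX : ∀ v ∈ D.X, pos' v = 0 := fun v hv => if_pos hv
  have hpP : ∀ v, v ∉ D.X → pos' v = pos v := fun v hv => if_neg hv
  have hpM : ∀ v, pos' v < M := by
    intro v
    by_cases hv : v ∈ D.X
    · rw [hpX v hv]
      exact (Nat.zero_le _).trans_lt (hM v)
    · rw [hpP v hv]
      exact hM v
  have hlex : ∀ u v, D.layer u < D.layer v → D.layer u * M + pos' u < D.layer v * M + pos' v := by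
    intro u v h
    have h1 : (D.layer u + 1) * M ≤ D.layer v * M := Nat.mul_le_mul_right M h
    have h2 := hpM u
    rw [add_mul] at h1
    omega
  have hlex' : ∀ u v, D.layer u * M + pos' u = D.layer v * M + pos' v →
      D.layer u = D.layer v ∧ pos' u = pos' v := by
    intro u v h
    rcases lt_trichotomy (D.layer u) (D.layer v) with h1 | h1 | h1
    · have := hlex u v h1; omega
    · rw [h1] at h; exact ⟨h1, by omega⟩
    · have := hlex v u h1; omega
  refine ⟨{ X := D.X
            line := fun v => 3 * i v + D.layer v % 3
            grp := fun v => 3 * (D.layer v % 3) + col v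
            trk := fun v => 3 * lev v + idx v
            ord := fun v => D.layer v * M + pos' v
            line_lt := ?_
            grp_lt := ?_
            trk_lt := ?_
            eq_of_line_eq := ?_
            eq_of_trk_eq := ?_
            line_ne := ?_
            grp_ne := ?_
            ord_le := ?_ }⟩
  · intro v hv
    have := hik v hv
    omega
  · intro v hv
    have := hcol3 v
    omega
  · intro v hv
    have := hlt v (hmem v hv)
    omega
  · intro u hu v hv h1 h2
    exact hi u hu v hv (hlex' u v h2).1 (by omega)
  · intro u hu v hv h1 h2 h3
    have h4 := hlex' u v h3
    rw [hpP u hu, hpP v hv] at h4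
    have h5 := hlt u (hmem u hu)
    have h6 := hlt v (hmem v hv)
    exact hinj u (hmem u hu) v (hmem v hv) h4.1 (by omega) h4.2 (by omega)
  · intro u hu v hv ha h
    have h1 := D.layer_le u v ha
    have h2 := D.layer_le v u ha.symm
    exact ha.ne (hi u hu v hv (by omega) (by omega))
  · intro u hu v hv ha h
    have h1 := D.layer_le u v ha
    have h2 := D.layer_le v u ha.symm
    have h3 := hcol3 u
    have h4 := hcol3 v
    exact hcol u v hu hv ha (by omega) (by omega)
  · intro u v u' v' ha ha' hu hv h
    have h1 := D.layer_le u v ha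
    have h2 := D.layer_le v u ha.symm
    have h3 := D.layer_le u' v' ha'
    have h4 := D.layer_le v' u' ha'.symm
    have h5 := hcol3 u
    have h6 := hcol3 u'
    have h7 := hcol3 v
    have h8 := hcol3 v'
    have hu3 : D.layer u % 3 = D.layer u' % 3 := by
      rcases hu with hu | hu
      · omega
      · have := hu.2.2.1; omega
    have hv3 : D.layer v % 3 = D.layer v' % 3 := by
      rcases hv with hv | hv
      · omega
      · have := hv.2.2.1; omega
    rcases lt_trichotomy (D.layer u) (D.layer u') with hl | hl | hl
    · exact (hlex v v' (by omega)).le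
    · have hvv : D.layer v = D.layer v' := by omega
      have hpu : pos' u < pos' u' := by rw [hl] at h; omega
      rw [hvv]
      apply Nat.add_le_add_left
      rcases hu with ⟨hu, hu', -⟩ | ⟨hu, hu', -, hut⟩
      · rw [hpX u hu, hpX u' hu'] at hpu
        omega
      rcases hv with ⟨hv, hv', -⟩ | ⟨hv, hv', -, hvt⟩
      · rw [hpX v hv]
        omega
      · rw [hpP v hv, hpP v' hv']
        rw [hpP u hu, hpP u' hu'] at hpu
        have b1 := hlt u (hmem u hu)
        have b2 := hlt u' (hmem u' hu')
        have b3 := hlt v (hmem v hv)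
        have b4 := hlt v' (hmem v' hv')
        exact hord u (hmem u hu) v (hmem v hv) u' (hmem u' hu') v' (hmem v' hv') ha ha'
          (by omega) (by omega) hpu
    · have := hlex u' u hl
      omega

/-! ### Criteria for segments not to meet -/

/-- Four points on the moment curve modulo a prime are not coplanar. -/
theorem moment_curve_segments_disjoint (p : ℕ) [Fact p.Prime] {x₁ x₂ x₃ x₄ y₁ y₂ y₃ y₄
    z₁ z₂ z₃ z₄ : ℤ} (hy₁ : (y₁ : ZMod p) = x₁ ^ 2) (hy₂ : (y₂ : ZMod p) = x₂ ^ 2)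
    (hy₃ : (y₃ : ZMod p) = x₃ ^ 2) (hy₄ : (y₄ : ZMod p) = x₄ ^ 2)
    (hz₁ : (z₁ : ZMod p) = x₁ ^ 3) (hz₂ : (z₂ : ZMod p) = x₂ ^ 3)
    (hz₃ : (z₃ : ZMod p) = x₃ ^ 3) (hz₄ : (z₄ : ZMod p) = x₄ ^ 3)
    (h₁₂ : (x₁ : ZMod p) ≠ x₂) (h₁₃ : (x₁ : ZMod p) ≠ x₃) (h₁₄ : (x₁ : ZMod p) ≠ x₄)
    (h₂₃ : (x₂ : ZMod p) ≠ x₃) (h₂₄ : (x₂ : ZMod p) ≠ x₄) (h₃₄ : (x₃ : ZMod p) ≠ x₄) (s r : ℝ)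
    (hx : (x₁ : ℝ) + s * (x₂ - x₁) = x₃ + r * (x₄ - x₃))
    (hy : (y₁ : ℝ) + s * (y₂ - y₁) = y₃ + r * (y₄ - y₃))
    (hz : (z₁ : ℝ) + s * (z₂ - z₁) = z₃ + r * (z₄ - z₃)) : False := by
  -- Segments that meet span only a plane, so the integer determinant of three difference vectors
  -- vanishes.
  have hdet : ((x₃ - x₁) * ((y₂ - y₁) * (z₄ - z₃) - (z₂ - z₁) * (y₄ - y₃))
      - (y₃ - y₁) * ((x₂ - x₁) * (z₄ - z₃) - (z₂ - z₁) * (x₄ - x₃))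
      + (z₃ - z₁) * ((x₂ - x₁) * (y₄ - y₃) - (y₂ - y₁) * (x₄ - x₃)) : ℝ) = 0 := by
    linear_combination (-((y₂ - y₁ : ℝ) * (z₄ - z₃) - (z₂ - z₁) * (y₄ - y₃))) * hx
      + ((x₂ - x₁ : ℝ) * (z₄ - z₃) - (z₂ - z₁) * (x₄ - x₃)) * hy
      - ((x₂ - x₁ : ℝ) * (y₄ - y₃) - (y₂ - y₁) * (x₄ - x₃)) * hz
  have hdet' : (x₃ - x₁) * ((y₂ - y₁) * (z₄ - z₃) - (z₂ - z₁) * (y₄ - y₃))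
      - (y₃ - y₁) * ((x₂ - x₁) * (z₄ - z₃) - (z₂ - z₁) * (x₄ - x₃))
      + (z₃ - z₁) * ((x₂ - x₁) * (y₄ - y₃) - (y₂ - y₁) * (x₄ - x₃)) = 0 := by exact_mod_cast hdet
  have hmod := congrArg (fun t : ℤ => (t : ZMod p)) hdet'
  simp only [Int.cast_add, Int.cast_sub, Int.cast_mul, Int.cast_zero, hy₁, hy₂, hy₃, hy₄, hz₁, hz₂,
    hz₃, hz₄] at hmod
  -- Modulo `p` the determinant is, up to sign, the Vandermonde product.
  have hprod : ((x₁ : ZMod p) - x₂) * (x₁ - x₃) * (x₁ - x₄) * (x₂ - x₃) * (x₂ - x₄) *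
      (x₃ - x₄) = 0 := by
    linear_combination -hmod
  simp only [mul_eq_zero, sub_eq_zero] at hprod
  tauto

/-- Two pairs of points on parallel lines whose direction vectors lie in disjoint sectors. -/
theorem eq_of_slope_windows {s d₁ d₂ e₁ e₂ S₁ S₂ ℓ : ℝ} (hs0 : 0 < s) (hs1 : s < 1)
    (hy : (1 - s) * d₁ + s * d₂ = 0)
    (hz : (1 - s) * (S₁ * d₁ + e₁) + s * (S₂ * d₂ + e₂) = 0)
    (he₁ : |e₁| ≤ ℓ * |d₁|) (he₂ : |e₂| ≤ ℓ * |d₂|) (hS : 2 * ℓ < |S₁ - S₂|) : d₁ = 0 := by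
  by_contra hd
  have hc : 0 < (1 - s) * |d₁| := mul_pos (by linarith) (abs_pos.2 hd)
  have h1 : s * |d₂| = (1 - s) * |d₁| := by
    have h := congrArg abs (show s * d₂ = -((1 - s) * d₁) by linarith)
    rwa [abs_neg, abs_mul, abs_mul, abs_of_pos hs0, abs_of_pos (show 0 < 1 - s by linarith)] at h
  have h2 : (S₁ - S₂) * ((1 - s) * d₁) = -((1 - s) * e₁ + s * e₂) := by
    linear_combination hz - S₂ * hy
  have h3 := congrArg abs h2
  rw [abs_mul, abs_mul, abs_neg, abs_of_pos (show 0 < 1 - s by linarith)] at h3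
  have h4 : |(1 - s) * e₁ + s * e₂| ≤ (1 - s) * |e₁| + s * |e₂| := by
    refine (abs_add_le _ _).trans (le_of_eq ?_)
    rw [abs_mul, abs_mul, abs_of_pos hs0, abs_of_pos (show 0 < 1 - s by linarith)]
  have h5 : (1 - s) * |e₁| ≤ (1 - s) * (ℓ * |d₁|) :=
    mul_le_mul_of_nonneg_left he₁ (by linarith)
  have h6 : s * |e₂| ≤ s * (ℓ * |d₂|) := mul_le_mul_of_nonneg_left he₂ hs0.le
  have h7 : 2 * ℓ * ((1 - s) * |d₁|) < |S₁ - S₂| * ((1 - s) * |d₁|) :=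
    mul_lt_mul_of_pos_right hS hc
  have h8 : s * (ℓ * |d₂|) = ℓ * ((1 - s) * |d₁|) := by rw [← h1]; ring
  linarith

/-- Two segments starting at the same plane do not meet if the difference of their starting points
is steeper than the difference of their directions. -/
theorem not_meet_of_steep {s r a b y y' z z' v v' w w' σ : ℝ} (ha : a ≠ 0) (hb : b ≠ 0)
    (hs : s ≠ 0) (hx : s * a = r * b) (hy : y + s * (v - y) = y' + r * (v' - y'))
    (hz : z + s * (w - z) = z' + r * (w' - z'))
    (hd : y - y' = 0 ∨ σ * |y - y'| ≤ |z - z'|)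
    (hν : |(w' - z') / b - (w - z) / a| < σ * |(v' - y') / b - (v - y) / a|) : False := by
  have hθ : 0 < |s * a| := abs_pos.2 (mul_ne_zero hs ha)
  -- At the meeting point both segments have advanced by `s * a = r * b` in the x-direction. So the
  -- differences of the starting points are the differences of the slopes, scaled by the same
  -- factor.
  have h1 : y - y' = (s * a) * ((v' - y') / b - (v - y) / a) := by
    rw [mul_sub]
    nth_rewrite 1 [hx]
    field_simp
    linarith
  have h2 : z - z' = (s * a) * ((w' - z') / b - (w - z) / a) := by
    rw [mul_sub]
    nth_rewrite 1 [hx]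
    field_simp
    linarith
  rcases hd with hd | hd
  · rw [hd] at h1
    have h3 := (mul_eq_zero.1 h1.symm).resolve_left (mul_ne_zero hs ha)
    rw [h3, abs_zero, mul_zero] at hν
    exact absurd hν (not_lt.2 (abs_nonneg _))
  · rw [h1, h2, abs_mul (s * a), abs_mul (s * a)] at hd
    nlinarith

/-! ### Slopes in the projection to the xy-plane -/

section Bounds

/-- A point of one of the nine groups: `i` is the number of the group. -/
structure IsGroupPoint (α T H : ℝ) (i : ℕ) (y z : ℝ) : Prop where
  lt : i < 9
  le_y : α * i ^ 2 ≤ y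
  y_le : y ≤ α * i ^ 2 + 11 * T
  le_z : 110 * H * i ≤ z
  z_le : z ≤ 110 * H * i + 101 * H

/-- Bounds on the constants of the drawing. -/
structure DrawingBounds (m T K α Y : ℝ) : Prop where
  one_le_m : 1 ≤ m
  one_le_T : 1 ≤ T
  one_le_K : 1 ≤ K
  le_α : 11000 * T ≤ α
  α_le : 64 * α + 11 * T < 10 ^ 6 * T
  le_Y : 2 * 10 ^ 12 * m * T + 18 * m ^ 2 ≤ Y

variable {m T K α Y : ℝ}

theorem IsGroupPoint.z_nonneg {i : ℕ} {y z : ℝ} (hB : DrawingBounds m T K α Y)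
    (h : IsGroupPoint α T (K * T) i y z) : 0 ≤ z := by
  have := hB.one_le_T
  have := hB.one_le_K
  exact le_trans (by positivity) h.le_z

theorem IsGroupPoint.cast_le {H : ℝ} {i : ℕ} {y z : ℝ} (h : IsGroupPoint α T H i y z) :
    (i : ℝ) ≤ 8 := by
  have := h.lt
  exact_mod_cast (by omega : i ≤ 8)

theorem IsGroupPoint.z_le' {i : ℕ} {y z : ℝ} (hB : DrawingBounds m T K α Y)
    (h : IsGroupPoint α T (K * T) i y z) : z ≤ 1000 * (K * T) := by
  have h1 := hB.one_le_T
  have h2 := hB.one_le_K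
  have h3 : 0 < K * T := by positivity
  have h4 := h.cast_le
  have h5 := h.z_le
  nlinarith

theorem IsGroupPoint.y_nonneg {i : ℕ} {y z : ℝ} (hB : DrawingBounds m T K α Y)
    (h : IsGroupPoint α T (K * T) i y z) : 0 ≤ y := by
  have h1 := hB.one_le_T
  have h2 := hB.le_α
  refine le_trans ?_ h.le_y
  have : 0 ≤ α := by linarith
  positivity

theorem IsGroupPoint.y_lt {i : ℕ} {y z : ℝ} (hB : DrawingBounds m T K α Y)
    (h : IsGroupPoint α T (K * T) i y z) : y < 10 ^ 6 * T := by
  have h1 := hB.one_le_T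
  have h2 := hB.le_α
  have h3 := hB.α_le
  have h4 := h.cast_le
  have h5 := h.y_le
  have h6 : (i : ℝ) ^ 2 ≤ 64 := by nlinarith [Nat.cast_nonneg (α := ℝ) i]
  have h7 : α * (i : ℝ) ^ 2 ≤ α * 64 := mul_le_mul_of_nonneg_left h6 (by linarith)
  linarith

/-- The distance in the first coordinate from a group to a line. -/
theorem lineDist_bounds {i : ℕ} {j : ℝ} (hi : (i : ℝ) ≤ 8) (hm : 1 ≤ m) (hj0 : 0 ≤ j)
    (hj : j ≤ m - 1) :
    10 ^ 6 * m / 2 ≤ 10 ^ 6 * (m + j) - i ∧ 10 ^ 6 * (m + j) - i ≤ 2 * 10 ^ 6 * m := by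
  have : (0 : ℝ) ≤ i := Nat.cast_nonneg i
  constructor <;> linarith

/-- The chord of the parabola `α x²` between `i` and `k` has slope `α (i + k)`. The ends deviate by
at most `11 T`, over a distance of at least 1. -/
theorem groupSlope_bounds {i k : ℕ} {y z v w : ℝ} {H : ℝ} (h : IsGroupPoint α T H i y z)
    (h' : IsGroupPoint α T H k v w) (hik : i ≠ k) :
    |(v - y) / ((k : ℝ) - i) - α * (i + k)| ≤ 11 * T := by
  have hne : ((k : ℝ) - i) ≠ 0 := sub_ne_zero.2 (by exact_mod_cast hik.symm)
  have habs : 1 ≤ |(k : ℝ) - i| := by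
    have : (1 : ℤ) ≤ |(k : ℤ) - i| := Int.one_le_abs (by omega)
    exact_mod_cast this
  have e : (v - y) / ((k : ℝ) - i) - α * (i + k) =
      ((v - α * k ^ 2) - (y - α * i ^ 2)) / ((k : ℝ) - i) := by
    field_simp
    ring
  rw [e, abs_div, div_le_iff₀ (by linarith)]
  have h1 := h.le_y
  have h2 := h.y_le
  have h3 := h'.le_y
  have h4 := h'.y_le
  have h5 : |(v - α * k ^ 2) - (y - α * i ^ 2)| ≤ 11 * T := abs_le.2 ⟨by linarith, by linarith⟩
  have hT : 0 ≤ 11 * T := (abs_nonneg _).trans h5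
  nlinarith

/-- The fall is at least `Y ≥ 2 * 10 ^ 12 * m * T` and at most `2 Y`, over a distance between `10 ^
6 * m / 2` and `2 * 10 ^ 6 * m`. The lower bound makes edges to lines fall faster than anything
inside the groups. -/
theorem lineSlope_bounds {i : ℕ} {y z j : ℝ} (hB : DrawingBounds m T K α Y)
    (h : IsGroupPoint α T (K * T) i y z) (hj0 : 0 ≤ j) (hj : j ≤ m - 1) :
    10 ^ 6 * T ≤ (Y + j ^ 2 + y) / (10 ^ 6 * (m + j) - i) ∧
      (Y + j ^ 2 + y) / (10 ^ 6 * (m + j) - i) ≤ 4 * Y / (10 ^ 6 * m) := by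
  have h1 := hB.one_le_m
  have h2 := hB.one_le_T
  have h3 := hB.le_Y
  have h4 := h.y_nonneg hB
  have h5 := h.y_lt hB
  obtain ⟨h6, h7⟩ := lineDist_bounds (i := i) h.cast_le h1 hj0 hj
  have h8 : 0 < 10 ^ 6 * (m + j) - (i : ℝ) := by linarith
  have hmT : T ≤ m * T := by nlinarith
  constructor
  · rw [le_div_iff₀ h8]
    have : 10 ^ 6 * T * (10 ^ 6 * (m + j) - i) ≤ 10 ^ 6 * T * (2 * 10 ^ 6 * m) :=
      mul_le_mul_of_nonneg_left h7 (by linarith)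
    nlinarith [sq_nonneg j, sq_nonneg m]
  · rw [div_le_div_iff₀ h8 (by linarith)]
    have hjm : j ^ 2 ≤ m ^ 2 := by nlinarith
    have hY0 : 0 ≤ Y := by nlinarith
    have h9 : Y + j ^ 2 + y ≤ 2 * Y := by nlinarith [sq_nonneg m]
    have h10 : (Y + j ^ 2 + y) * (10 ^ 6 * m) ≤ 2 * Y * (10 ^ 6 * m) :=
      mul_le_mul_of_nonneg_right h9 (by linarith)
    have h11 : 4 * Y * (10 ^ 6 * m / 2) ≤ 4 * Y * (10 ^ 6 * (m + j) - i) :=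
      mul_le_mul_of_nonneg_left h6 (by linarith)
    linarith

/-- Slopes towards different lines differ substantially. -/
theorem lineSlope_diff {i i' : ℕ} {y z y' z' : ℝ} {j j' : ℕ} (hB : DrawingBounds m T K α Y)
    (h : IsGroupPoint α T (K * T) i y z) (h' : IsGroupPoint α T (K * T) i' y' z')
    (hj : (j : ℝ) ≤ m - 1) (hj' : (j' : ℝ) ≤ m - 1) (hne : j ≠ j') :
    Y / (16 * 10 ^ 6 * m ^ 2) ≤ |(Y + (j : ℝ) ^ 2 + y) / (10 ^ 6 * (m + j) - i) -
      (Y + (j' : ℝ) ^ 2 + y') / (10 ^ 6 * (m + j') - i')| := by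
  have key : ∀ (i i' : ℕ) (y z y' z' : ℝ) (j j' : ℕ), IsGroupPoint α T (K * T) i y z →
      IsGroupPoint α T (K * T) i' y' z' → (j : ℝ) ≤ m - 1 → (j' : ℝ) ≤ m - 1 → j < j' →
      Y / (16 * 10 ^ 6 * m ^ 2) ≤ |(Y + (j : ℝ) ^ 2 + y) / (10 ^ 6 * (m + j) - i) -
        (Y + (j' : ℝ) ^ 2 + y') / (10 ^ 6 * (m + j') - i')| := by
    clear h h' hj hj' hne
    intro i i' y z y' z' j j' h h' hj hj' hlt
    have h1 := hB.one_le_m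
    have h2 := hB.one_le_T
    have h3 := hB.le_Y
    have h4 := h.y_nonneg hB
    have h5 := h'.y_nonneg hB
    have h6 := h'.y_lt hB
    have hj0 : (0 : ℝ) ≤ j := Nat.cast_nonneg j
    have hj0' : (0 : ℝ) ≤ j' := Nat.cast_nonneg j'
    obtain ⟨a1, a2⟩ := lineDist_bounds (i := i) h.cast_le h1 hj0 hj
    obtain ⟨b1, b2⟩ := lineDist_bounds (i := i') h'.cast_le h1 hj0' hj'
    have hδ : (1 : ℝ) ≤ (j' : ℝ) - j := by
      have : (j : ℝ) + 1 ≤ j' := by exact_mod_cast hlt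
      linarith
    have hba : 10 ^ 6 / 2 * ((j' : ℝ) - j) ≤
        (10 ^ 6 * (m + j') - i') - (10 ^ 6 * (m + j) - i) := by
      have := h'.cast_le
      have : (0 : ℝ) ≤ i := Nat.cast_nonneg i
      linarith
    generalize 10 ^ 6 * (m + (j : ℝ)) - i = a at *
    generalize 10 ^ 6 * (m + (j' : ℝ)) - i' = b at *
    generalize hδe : (j' : ℝ) - j = δ at *
    have ha : 0 < a := by linarith
    have hb : 0 < b := by linarith
    have hT0 : (0 : ℝ) ≤ m * T := by positivity
    have hm0 : (0 : ℝ) ≤ m ^ 2 := by positivity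
    have hY0 : 0 ≤ Y := by linarith
    have n1 : Y * (10 ^ 6 / 2 * δ) ≤ Y * (b - a) := mul_le_mul_of_nonneg_left hba hY0
    have n2 : -(4 * 10 ^ 6 * m ^ 2 * δ) ≤ (j : ℝ) ^ 2 * b - (j' : ℝ) ^ 2 * a := by
      have e : (j : ℝ) ^ 2 * b - (j' : ℝ) ^ 2 * a = (j : ℝ) ^ 2 * (b - a) - δ * (j' + j) * a := by
        rw [← hδe]; ring
      have e1 : 0 ≤ (j : ℝ) ^ 2 * (b - a) := mul_nonneg (sq_nonneg _) (by linarith)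
      have e2 : δ * (j' + j) * a ≤ δ * (2 * m) * (2 * 10 ^ 6 * m) := by
        apply mul_le_mul _ a2 ha.le (by positivity)
        exact mul_le_mul_of_nonneg_left (by linarith) (by linarith)
      rw [e]
      linarith
    have n3 : -(2 * 10 ^ 12 * (m * T)) ≤ y * b - y' * a := by
      have e1 : 0 ≤ y * b := by positivity
      have e2 : y' * a ≤ 10 ^ 6 * T * (2 * 10 ^ 6 * m) :=
        mul_le_mul h6.le a2 ha.le (by positivity)
      linarith
    -- The main term is `Y (b - a) ≥ 10 ^ 6 * Y / 2 * δ`. The terms from `j ^ 2` and `y` cost at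
    -- most half of it, which is the purpose of the summand `18 m ^ 2` in the bound for `Y`.
    have n4 : 10 ^ 6 * Y / 4 ≤ (Y + (j : ℝ) ^ 2 + y) * b - a * (Y + (j' : ℝ) ^ 2 + y') := by
      have e : (10 ^ 6 * Y / 4 - 4 * 10 ^ 6 * m ^ 2) * 1 ≤
          (10 ^ 6 * Y / 2 - 4 * 10 ^ 6 * m ^ 2) * δ := by
        apply mul_le_mul <;> nlinarith
      nlinarith
    rw [div_sub_div _ _ ha.ne' hb.ne']
    refine le_trans ?_ (le_abs_self _)
    rw [div_le_div_iff₀ (by positivity) (by positivity)]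
    have n5 : a * b ≤ (2 * 10 ^ 6 * m) * (2 * 10 ^ 6 * m) :=
      mul_le_mul a2 b2 hb.le (by positivity)
    have n6 : Y * (a * b) ≤ Y * ((2 * 10 ^ 6 * m) * (2 * 10 ^ 6 * m)) :=
      mul_le_mul_of_nonneg_left n5 hY0
    have n7 : 10 ^ 6 * Y / 4 * (16 * 10 ^ 6 * m ^ 2) ≤
        ((Y + (j : ℝ) ^ 2 + y) * b - a * (Y + (j' : ℝ) ^ 2 + y')) * (16 * 10 ^ 6 * m ^ 2) :=
      mul_le_mul_of_nonneg_right n4 (by positivity)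
    linarith
  rcases lt_or_gt_of_ne hne with hlt | hlt
  · exact key i i' y z y' z' j j' h h' hj hj' hlt
  · rw [abs_sub_comm]
    exact key i' i y' z' y z j' j h' h hj' hj hlt

end Bounds

/-! ### Pairs of edges by the kinds of their ends -/

section Cases

variable {m T K α Y : ℝ}

theorem abs_sub_div_le {w z a H δ : ℝ} (hδ : 0 < δ) (ha : δ ≤ |a|) (hw0 : 0 ≤ w) (hw : w ≤ H)
    (hz0 : 0 ≤ z) (hz : z ≤ H) : |(w - z) / a| ≤ H / δ := by
  rw [abs_div]
  apply div_le_div₀ (hw0.trans hw) (abs_le.2 ⟨by linarith, by linarith⟩) hδ ha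

theorem one_le_abs_cast_sub {i k : ℕ} (h : i ≠ k) : (1 : ℝ) ≤ |(k : ℝ) - i| := by
  have : (1 : ℤ) ≤ |(k : ℤ) - i| := Int.one_le_abs (by omega)
  exact_mod_cast this

/-- Edges from one group to two different groups. -/
theorem group_group_disjoint (hB : DrawingBounds m T K α Y) {i k k' : ℕ}
    {y z y' z' v w v' w' s r : ℝ} (h : IsGroupPoint α T (K * T) i y z)
    (h' : IsGroupPoint α T (K * T) i y' z') (g : IsGroupPoint α T (K * T) k v w)
    (g' : IsGroupPoint α T (K * T) k' v' w') (hk : i ≠ k) (hk' : i ≠ k') (hkk : k ≠ k')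
    (hs : s ≠ 0) (hx : (i : ℝ) + s * (k - i) = i + r * (k' - i))
    (hy : y + s * (v - y) = y' + r * (v' - y')) (hz : z + s * (w - z) = z' + r * (w' - z'))
    (hd : y - y' = 0 ∨ K / 2 * |y - y'| ≤ |z - z'|) : False := by
  have h1 := hB.one_le_T
  have h2 := hB.one_le_K
  have h3 := hB.le_α
  have hk1 := one_le_abs_cast_sub hk
  have hk1' := one_le_abs_cast_sub hk'
  refine not_meet_of_steep (a := (k : ℝ) - i) (b := (k' : ℝ) - i) ?_ ?_ hs (by linarith) hy hz hd ?_
  · exact abs_pos.1 (by linarith)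
  · exact abs_pos.1 (by linarith)
  have e1 := abs_sub_div_le one_pos hk1 (g.z_nonneg hB) (g.z_le' hB) (h.z_nonneg hB) (h.z_le' hB)
  have e2 := abs_sub_div_le one_pos hk1' (g'.z_nonneg hB) (g'.z_le' hB) (h'.z_nonneg hB)
    (h'.z_le' hB)
  have e3 := abs_le.1 (groupSlope_bounds h g hk)
  have e4 := abs_le.1 (groupSlope_bounds h' g' hk')
  have e5 : α ≤ |α * (i + k') - α * (i + k)| := by
    have : α * ((i : ℝ) + k') - α * (i + k) = α * ((k' : ℝ) - k) := by ring
    rw [this, abs_mul, abs_of_pos (by linarith)]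
    have := one_le_abs_cast_sub hkk
    nlinarith
  have e6 : α - 22 * T ≤ |(v' - y') / ((k' : ℝ) - i) - (v - y) / ((k : ℝ) - i)| := by
    rcases le_abs.1 e5 with e5 | e5
    · exact le_abs.2 (Or.inl (by linarith))
    · exact le_abs.2 (Or.inr (by linarith))
  have e7 := abs_sub ((w' - z') / ((k' : ℝ) - i)) ((w - z) / ((k : ℝ) - i))
  -- `10978 = 11000 - 22`; half of it exceeds 2000, and the z-slopes differ by at most `2000 K T`.
  have e8 : K / 2 * (10978 * T) ≤
      K / 2 * |(v' - y') / ((k' : ℝ) - i) - (v - y) / ((k : ℝ) - i)| :=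
    mul_le_mul_of_nonneg_left (by linarith) (by linarith)
  have e9 : 0 < K * T := by positivity
  linarith

/-- Edges from one group to another group and to a line. -/
theorem group_line_disjoint (hB : DrawingBounds m T K α Y) {i k j : ℕ}
    {y z y' z' v w w' s r : ℝ} (h : IsGroupPoint α T (K * T) i y z)
    (h' : IsGroupPoint α T (K * T) i y' z') (g : IsGroupPoint α T (K * T) k v w)
    (hj : (j : ℝ) ≤ m - 1) (hw0 : 0 ≤ w') (hw : w' ≤ K * T) (hk : i ≠ k)
    (hs : s ≠ 0) (hx : (i : ℝ) + s * (k - i) = i + r * (10 ^ 6 * (m + j) - i))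
    (hy : y + s * (v - y) = y' + r * (-(Y + j ^ 2) - y'))
    (hz : z + s * (w - z) = z' + r * (w' - z'))
    (hd : y - y' = 0 ∨ K / 2 * |y - y'| ≤ |z - z'|) : False := by
  have h1 := hB.one_le_T
  have h2 := hB.one_le_K
  have h3 := hB.le_α
  have h4 := hB.one_le_m
  have hk1 := one_le_abs_cast_sub hk
  obtain ⟨b1, -⟩ := lineDist_bounds (i := i) h.cast_le h4 (Nat.cast_nonneg j) hj
  have e9 : 0 < K * T := by positivity
  refine not_meet_of_steep (a := (k : ℝ) - i) (b := 10 ^ 6 * (m + j) - i) ?_ (by linarith) hs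
    (by linarith) hy hz hd ?_
  · exact abs_pos.1 (by linarith)
  have e1 := abs_sub_div_le one_pos hk1 (g.z_nonneg hB) (g.z_le' hB) (h.z_nonneg hB) (h.z_le' hB)
  have e2 := abs_sub_div_le one_pos (a := 10 ^ 6 * (m + j) - (i : ℝ))
    ((by linarith : (1 : ℝ) ≤ _).trans (le_abs_self _))
    hw0 (hw.trans (by linarith : K * T ≤ 1000 * (K * T))) (h'.z_nonneg hB) (h'.z_le' hB)
  have e3 := abs_le.1 (groupSlope_bounds h g hk)
  obtain ⟨e4, -⟩ := lineSlope_bounds hB h' (Nat.cast_nonneg j) hj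
  have e5 : 0 ≤ α * ((i : ℝ) + k) := by
    have : 0 ≤ α := by linarith
    positivity
  have e6 : (-(Y + (j : ℝ) ^ 2) - y') / (10 ^ 6 * (m + j) - i) =
      -((Y + (j : ℝ) ^ 2 + y') / (10 ^ 6 * (m + j) - i)) := by
    rw [← neg_div]; ring
  rw [e6]
  have e7 := abs_sub ((w' - z') / (10 ^ 6 * (m + j) - i)) ((w - z) / ((k : ℝ) - i))
  have e8 : K / 2 * (10978 * T) ≤ K / 2 *
      |-((Y + (j : ℝ) ^ 2 + y') / (10 ^ 6 * (m + j) - i)) - (v - y) / ((k : ℝ) - i)| :=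
    mul_le_mul_of_nonneg_left (le_abs.2 (Or.inr (by linarith))) (by linarith)
  linarith

/-- Edges from one group to two different lines. -/
theorem line_line_disjoint (hB : DrawingBounds m T K α Y) {i j j' : ℕ}
    {y z y' z' w w' s r : ℝ} (h : IsGroupPoint α T (K * T) i y z)
    (h' : IsGroupPoint α T (K * T) i y' z')
    (hj : (j : ℝ) ≤ m - 1) (hj' : (j' : ℝ) ≤ m - 1) (hjj : j ≠ j')
    (hw0 : 0 ≤ w) (hw : w ≤ K * T) (hw0' : 0 ≤ w') (hw' : w' ≤ K * T)
    (hs : s ≠ 0)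
    (hx : (i : ℝ) + s * (10 ^ 6 * (m + j) - i) = i + r * (10 ^ 6 * (m + j') - i))
    (hy : y + s * (-(Y + j ^ 2) - y) = y' + r * (-(Y + j' ^ 2) - y'))
    (hz : z + s * (w - z) = z' + r * (w' - z'))
    (hd : y - y' = 0 ∨ K / 2 * |y - y'| ≤ |z - z'|) : False := by
  have h1 := hB.one_le_T
  have h2 := hB.one_le_K
  have h4 := hB.one_le_m
  obtain ⟨a1, -⟩ := lineDist_bounds (i := i) h.cast_le h4 (Nat.cast_nonneg j) hj
  obtain ⟨b1, -⟩ := lineDist_bounds (i := i) h.cast_le h4 (Nat.cast_nonneg j') hj'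
  have e9 : 0 < K * T := by positivity
  refine not_meet_of_steep (a := 10 ^ 6 * (m + j) - i) (b := 10 ^ 6 * (m + j') - i) (by linarith)
    (by linarith) hs (by linarith) hy hz hd ?_
  have hm0 : 0 < 10 ^ 6 * m / 2 := by linarith
  have e1 := abs_sub_div_le hm0 (a1.trans (le_abs_self _)) hw0
    (hw.trans (by linarith : K * T ≤ 1000 * (K * T))) (h.z_nonneg hB) (h.z_le' hB)
  have e2 := abs_sub_div_le hm0 (b1.trans (le_abs_self _)) hw0'
    (hw'.trans (by linarith : K * T ≤ 1000 * (K * T))) (h'.z_nonneg hB) (h'.z_le' hB)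
  have e3 := lineSlope_diff hB h h' hj hj' hjj
  have e6 : ∀ (j : ℕ) (y : ℝ), (-(Y + (j : ℝ) ^ 2) - y) / (10 ^ 6 * (m + j) - i) =
      -((Y + (j : ℝ) ^ 2 + y) / (10 ^ 6 * (m + j) - i)) := by
    intro j y
    rw [← neg_div]; ring
  rw [e6, e6, neg_sub_neg]
  have e7 := abs_sub ((w' - z') / (10 ^ 6 * (m + j') - i)) ((w - z) / (10 ^ 6 * (m + j) - i))
  have e8 := mul_le_mul_of_nonneg_left e3 (by linarith : 0 ≤ K / 2)
  -- The inequality amounts to `128000 * m * T < Y`.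
  have e10 : 1000 * (K * T) / (10 ^ 6 * m / 2) + 1000 * (K * T) / (10 ^ 6 * m / 2) <
      K / 2 * (Y / (16 * 10 ^ 6 * m ^ 2)) := by
    have e : K / 2 * (Y / (16 * 10 ^ 6 * m ^ 2)) -
        (1000 * (K * T) / (10 ^ 6 * m / 2) + 1000 * (K * T) / (10 ^ 6 * m / 2)) =
        K * (Y - 128000 * m * T) / (32 * 10 ^ 6 * m ^ 2) := by
      field_simp
      ring
    rw [← sub_pos, e]
    have hY := hB.le_Y
    have : 0 < m * T := by positivity
    have : 0 < m ^ 2 := by positivity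
    apply div_pos
    · apply mul_pos (by linarith)
      linarith
    · positivity
  linarith

/-- Edges from two groups to two lines. -/
theorem group_line_group_line_disjoint (hB : DrawingBounds m T K α Y) {i i' j j' : ℕ}
    {y z y' z' w w' s r : ℝ} (h : IsGroupPoint α T (K * T) i y z)
    (h' : IsGroupPoint α T (K * T) i' y' z') (hii : i ≠ i')
    (hj : (j : ℝ) ≤ m - 1) (hj' : (j' : ℝ) ≤ m - 1) (hjj : j ≠ j')
    (hw0 : 0 ≤ w) (hw : w ≤ K * T) (hw0' : 0 ≤ w') (hw' : w' ≤ K * T)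
    (hs : 0 < s) (hr : 0 < r)
    (hx : (i : ℝ) + s * (10 ^ 6 * (m + j) - i) = i' + r * (10 ^ 6 * (m + j') - i'))
    (hy : y + s * (-(Y + j ^ 2) - y) = y' + r * (-(Y + j' ^ 2) - y'))
    (hz : z + s * (w - z) = z' + r * (w' - z')) : False := by
  have h1 := hB.one_le_T
  have h2 := hB.one_le_K
  have h4 := hB.one_le_m
  obtain ⟨a1, -⟩ := lineDist_bounds (i := i) h.cast_le h4 (Nat.cast_nonneg j) hj
  obtain ⟨b1, -⟩ := lineDist_bounds (i := i') h'.cast_le h4 (Nat.cast_nonneg j') hj'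
  have e9 : 0 < K * T := by positivity
  have hmT : 0 < m * T := by positivity
  have hm2 : 0 < m ^ 2 := by positivity
  have hY := hB.le_Y
  have hY0 : 0 < Y := by linarith
  have e3 := lineSlope_diff hB h h' hj hj' hjj
  obtain ⟨g1, g2⟩ := lineSlope_bounds hB h' (Nat.cast_nonneg j') hj'
  have ea : s * (-(Y + (j : ℝ) ^ 2) - y) = -(s * (10 ^ 6 * (m + j) - i)) *
      ((Y + (j : ℝ) ^ 2 + y) / (10 ^ 6 * (m + j) - i)) := by
    have : 10 ^ 6 * (m + j) - (i : ℝ) ≠ 0 := by linarith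
    field_simp
    ring
  have eb : r * (-(Y + (j' : ℝ) ^ 2) - y') = -(r * (10 ^ 6 * (m + j') - i')) *
      ((Y + (j' : ℝ) ^ 2 + y') / (10 ^ 6 * (m + j') - i')) := by
    have : 10 ^ 6 * (m + j') - (i' : ℝ) ≠ 0 := by linarith
    field_simp
    ring
  rw [ea, eb] at hy
  clear ea eb
  generalize (Y + (j : ℝ) ^ 2 + y) / (10 ^ 6 * (m + j) - i) = g at *
  generalize (Y + (j' : ℝ) ^ 2 + y') / (10 ^ 6 * (m + j') - i') = g' at *
  generalize 10 ^ 6 * (m + (j : ℝ)) - i = a at *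
  generalize 10 ^ 6 * (m + (j' : ℝ)) - i' = b at *
  have ha : 0 < a := by linarith
  have hb : 0 < b := by linarith
  have hsa : 0 < s * a := mul_pos hs ha
  have hrb : 0 < r * b := mul_pos hr hb
  have hi8 := h.cast_le
  have hi8' := h'.cast_le
  have hi0 : (0 : ℝ) ≤ i := Nat.cast_nonneg i
  have hi0' : (0 : ℝ) ≤ i' := Nat.cast_nonneg i'
  -- Elimination of `r`: the place where the projections cross is governed by the difference of the
  -- slopes.
  have k1 : s * a * (g - g') = (y - y') - (i' - i) * g' := by
    linear_combination (-g') * hx - hy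
  have k2 : |(y - y') - (i' - i) * g'| ≤ 10 ^ 6 * T + 8 * g' := by
    have y1 := h.y_nonneg hB
    have y2 := h.y_lt hB
    have y3 := h'.y_nonneg hB
    have y4 := h'.y_lt hB
    have hg' : 0 ≤ g' := by linarith
    have q1 : ((i' : ℝ) - i) * g' ≤ 8 * g' := mul_le_mul_of_nonneg_right (by linarith) hg'
    have q2 : -8 * g' ≤ ((i' : ℝ) - i) * g' := mul_le_mul_of_nonneg_right (by linarith) hg'
    exact abs_le.2 ⟨by linarith, by linarith⟩
  rw [← k1, abs_mul, abs_of_pos hsa] at k2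
  have k3 : s * a * (Y / (16 * 10 ^ 6 * m ^ 2)) ≤ 10 ^ 6 * T + 8 * (4 * Y / (10 ^ 6 * m)) :=
    (mul_le_mul_of_nonneg_left e3 hsa.le).trans (k2.trans (by linarith))
  -- The crossing is close to the groups. Here `520 = 16 * 32.5`: the part `16 * 32` outweighs `8 *
  -- g'`, and what remains, `Y / (2 * 10 ^ 6 * m)`, is at least `10 ^ 6 * T`.
  have k4 : s * a ≤ 520 * m := by
    by_contra hlt
    push Not at hlt
    have k5 : 520 * m * (Y / (16 * 10 ^ 6 * m ^ 2)) < s * a * (Y / (16 * 10 ^ 6 * m ^ 2)) :=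
      mul_lt_mul_of_pos_right hlt (by positivity)
    have k6 : 520 * m * (Y / (16 * 10 ^ 6 * m ^ 2)) - 8 * (4 * Y / (10 ^ 6 * m)) =
        Y / (2 * 10 ^ 6 * m) := by
      field_simp
      ring
    have k7 : 10 ^ 6 * T ≤ Y / (2 * 10 ^ 6 * m) := by
      rw [le_div_iff₀ (by positivity)]
      linarith
    linarith
  have k5 : s ≤ 1 / 400 := by
    by_contra hlt
    push Not at hlt
    have : 1 / 400 * (10 ^ 6 * m / 2) ≤ s * a := mul_le_mul hlt.le a1 (by positivity) hs.le
    linarith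
  have k6 : r ≤ 1 / 400 := by
    by_contra hlt
    push Not at hlt
    have : 1 / 400 * (10 ^ 6 * m / 2) ≤ r * b := mul_le_mul hlt.le b1 (by positivity) hr.le
    linarith
  have z1 := h.z_nonneg hB
  have z2 := h.z_le' hB
  have z3 := h'.z_nonneg hB
  have z4 := h'.z_le' hB
  have l : ∀ s t : ℝ, 0 < s → s ≤ 1 / 400 → |t| ≤ 1000 * (K * T) →
      |s * t| ≤ 1 / 400 * (1000 * (K * T)) := by
    intro s t hs hs' ht
    rw [abs_mul, abs_of_pos hs]
    exact mul_le_mul hs' ht (abs_nonneg t) (by norm_num)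
  have l1 := abs_le.1 (l s (w - z) hs k5 (abs_le.2 ⟨by linarith, by linarith⟩))
  have l2 := abs_le.1 (l r (w' - z') hr k6 (abs_le.2 ⟨by linarith, by linarith⟩))
  -- So early on, each edge has changed its height by at most `2.5 K T`, whereas the height ranges
  -- of two groups are at least `9 K T` apart.
  rcases lt_or_gt_of_ne hii with hlt | hlt
  · have : (i : ℝ) + 1 ≤ i' := by exact_mod_cast hlt
    have e := mul_le_mul_of_nonneg_left this (by linarith : 0 ≤ 110 * (K * T))
    have := h.z_le
    have := h'.le_z
    linarith
  · have : (i' : ℝ) + 1 ≤ i := by exact_mod_cast hlt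
    have e := mul_le_mul_of_nonneg_left this (by linarith : 0 ≤ 110 * (K * T))
    have := h.le_z
    have := h'.z_le
    linarith

/-- Edges from two groups to the same line. -/
theorem same_line_disjoint (hB : DrawingBounds m T K α Y) {i i' j : ℕ} {y z y' z' s r : ℝ}
    (h : IsGroupPoint α T (K * T) i y z) (h' : IsGroupPoint α T (K * T) i' y' z')
    (hj : (j : ℝ) ≤ m - 1) (hs : s < 1)
    (hx : (i : ℝ) + s * (10 ^ 6 * (m + j) - i) = i' + r * (10 ^ 6 * (m + j) - i'))
    (hy : y + s * (-(Y + j ^ 2) - y) = y' + r * (-(Y + j ^ 2) - y')) : i = i' := by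
  by_contra hii
  have h1 := hB.one_le_T
  have h4 := hB.one_le_m
  have hY := hB.le_Y
  obtain ⟨a1, a2⟩ := lineDist_bounds (i := i) h.cast_le h4 (Nat.cast_nonneg j) hj
  obtain ⟨b1, b2⟩ := lineDist_bounds (i := i') h'.cast_le h4 (Nat.cast_nonneg j) hj
  have y1 := h.y_nonneg hB
  have y2 := (h.y_lt hB).le
  have y3 := h'.y_nonneg hB
  have y4 := (h'.y_lt hB).le
  have k1 : (1 - s) * ((y + (Y + j ^ 2)) * (10 ^ 6 * (m + j) - i') -
      (y' + (Y + j ^ 2)) * (10 ^ 6 * (m + j) - i)) = 0 := by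
    linear_combination (10 ^ 6 * (m + (j : ℝ)) - i') * hy + (y' + (Y + (j : ℝ) ^ 2)) * hx
  -- The projections both end at the line. If they also meet before it, they have the same slope,
  -- and moving from one group to another would change `y` by far more than the groups allow.
  have k2 := (mul_eq_zero.1 k1).resolve_left (by linarith)
  have k3 : (Y + (j : ℝ) ^ 2) * (i' - i) =
      y * (10 ^ 6 * (m + j) - i') - y' * (10 ^ 6 * (m + j) - i) := by linarith
  generalize 10 ^ 6 * (m + (j : ℝ)) - i = a at *
  generalize 10 ^ 6 * (m + (j : ℝ)) - i' = b at *
  have k4 : y * b ≤ 10 ^ 6 * T * (2 * 10 ^ 6 * m) :=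
    mul_le_mul y2 b2 (by linarith) (by linarith)
  have k5 : y' * a ≤ 10 ^ 6 * T * (2 * 10 ^ 6 * m) :=
    mul_le_mul y4 a2 (by linarith) (by linarith)
  have k6 : 0 ≤ y * b := mul_nonneg y1 (by linarith)
  have k7 : 0 ≤ y' * a := mul_nonneg y3 (by linarith)
  have k8 : 0 < m ^ 2 := by positivity
  have k9 : |(Y + (j : ℝ) ^ 2) * (i' - i)| ≤ 10 ^ 6 * T * (2 * 10 ^ 6 * m) := by
    rw [k3]
    exact abs_le.2 ⟨by linarith, by linarith⟩
  have k10 : Y ≤ |(Y + (j : ℝ) ^ 2) * (i' - i)| := by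
    rw [abs_mul]
    have q1 := one_le_abs_cast_sub hii
    have q2 := le_abs_self (Y + (j : ℝ) ^ 2)
    have q3 := sq_nonneg (j : ℝ)
    have q4 := mul_le_mul_of_nonneg_left q1 (abs_nonneg (Y + (j : ℝ) ^ 2))
    linarith
  linarith

/-- Both ends lie above the parabola `α x²`, so the edge lies above the chord. -/
theorem group_chord_ge {H : ℝ} {i k : ℕ} {y z v w s X : ℝ}
    (h : IsGroupPoint α T H i y z) (g : IsGroupPoint α T H k v w) (hs0 : 0 ≤ s) (hs : s ≤ 1)
    (hX : X = i + s * (k - i)) :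
    α * (i ^ 2 + (X - i) * (i + k)) ≤ y + s * (v - y) := by
  have h1 := mul_le_mul_of_nonneg_left h.le_y (by linarith : 0 ≤ 1 - s)
  have h2 := mul_le_mul_of_nonneg_left g.le_y hs0
  subst hX
  linarith

theorem group_to_line_le (hB : DrawingBounds m T K α Y) {i j : ℕ} {y z r X : ℝ}
    (h : IsGroupPoint α T (K * T) i y z) (hj : (j : ℝ) ≤ m - 1) (hr : 0 ≤ r)
    (hX : X = i + r * (10 ^ 6 * (m + j) - i)) :
    y + r * (-(Y + j ^ 2) - y) ≤ α * i ^ 2 + 11 * T - (X - i) * (10 ^ 6 * T) := by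
  have h4 := hB.one_le_m
  obtain ⟨b1, b2⟩ := lineDist_bounds (i := i) h.cast_le h4 (Nat.cast_nonneg j) hj
  obtain ⟨g1, -⟩ := lineSlope_bounds hB h (Nat.cast_nonneg j) hj
  rw [le_div_iff₀ (by linarith)] at g1
  have h1 := h.y_le
  have h2 := mul_le_mul_of_nonneg_left g1 hr
  subst hX
  linarith

/-- Edges between two groups and edges from a third group to a line. -/
theorem chord_line_disjoint (hB : DrawingBounds m T K α Y) {i k i' j : ℕ}
    {y z v w y' z' s r : ℝ} (h : IsGroupPoint α T (K * T) i y z)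
    (g : IsGroupPoint α T (K * T) k v w) (h' : IsGroupPoint α T (K * T) i' y' z')
    (hii : i ≠ i') (hj : (j : ℝ) ≤ m - 1) (hik : i < k) (hs0 : 0 < s) (hs : s < 1) (hr : 0 < r)
    (hx : (i : ℝ) + s * (k - i) = i' + r * (10 ^ 6 * (m + j) - i'))
    (hy : y + s * (v - y) = y' + r * (-(Y + j ^ 2) - y')) : False := by
  have h1 := hB.one_le_T
  have h3 := hB.le_α
  have h4 := hB.one_le_m
  have h5 := hB.α_le
  have hα : 0 ≤ α := by linarith
  obtain ⟨b1, -⟩ := lineDist_bounds (i := i') h'.cast_le h4 (Nat.cast_nonneg j) hj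
  obtain ⟨X, hX⟩ : ∃ X, X = (i : ℝ) + s * (k - i) := ⟨_, rfl⟩
  have e1 := group_chord_ge h g hs0.le hs.le hX
  have e2 := group_to_line_le hB h' hj hr.le (hX.trans hx)
  have hik' : (i : ℝ) + 1 ≤ k := by exact_mod_cast hik
  have hi0 : (0 : ℝ) ≤ i := Nat.cast_nonneg i
  have hi0' : (0 : ℝ) ≤ i' := Nat.cast_nonneg i'
  have hXi : (i : ℝ) < X := by
    have := mul_pos hs0 (by linarith : (0 : ℝ) < k - i)
    linarith
  have hXk : X < k := by
    have := mul_pos (by linarith : 0 < 1 - s) (by linarith : (0 : ℝ) < k - i)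
    linarith
  have hXi' : (i' : ℝ) < X := by
    have := mul_pos hr (by linarith : 0 < 10 ^ 6 * (m + (j : ℝ)) - i')
    linarith
  -- If the edge to the line starts between the groups of the chord, the chord passes at least `α`
  -- above the start. If it starts before both, it is already below `y = 0` when it reaches the
  -- first of them.
  rcases lt_or_gt_of_ne hii with hlt | hlt
  · have c1 : (i : ℝ) + 1 ≤ i' := by exact_mod_cast hlt
    have c2 : i' < k := by exact_mod_cast hXi'.trans hXk
    have c3 : (i' : ℝ) + 1 ≤ k := by exact_mod_cast c2
    have c4 : ((i' : ℝ) - i) * (i' + 1 + i) ≤ (X - i) * (i + k) :=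
      mul_le_mul (by linarith) (by linarith) (by linarith) (by linarith)
    have c5 : α * ((i' : ℝ) ^ 2 + 1) ≤ α * (i ^ 2 + (X - i) * (i + k)) :=
      mul_le_mul_of_nonneg_left (by nlinarith) hα
    have c6 : 0 ≤ (X - i') * (10 ^ 6 * T) := mul_nonneg (by linarith) (by linarith)
    linarith
  · have c1 : (i' : ℝ) + 1 ≤ i := by exact_mod_cast hlt
    have c2 : 1 * (10 ^ 6 * T) ≤ (X - i') * (10 ^ 6 * T) :=
      mul_le_mul_of_nonneg_right (by linarith) (by linarith)
    have c3 : 0 ≤ α * ((i : ℝ) ^ 2 + (X - i) * (i + k)) := by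
      have : 0 ≤ X - i := by linarith
      positivity
    have c4 := h'.cast_le
    have c5 : (i' : ℝ) ^ 2 ≤ 64 := by nlinarith
    have c6 := mul_le_mul_of_nonneg_left c5 hα
    linarith

/-- Edges from a group to a line lie strictly outside the parabola of the lines. -/
theorem outside_parabola (hB : DrawingBounds m T K α Y) {i j : ℕ} {y z s : ℝ}
    (h : IsGroupPoint α T (K * T) i y z) (hj : (j : ℝ) ≤ m - 1) (hs : s < 1) {ω : ℝ}
    (hω : (i : ℝ) + s * (10 ^ 6 * (m + j) - i) = 10 ^ 6 * (m + ω)) :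
    -(Y + ω ^ 2) < y + s * (-(Y + j ^ 2) - y) := by
  have h1 := hB.one_le_T
  have h4 := hB.one_le_m
  have hY := hB.le_Y
  have y1 := h.y_nonneg hB
  have hi8 := h.cast_le
  have hi0 : (0 : ℝ) ≤ i := Nat.cast_nonneg i
  have hj0 : (0 : ℝ) ≤ j := Nat.cast_nonneg j
  -- The position of the group on the scale on which the lines are at `0, …, m - 1`.
  obtain ⟨a, ha⟩ : ∃ a, a = (i : ℝ) / 10 ^ 6 - m := ⟨_, rfl⟩
  have hω' : ω = (1 - s) * a + s * j := by
    rw [ha]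
    linarith
  have e : y + s * (-(Y + (j : ℝ) ^ 2) - y) + (Y + ω ^ 2) =
      (1 - s) * (y + Y + a ^ 2 - s * (a - j) ^ 2) := by
    rw [hω']; ring
  have k1 : (a - j) ^ 2 ≤ 4 * m ^ 2 := by
    have q1 : -(2 * m) ≤ a - j := by linarith
    have q2 : a - j ≤ 2 * m := by linarith
    nlinarith
  have k2 : s * (a - j) ^ 2 ≤ (a - j) ^ 2 := by nlinarith [sq_nonneg (a - j)]
  have k3 : 0 < m * T := by positivity
  have k4 : 0 < (1 - s) * (y + Y + a ^ 2 - s * (a - j) ^ 2) :=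
    mul_pos (by linarith) (by nlinarith [sq_nonneg a, sq_nonneg m])
  linarith

/-- Chords lie strictly inside the parabola of the lines. -/
theorem inside_parabola {j k : ℕ} (hjk : j ≠ k) {s ω : ℝ} (hs0 : 0 < s) (hs : s < 1)
    (hω : ω = j + s * (k - j)) :
    -(Y + (j : ℝ) ^ 2) + s * (-(Y + k ^ 2) - -(Y + j ^ 2)) < -(Y + ω ^ 2) := by
  have h1 : ((k : ℝ) - j) ≠ 0 := sub_ne_zero.2 (by exact_mod_cast hjk.symm)
  have h2 : 0 < s * (1 - s) * ((k : ℝ) - j) ^ 2 := by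
    have : 0 < 1 - s := by linarith
    positivity
  subst hω
  linarith

/-- Two chords of the parabola with a common end. -/
theorem chords_eq_of_common_end {j k k' : ℕ} (hj : j ≠ k) {s r : ℝ} (hs : s ≠ 0)
    (hx : s * ((k : ℝ) - j) = r * (k' - j)) (hy : s * ((k : ℝ) ^ 2 - j ^ 2) = r * (k' ^ 2 - j ^ 2)) :
    k = k' := by
  have h1 : ((k : ℝ) - j) ≠ 0 := sub_ne_zero.2 (by exact_mod_cast hj.symm)
  have h2 : s * ((k : ℝ) - j) * (k - k') = 0 := by
    linear_combination hy - (j + k' : ℝ) * hx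
  have h3 := (mul_eq_zero.1 h2).resolve_left (mul_ne_zero hs h1)
  exact_mod_cast sub_eq_zero.1 h3

end Cases

/-! ### Placements and the disjointness of their edges -/

/-- Coordinates for the vertices of a track layout in which all edges are pairwise disjoint. -/
structure SimpleGraph.TrackLayout.Placement {V : Type*} {G : SimpleGraph V} {m t : ℕ}
    (Lo : G.TrackLayout m t) (p : ℕ) (T K α Y ℓ : ℝ) (x y z : V → ℤ) : Prop where
  bounds : DrawingBounds m T K α Y
  lt_p : m < p
  window_lt : 2 * ℓ < K
  x_group : ∀ u, u ∉ Lo.X → x u = Lo.grp u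
  point_group : ∀ u, u ∉ Lo.X → IsGroupPoint α T (K * T) (Lo.grp u) (y u) (z u)
  y_mod_group : ∀ u, u ∉ Lo.X → (y u : ZMod 11) = ((Lo.grp u : ℤ) : ZMod 11) ^ 2
  z_mod_group : ∀ u, u ∉ Lo.X → (z u : ZMod 11) = ((Lo.grp u : ℤ) : ZMod 11) ^ 3
  diff_group : ∀ u, u ∉ Lo.X → ∀ v, v ∉ Lo.X → Lo.grp u = Lo.grp v →
    (y u = y v ∧ Lo.trk u = Lo.trk v ∧ (Lo.ord u < Lo.ord v → z u < z v)) ∨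
    (y u ≠ y v ∧ |(z u - z v : ℝ) - K * (Lo.grp u + 1) * (y u - y v)| ≤ ℓ * |(y u - y v : ℝ)|)
  x_line : ∀ u ∈ Lo.X, x u = 10 ^ 6 * (m + Lo.line u)
  y_line : ∀ u ∈ Lo.X, (y u : ℝ) = -(Y + (Lo.line u : ℝ) ^ 2)
  z_line_nonneg : ∀ u ∈ Lo.X, (0 : ℝ) ≤ z u
  z_line_le : ∀ u ∈ Lo.X, (z u : ℝ) ≤ K * T
  z_mod_line : ∀ u ∈ Lo.X, (z u : ZMod p) = ((Lo.line u : ℤ) : ZMod p) ^ 3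
  z_lt_line : ∀ u ∈ Lo.X, ∀ v ∈ Lo.X, Lo.line u = Lo.line v → Lo.ord u < Lo.ord v → z u < z v

namespace SimpleGraph.TrackLayout.Placement

variable {V : Type*} {G : SimpleGraph V} {m t : ℕ} {Lo : G.TrackLayout m t} {p : ℕ}
  {T K α Y ℓ : ℝ} {x y z : V → ℤ}

/-- `u` and `v` are on the same track. -/
def SameTrack (Lo : G.TrackLayout m t) (u v : V) : Prop :=
  u ∈ Lo.X ∧ v ∈ Lo.X ∧ Lo.line u = Lo.line v ∨
    u ∉ Lo.X ∧ v ∉ Lo.X ∧ Lo.grp u = Lo.grp v ∧ Lo.trk u = Lo.trk v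

theorem SameTrack.symm {u v : V} (h : SameTrack Lo u v) : SameTrack Lo v u := by
  rcases h with h | h
  · exact Or.inl ⟨h.2.1, h.1, h.2.2.symm⟩
  · exact Or.inr ⟨h.2.1, h.1, h.2.2.1.symm, h.2.2.2.symm⟩

theorem SameTrack.eq {u v : V} (h : SameTrack Lo u v) (ho : Lo.ord u = Lo.ord v) : u = v := by
  rcases h with h | h
  · exact Lo.eq_of_line_eq u h.1 v h.2.1 h.2.2 ho
  · exact Lo.eq_of_trk_eq u h.1 v h.2.1 h.2.2.1 h.2.2.2 ho

theorem one_le_m (P : Lo.Placement p T K α Y ℓ x y z) : (1 : ℝ) ≤ m := P.bounds.one_le_m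

theorem line_le (P : Lo.Placement p T K α Y ℓ x y z) {u : V} (hu : u ∈ Lo.X) :
    (Lo.line u : ℝ) ≤ m - 1 := by
  have h1 : Lo.line u + 1 ≤ m := Lo.line_lt u hu
  have h2 : ((Lo.line u : ℝ) + 1) ≤ m := by exact_mod_cast h1
  have := P.one_le_m
  linarith

theorem x_group_lt_x_line (P : Lo.Placement p T K α Y ℓ x y z) {u v : V} (hu : u ∉ Lo.X)
    (hv : v ∈ Lo.X) : x u < x v := by
  have h1 := Lo.grp_lt u hu
  have h2 : (1 : ℤ) ≤ m := by exact_mod_cast P.one_le_m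
  rw [P.x_group u hu, P.x_line v hv]
  omega

theorem xr_group (P : Lo.Placement p T K α Y ℓ x y z) {u : V} (hu : u ∉ Lo.X) :
    (x u : ℝ) = Lo.grp u := by
  rw [P.x_group u hu]; simp

theorem xr_line (P : Lo.Placement p T K α Y ℓ x y z) {u : V} (hu : u ∈ Lo.X) :
    (x u : ℝ) = 10 ^ 6 * (m + Lo.line u) := by
  rw [P.x_line u hu]; push_cast; ring

theorem z_lt_of_sameTrack (P : Lo.Placement p T K α Y ℓ x y z) {u v : V} (h : SameTrack Lo u v)
    (hy : y u = y v) (ho : Lo.ord u < Lo.ord v) : z u < z v := by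
  rcases h with h | h
  · exact P.z_lt_line u h.1 v h.2.1 h.2.2 ho
  · rcases P.diff_group u h.1 v h.2.1 h.2.2.1 with h' | h'
    · exact h'.2.2 ho
    · exact absurd hy h'.1

/-- Points in different columns of a group differ with slope at least `K`, up to an error `ℓ < K /
2`. -/
theorem steep (P : Lo.Placement p T K α Y ℓ x y z) {u v : V} (hu : u ∉ Lo.X) (hv : v ∉ Lo.X)
    (h : Lo.grp u = Lo.grp v) :
    (y u - y v : ℝ) = 0 ∨ K / 2 * |(y u - y v : ℝ)| ≤ |(z u - z v : ℝ)| := by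
  rcases P.diff_group u hu v hv h with h' | h'
  · exact Or.inl (by rw [h'.1]; ring)
  · right
    have h1 := h'.2
    have hK := P.bounds.one_le_K
    have hw := P.window_lt
    have h2 : |K * ((Lo.grp u : ℝ) + 1) * (y u - y v)| =
        K * ((Lo.grp u : ℝ) + 1) * |(y u - y v : ℝ)| := by
      rw [abs_mul, abs_of_nonneg (by positivity)]
    have h3 : |K * ((Lo.grp u : ℝ) + 1) * (y u - y v)| ≤ |(z u - z v : ℝ)| +
        |(z u - z v : ℝ) - K * (Lo.grp u + 1) * (y u - y v)| := by
      have := abs_sub (z u - z v : ℝ) ((z u - z v : ℝ) - K * (Lo.grp u + 1) * (y u - y v))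
      simpa using this
    have h4 : K * 1 * |(y u - y v : ℝ)| ≤ K * ((Lo.grp u : ℝ) + 1) * |(y u - y v : ℝ)| := by
      apply mul_le_mul_of_nonneg_right _ (abs_nonneg _)
      apply mul_le_mul_of_nonneg_left _ (by linarith)
      have : (0 : ℝ) ≤ Lo.grp u := Nat.cast_nonneg _
      linarith
    have h5 : ℓ * |(y u - y v : ℝ)| ≤ K / 2 * |(y u - y v : ℝ)| :=
      mul_le_mul_of_nonneg_right (by linarith) (abs_nonneg _)
    linarith

/-- Two edges between the same two tracks do not meet. -/
theorem same_tracks_disjoint (P : Lo.Placement p T K α Y ℓ x y z) {u v u' v' : V}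
    (hu : SameTrack Lo u u') (hv : SameTrack Lo v v') (hyu : y u = y u') (hyv : y v = y v')
    (ha : G.Adj u v) (ha' : G.Adj u' v') (hne : ¬ (u = u' ∧ v = v')) {s : ℝ} (hs0 : 0 < s)
    (hs : s < 1) (h : (1 - s) * (z u - z u') + s * (z v - z v') = 0) : False := by
  have key : ∀ u v u' v', SameTrack Lo u u' → SameTrack Lo v v' → y u = y u' → y v = y v' →
      G.Adj u v → G.Adj u' v' → Lo.ord u < Lo.ord u' →
      (1 - s) * (z u - z u' : ℝ) + s * (z v - z v') < 0 := by
    intro u v u' v' hu hv hyu hyv ha ha' ho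
    have h1 : (z u : ℝ) < z u' := by exact_mod_cast P.z_lt_of_sameTrack hu hyu ho
    have h2 : (z v : ℝ) ≤ z v' := by
      rcases (Lo.ord_le u v u' v' ha ha' hu hv ho).lt_or_eq with h | h
      · exact_mod_cast (P.z_lt_of_sameTrack hv hyv h).le
      · rw [hv.eq h]
    have h3 : (1 - s) * (z u - z u' : ℝ) < 0 := mul_neg_of_pos_of_neg (by linarith) (by linarith)
    have h4 : s * (z v - z v' : ℝ) ≤ 0 := mul_nonpos_of_nonneg_of_nonpos hs0.le (by linarith)
    linarith
  rcases lt_trichotomy (Lo.ord u) (Lo.ord u') with ho | ho | ho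
  · have := key u v u' v' hu hv hyu hyv ha ha' ho
    linarith
  · have huu := hu.eq ho
    subst huu
    have h1 : s * (z v - z v' : ℝ) = 0 := by linarith
    have h2 : z v = z v' := by
      have := (mul_eq_zero.1 h1).resolve_left hs0.ne'
      exact_mod_cast sub_eq_zero.1 this
    rcases lt_trichotomy (Lo.ord v) (Lo.ord v') with ho | ho | ho
    · have := P.z_lt_of_sameTrack hv hyv ho
      omega
    · exact hne ⟨rfl, hv.eq ho⟩
    · have := P.z_lt_of_sameTrack hv.symm hyv.symm ho
      omega
  · have := key u' v' u v hu.symm hv.symm hyu.symm hyv.symm ha' ha ho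
    linarith

theorem cast_zmod_ne {p a b : ℕ} (ha : a < p) (hb : b < p) (h : a ≠ b) :
    ((a : ℤ) : ZMod p) ≠ ((b : ℤ) : ZMod p) := by
  intro e
  push_cast at e
  rw [ZMod.natCast_eq_natCast_iff', Nat.mod_eq_of_lt ha, Nat.mod_eq_of_lt hb] at e
  exact h e

/-- Two edges starting in the same plane do not meet. -/
theorem disjoint_of_x_eq (P : Lo.Placement p T K α Y ℓ x y z) {u v u' v' : V}
    (ha : G.Adj u v) (ha' : G.Adj u' v') (hxv : x u < x v) (hxv' : x u' < x v') (hxu : x u = x u')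
    (hne : ¬ (u = u' ∧ v = v')) {s r : ℝ} (hs0 : 0 < s) (hs : s < 1) (hr0 : 0 < r)
    (hx : (x u : ℝ) + s * (x v - x u) = x u' + r * (x v' - x u'))
    (hy : (y u : ℝ) + s * (y v - y u) = y u' + r * (y v' - y u'))
    (hz : (z u : ℝ) + s * (z v - z u) = z u' + r * (z v' - z u')) : False := by
  -- Edges between the same two planes meet at equal parameters, which makes the meeting condition
  -- linear in the differences at the two ends.
  have hsr : x v = x v' → s = r := by
    intro e
    have h1 : (s - r) * ((x v : ℝ) - x u) = 0 := by
      rw [← e, ← hxu] at hx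
      linarith
    have h2 : ((x v : ℝ) - x u) ≠ 0 := by
      have : (x u : ℝ) < x v := by exact_mod_cast hxv
      linarith
    exact sub_eq_zero.1 ((mul_eq_zero.1 h1).resolve_right h2)
  have hymul : ∀ {a b c d : V}, s = r → (y a : ℝ) + s * (y b - y a) = y c + r * (y d - y c) →
      (1 - s) * (y a - y c : ℝ) + s * (y b - y d) = 0 := by
    intro a b c d e h
    rw [← e] at h
    linarith
  have hzmul : s = r → (1 - s) * (z u - z u' : ℝ) + s * (z v - z v') = 0 := by
    intro e
    rw [← e] at hz
    linarith
  by_cases huX : u ∈ Lo.X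
  · have huX' : u' ∈ Lo.X := by
      by_contra h
      have := P.x_group_lt_x_line h huX
      omega
    have hvX : v ∈ Lo.X := by
      by_contra h
      have := P.x_group_lt_x_line h huX
      omega
    have hvX' : v' ∈ Lo.X := by
      by_contra h
      have := P.x_group_lt_x_line h huX'
      omega
    have hlu : Lo.line u = Lo.line u' := by
      have h1 := P.x_line u huX
      have h2 := P.x_line u' huX'
      omega
    have hyu : y u = y u' := by
      have h1 := P.y_line u huX
      rw [hlu, ← P.y_line u' huX'] at h1
      exact_mod_cast h1
    by_cases hlv : Lo.line v = Lo.line v'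
    · have hyv : y v = y v' := by
        have h1 := P.y_line v hvX
        rw [hlv, ← P.y_line v' hvX'] at h1
        exact_mod_cast h1
      have e := hsr (by rw [P.x_line v hvX, P.x_line v' hvX', hlv])
      exact P.same_tracks_disjoint (Or.inl ⟨huX, huX', hlu⟩) (Or.inl ⟨hvX, hvX', hlv⟩) hyu hyv
        ha ha' hne hs0 hs (hzmul e)
    · apply hlv
      rw [P.xr_line huX, P.xr_line hvX, P.xr_line huX', P.xr_line hvX', ← hlu] at hx
      rw [P.y_line u huX, P.y_line v hvX, P.y_line u' huX', P.y_line v' hvX', ← hlu] at hy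
      exact chords_eq_of_common_end (Lo.line_ne u huX v hvX ha) hs0.ne' (r := r)
        (by linarith) (by linarith)
  · have huX' : u' ∉ Lo.X := by
      intro h
      have := P.x_group_lt_x_line huX h
      omega
    have hg : Lo.grp u = Lo.grp u' := by
      have h1 := P.x_group u huX
      have h2 := P.x_group u' huX'
      omega
    have pu := P.point_group u huX
    have pu' := P.point_group u' huX'
    rw [← hg] at pu'
    have hst := P.steep huX huX' hg
    rw [P.xr_group huX, P.xr_group huX', ← hg] at hx
    by_cases hvX : v ∈ Lo.X
    · by_cases hvX' : v' ∈ Lo.X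
      · by_cases hlv : Lo.line v = Lo.line v'
        · have e := hsr (by rw [P.x_line v hvX, P.x_line v' hvX', hlv])
          have hyv : y v = y v' := by
            have h1 := P.y_line v hvX
            rw [hlv, ← P.y_line v' hvX'] at h1
            exact_mod_cast h1
          have hyu : y u = y u' := by
            have h1 := hymul e hy
            rw [hyv, sub_self, mul_zero, add_zero] at h1
            have h2 := (mul_eq_zero.1 h1).resolve_left (by linarith)
            exact_mod_cast sub_eq_zero.1 h2
          rcases P.diff_group u huX u' huX' hg with h' | h'
          · exact P.same_tracks_disjoint (Or.inr ⟨huX, huX', hg, h'.2.1⟩)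
              (Or.inl ⟨hvX, hvX', hlv⟩) hyu hyv ha ha' hne hs0 hs (hzmul e)
          · exact h'.1 hyu
        · rw [P.xr_line hvX, P.xr_line hvX'] at hx
          rw [P.y_line v hvX, P.y_line v' hvX'] at hy
          exact line_line_disjoint P.bounds pu pu' (P.line_le hvX) (P.line_le hvX') hlv
            (P.z_line_nonneg v hvX) (P.z_line_le v hvX) (P.z_line_nonneg v' hvX')
            (P.z_line_le v' hvX') hs0.ne' hx hy hz hst
      · rw [P.xr_line hvX, P.xr_group hvX'] at hx
        rw [P.y_line v hvX] at hy
        exact group_line_disjoint P.bounds pu' pu (P.point_group v' hvX') (P.line_le hvX)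
          (P.z_line_nonneg v hvX) (P.z_line_le v hvX)
          (hg ▸ Lo.grp_ne u' huX' v' hvX' ha') hr0.ne' hx.symm hy.symm hz.symm
          (by rw [abs_sub_comm, abs_sub_comm (z u' : ℝ)]; exact hst.imp (by intro h; linarith) id)
    · by_cases hvX' : v' ∈ Lo.X
      · rw [P.xr_group hvX, P.xr_line hvX'] at hx
        rw [P.y_line v' hvX'] at hy
        exact group_line_disjoint P.bounds pu pu' (P.point_group v hvX) (P.line_le hvX')
          (P.z_line_nonneg v' hvX') (P.z_line_le v' hvX')
          (Lo.grp_ne u huX v hvX ha) hs0.ne' hx hy hz hst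
      · have pv := P.point_group v hvX
        have pv' := P.point_group v' hvX'
        have huv := Lo.grp_ne u huX v hvX ha
        by_cases hgv : Lo.grp v = Lo.grp v'
        · have e := hsr (by rw [P.x_group v hvX, P.x_group v' hvX', hgv])
          have hys := hymul e hy
          rcases P.diff_group u huX u' huX' hg with hu' | hu'
          · rcases P.diff_group v hvX v' hvX' hgv with hv' | hv'
            · exact P.same_tracks_disjoint (Or.inr ⟨huX, huX', hg, hu'.2.1⟩)
                (Or.inr ⟨hvX, hvX', hgv, hv'.2.1⟩) hu'.1 hv'.1 ha ha' hne hs0 hs (hzmul e)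
            · rw [hu'.1, sub_self, mul_zero, zero_add] at hys
              have h2 := (mul_eq_zero.1 hys).resolve_left hs0.ne'
              exact hv'.1 (by exact_mod_cast sub_eq_zero.1 h2)
          · have hve : |(z v - z v' : ℝ) - K * (Lo.grp v + 1) * (y v - y v')| ≤
                ℓ * |(y v - y v' : ℝ)| := by
              rcases P.diff_group v hvX v' hvX' hgv with hv' | hv'
              · exfalso
                rw [hv'.1, sub_self, mul_zero, add_zero] at hys
                have h2 := (mul_eq_zero.1 hys).resolve_left (by linarith)
                exact hu'.1 (by exact_mod_cast sub_eq_zero.1 h2)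
              · exact hv'.2
            -- The difference vectors at the two ends would be parallel, but their slopes lie within
            -- `ℓ` of `K` times different integers, and `2 * ℓ < K`.
            have h0 := eq_of_slope_windows hs0 hs hys (S₁ := K * (Lo.grp u + 1))
              (S₂ := K * (Lo.grp v + 1)) (by have := hzmul e; linarith) hu'.2 hve (by
                have h1 : K * ((Lo.grp u : ℝ) + 1) - K * (Lo.grp v + 1) =
                  K * ((Lo.grp u : ℝ) - Lo.grp v) := by ring
                have hK := P.bounds.one_le_K
                rw [h1, abs_mul, abs_of_pos (by linarith)]
                have h2 := one_le_abs_cast_sub huv.symm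
                have h3 := P.window_lt
                have h4 := mul_le_mul_of_nonneg_left h2 (by linarith : 0 ≤ K)
                linarith)
            exact hu'.1 (by exact_mod_cast sub_eq_zero.1 h0)
        · rw [P.xr_group hvX, P.xr_group hvX'] at hx
          exact group_group_disjoint P.bounds pu pu' pv pv' huv
            (hg ▸ Lo.grp_ne u' huX' v' hvX' ha') hgv hs0.ne' hx hy hz hst

/-- Two edges starting in different planes do not meet. -/
theorem disjoint_of_x_lt (P : Lo.Placement p T K α Y ℓ x y z) (hp : p.Prime) {u v u' v' : V}
    (ha : G.Adj u v) (ha' : G.Adj u' v') (hxv : x u < x v) (hxv' : x u' < x v') (hxu : x u < x u')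
    {s r : ℝ} (hs0 : 0 < s) (hs : s < 1) (hr0 : 0 < r) (hr : r < 1)
    (hx : (x u : ℝ) + s * (x v - x u) = x u' + r * (x v' - x u'))
    (hy : (y u : ℝ) + s * (y v - y u) = y u' + r * (y v' - y u'))
    (hz : (z u : ℝ) + s * (z v - z u) = z u' + r * (z v' - z u')) : False := by
  -- The x-ranges of the edges overlap, so `u'` cannot share a line or a group with `v`.
  have hq : x u' < x v := by
    have h1 : (x u : ℝ) < x v := by exact_mod_cast hxv
    have h2 : (x u' : ℝ) < x v' := by exact_mod_cast hxv'
    have h3 : (1 - s) * ((x v : ℝ) - x u) > 0 := mul_pos (by linarith) (by linarith)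
    have h4 : r * ((x v' : ℝ) - x u') > 0 := mul_pos hr0 (by linarith)
    have h5 : (x u' : ℝ) < x v := by linarith
    exact_mod_cast h5
  by_cases huX : u ∈ Lo.X
  · have huX' : u' ∈ Lo.X := by
      by_contra h
      have := P.x_group_lt_x_line h huX
      omega
    have hvX : v ∈ Lo.X := by
      by_contra h
      have := P.x_group_lt_x_line h huX
      omega
    have hvX' : v' ∈ Lo.X := by
      by_contra h
      have := P.x_group_lt_x_line h huX'
      omega
    have l1 := P.x_line u huX
    have l2 := P.x_line u' huX'
    have l3 := P.x_line v hvX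
    have l4 := P.x_line v' hvX'
    rw [P.xr_line huX, P.xr_line hvX, P.xr_line huX', P.xr_line hvX'] at hx
    by_cases hlv : Lo.line v = Lo.line v'
    · rw [P.y_line u huX, P.y_line v hvX, P.y_line u' huX', P.y_line v' hvX', ← hlv] at hy
      rw [← hlv] at hx
      have := chords_eq_of_common_end (j := Lo.line v) (k := Lo.line u) (k' := Lo.line u')
        (Lo.line_ne u huX v hvX ha).symm (s := 1 - s) (r := 1 - r) (by linarith)
        (by linarith) (by linarith)
      omega
    · have m1 := (Lo.line_lt u huX).trans P.lt_p
      have m2 := (Lo.line_lt v hvX).trans P.lt_p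
      have m3 := (Lo.line_lt u' huX').trans P.lt_p
      have m4 := (Lo.line_lt v' hvX').trans P.lt_p
      have : Fact p.Prime := ⟨hp⟩
      rw [P.y_line u huX, P.y_line v hvX, P.y_line u' huX', P.y_line v' hvX'] at hy
      -- An affine change of the xy-plane takes the line `j` to `(j, j²)`; the heights are `j³`
      -- modulo `p`.
      refine moment_curve_segments_disjoint p (x₁ := Lo.line u) (x₂ := Lo.line v)
        (x₃ := Lo.line u') (x₄ := Lo.line v') (y₁ := (Lo.line u : ℤ) ^ 2)
        (y₂ := (Lo.line v : ℤ) ^ 2) (y₃ := (Lo.line u' : ℤ) ^ 2) (y₄ := (Lo.line v' : ℤ) ^ 2)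
        (by push_cast; rfl) (by push_cast; rfl) (by push_cast; rfl) (by push_cast; rfl)
        (P.z_mod_line u huX) (P.z_mod_line v hvX) (P.z_mod_line u' huX') (P.z_mod_line v' hvX')
        (cast_zmod_ne m1 m2 (by omega)) (cast_zmod_ne m1 m3 (by omega))
        (cast_zmod_ne m1 m4 (by omega)) (cast_zmod_ne m2 m3 (by omega))
        (cast_zmod_ne m2 m4 (by omega)) (cast_zmod_ne m3 m4 (by omega)) s r ?_ ?_ hz
      · push_cast; linarith
      · push_cast; linarith
  have pu := P.point_group u huX
  by_cases huX' : u' ∈ Lo.X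
  · have hvX' : v' ∈ Lo.X := by
      by_contra h
      have := P.x_group_lt_x_line h huX'
      omega
    have hvX : v ∈ Lo.X := by
      by_contra h
      have := P.x_group_lt_x_line h huX'
      omega
    rw [P.xr_group huX, P.xr_line hvX, P.xr_line huX', P.xr_line hvX'] at hx
    rw [P.y_line v hvX, P.y_line u' huX', P.y_line v' hvX'] at hy
    have h1 := outside_parabola P.bounds pu (P.line_le hvX) hs
      (ω := (Lo.line u' : ℝ) + r * (Lo.line v' - Lo.line u')) (by linarith)
    have h2 := inside_parabola (Y := Y) (Lo.line_ne u' huX' v' hvX' ha') hr0 hr rfl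
    linarith
  have pu' := P.point_group u' huX'
  have l1 := P.x_group u huX
  have l2 := P.x_group u' huX'
  have hgu : Lo.grp u ≠ Lo.grp u' := by omega
  rw [P.xr_group huX, P.xr_group huX'] at hx
  by_cases hvX : v ∈ Lo.X
  · rw [P.xr_line hvX] at hx
    rw [P.y_line v hvX] at hy
    by_cases hvX' : v' ∈ Lo.X
    · rw [P.xr_line hvX'] at hx
      rw [P.y_line v' hvX'] at hy
      by_cases hlv : Lo.line v = Lo.line v'
      · rw [← hlv] at hx hy
        exact hgu (same_line_disjoint P.bounds pu pu' (P.line_le hvX) hs hx hy)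
      · exact group_line_group_line_disjoint P.bounds pu pu' hgu (P.line_le hvX) (P.line_le hvX')
          hlv (P.z_line_nonneg v hvX) (P.z_line_le v hvX) (P.z_line_nonneg v' hvX')
          (P.z_line_le v' hvX') hs0 hr0 hx hy hz
    · have l4 := P.x_group v' hvX'
      rw [P.xr_group hvX'] at hx
      exact chord_line_disjoint P.bounds pu' (P.point_group v' hvX') pu hgu.symm (P.line_le hvX)
        (by omega) hr0 hr hs0 hx.symm hy.symm
  · have l3 := P.x_group v hvX
    have pv := P.point_group v hvX
    rw [P.xr_group hvX] at hx
    by_cases hvX' : v' ∈ Lo.X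
    · rw [P.xr_line hvX'] at hx
      rw [P.y_line v' hvX'] at hy
      exact chord_line_disjoint P.bounds pu pv pu' hgu (P.line_le hvX')
        (by omega) hs0 hs hr0 hx hy
    · have l4 := P.x_group v' hvX'
      have pv' := P.point_group v' hvX'
      rw [P.xr_group hvX'] at hx
      by_cases hgv : Lo.grp v = Lo.grp v'
      · rw [← hgv] at hx pv'
        -- The edges share their right-hand group and are traversed backwards from it, with
        -- parameters `1 - s` and `1 - r`.
        exact group_group_disjoint P.bounds pv pv' pu pu'
          (Lo.grp_ne u huX v hvX ha).symm (hgv ▸ (Lo.grp_ne u' huX' v' hvX' ha').symm) hgu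
          (s := 1 - s) (r := 1 - r) (by linarith) (by linarith) (by linarith) (by linarith)
          (P.steep hvX hvX' hgv)
      · have m1 := (Lo.grp_lt u huX).trans (by norm_num : 9 < 11)
        have m2 := (Lo.grp_lt v hvX).trans (by norm_num : 9 < 11)
        have m3 := (Lo.grp_lt u' huX').trans (by norm_num : 9 < 11)
        have m4 := (Lo.grp_lt v' hvX').trans (by norm_num : 9 < 11)
        have : Fact (Nat.Prime 11) := ⟨by norm_num⟩
        exact moment_curve_segments_disjoint 11 (x₁ := Lo.grp u) (x₂ := Lo.grp v)
          (x₃ := Lo.grp u') (x₄ := Lo.grp v') (P.y_mod_group u huX) (P.y_mod_group v hvX)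
          (P.y_mod_group u' huX') (P.y_mod_group v' hvX') (P.z_mod_group u huX)
          (P.z_mod_group v hvX) (P.z_mod_group u' huX') (P.z_mod_group v' hvX')
          (cast_zmod_ne m1 m2 (by omega)) (cast_zmod_ne m1 m3 (by omega))
          (cast_zmod_ne m1 m4 (by omega)) (cast_zmod_ne m2 m3 (by omega))
          (cast_zmod_ne m2 m4 (by omega)) (cast_zmod_ne m3 m4 (by omega)) s r
          (by push_cast; exact hx) hy hz

/-- No vertex lies on an edge. -/
theorem vertex_not_on_edge (P : Lo.Placement p T K α Y ℓ x y z) {u v w : V}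
    (ha : G.Adj u v) (hxv : x u < x v) {s : ℝ} (hs0 : 0 < s) (hs : s < 1)
    (hx : (x w : ℝ) = x u + s * (x v - x u)) (hy : (y w : ℝ) = y u + s * (y v - y u)) : False := by
  have hxr : (x u : ℝ) < x v := by exact_mod_cast hxv
  have h3 : (1 - s) * ((x v : ℝ) - x u) > 0 := mul_pos (by linarith) (by linarith)
  have h4 : s * ((x v : ℝ) - x u) > 0 := mul_pos hs0 (by linarith)
  have huw : x u < x w := by
    have : (x u : ℝ) < x w := by linarith
    exact_mod_cast this
  have hwv : x w < x v := by
    have : (x w : ℝ) < x v := by linarith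
    exact_mod_cast this
  by_cases hwX : w ∈ Lo.X
  · have hvX : v ∈ Lo.X := by
      by_contra h
      have := P.x_group_lt_x_line h hwX
      omega
    by_cases huX : u ∈ Lo.X
    · rw [P.xr_line hwX, P.xr_line huX, P.xr_line hvX] at hx
      rw [P.y_line w hwX, P.y_line u huX, P.y_line v hvX] at hy
      have := inside_parabola (Y := Y) (Lo.line_ne u huX v hvX ha) hs0 hs
        (ω := Lo.line w) (by linarith)
      linarith
    · rw [P.xr_line hwX, P.xr_group huX, P.xr_line hvX] at hx
      rw [P.y_line w hwX, P.y_line v hvX] at hy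
      have := outside_parabola P.bounds (P.point_group u huX) (P.line_le hvX) hs
        (ω := Lo.line w) (by linarith)
      linarith
  · have huX : u ∉ Lo.X := by
      intro h
      have := P.x_group_lt_x_line hwX h
      omega
    have pu := P.point_group u huX
    have pw := P.point_group w hwX
    have l1 := P.x_group u huX
    have l2 := P.x_group w hwX
    have e1 : (Lo.grp u : ℝ) + 1 ≤ Lo.grp w := by
      have : Lo.grp u + 1 ≤ Lo.grp w := by omega
      exact_mod_cast this
    have b1 := P.bounds.one_le_T
    have b2 := P.bounds.le_α
    have b3 := P.bounds.α_le
    have hα : 0 ≤ α := by linarith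
    rw [P.xr_group hwX, P.xr_group huX] at hx
    by_cases hvX : v ∈ Lo.X
    · rw [P.xr_line hvX] at hx
      rw [P.y_line v hvX] at hy
      -- At the next plane the edge has fallen by at least `10 ^ 6 * T`, hence below `y = 0`.
      have h1 := group_to_line_le P.bounds pu (P.line_le hvX) hs0.le hx
      have h2 := pw.y_nonneg P.bounds
      have h5 := pu.cast_le
      have h6 : (Lo.grp u : ℝ) ^ 2 ≤ 64 := by nlinarith [Nat.cast_nonneg (α := ℝ) (Lo.grp u)]
      have h7 := mul_le_mul_of_nonneg_left h6 hα
      have h8 : 1 * (10 ^ 6 * T) ≤ ((Lo.grp w : ℝ) - Lo.grp u) * (10 ^ 6 * T) :=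
        mul_le_mul_of_nonneg_right (by linarith) (by linarith)
      linarith
    · rw [P.xr_group hvX] at hx
      have l3 := P.x_group v hvX
      have e2 : (Lo.grp w : ℝ) + 1 ≤ Lo.grp v := by
        have : Lo.grp w + 1 ≤ Lo.grp v := by omega
        exact_mod_cast this
      have h1 := group_chord_ge pu (P.point_group v hvX) hs0.le hs.le hx
      have h2 := pw.y_le
      have h5 : (Lo.grp w : ℝ) ^ 2 + 1 ≤ (Lo.grp u : ℝ) ^ 2 +
          ((Lo.grp w : ℝ) - Lo.grp u) * (Lo.grp u + Lo.grp v) := by nlinarith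
      have h6 := mul_le_mul_of_nonneg_left h5 hα
      linarith

end SimpleGraph.TrackLayout.Placement

/-! ### Construction of a placement -/

theorem exists_rank_lt_of_lt {V β : Type*} [Fintype V] [LinearOrder β] (f : V → β) :
    ∃ r : V → ℕ, (∀ v, r v < Fintype.card V) ∧ ∀ u v, f u < f v → r u < r v := by
  classical
  refine ⟨fun v => (Finset.univ.filter fun w => f w < f v).card, fun v => ?_, fun u v h => ?_⟩
  · exact Finset.card_lt_univ_of_notMem (x := v) (by simp)
  · apply Finset.card_lt_card
    refine Finset.ssubset_iff_subset_ne.2 ⟨fun w hw => ?_, fun e => ?_⟩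
    · simp only [Finset.mem_filter, Finset.mem_univ, true_and] at hw ⊢
      exact hw.trans h
    · have : u ∈ Finset.univ.filter fun w => f w < f v := by simpa using h
      rw [← e] at this
      simp at this

namespace SimpleGraph.TrackLayout

variable {V : Type*} {G : SimpleGraph V} {m t : ℕ}

/-- Adding empty tracks. -/
def mono (Lo : G.TrackLayout m t) {m' : ℕ} (h : m ≤ m') : G.TrackLayout m' t :=
  { Lo with line_lt := fun v hv => (Lo.line_lt v hv).trans_le h }

/-- Pieces of at most `ℓ` consecutive vertices of a track become columns, so a group needs at most
`T` columns of height `O(ℓ)`. Multiplying by 11 and adding `grp ^ 2` or `grp ^ 3` puts the groups on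
the moment curve modulo 11; this is also why `α` is `11000 * T + 1`. -/
theorem exists_placement [Fintype V] (Lo : G.TrackLayout m t) (hm : 1 ≤ m) {p ℓ : ℕ} (hp : m < p)
    (hℓ : 1 ≤ ℓ) {T K Y : ℕ} (hT : T = t + Fintype.card V / ℓ + 1) (hK : K = 1000 * p * ℓ)
    (hY : Y = 2 * 10 ^ 12 * m * T + 18 * m ^ 2) :
    ∃ x y z : V → ℤ, Lo.Placement p T K (11000 * T + 1) Y ℓ x y z := by
  classical
  obtain ⟨r, hrn, hr⟩ := exists_rank_lt_of_lt Lo.ord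
  obtain ⟨R, hRn, hR⟩ := exists_rank_lt_of_lt fun v => toLex (Lo.trk v, Lo.ord v)
  have hR1 : ∀ u v, Lo.trk u < Lo.trk v → R u < R v :=
    fun u v h => hR u v (Prod.Lex.toLex_lt_toLex.2 (Or.inl h))
  have hR2 : ∀ u v, Lo.trk u = Lo.trk v → Lo.ord u < Lo.ord v → R u < R v :=
    fun u v h h' => hR u v (Prod.Lex.toLex_lt_toLex.2 (Or.inr ⟨h, h'⟩))
  -- The column. `R` ranks by track and then by order, so `R u / ℓ` does not decrease from one track
  -- to the next and different tracks get different columns. The total number of pieces exceeds the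
  -- number of tracks by at most `n / ℓ`.
  let τ : V → ℕ := fun u => Lo.trk u + R u / ℓ
  have hτ : ∀ u, u ∉ Lo.X → τ u + 1 ≤ T := by
    intro u hu
    have h1 := Lo.trk_lt u hu
    have h2 : R u / ℓ ≤ Fintype.card V / ℓ := Nat.div_le_div_right (hRn u).le
    simp only [τ]
    omega
  have hmod : ∀ u, R u % ℓ < ℓ := fun u => Nat.mod_lt _ hℓ
  have hp0 : 1 ≤ p := by omega
  have hT1 : 1 ≤ T := by rw [hT]; exact Nat.le_add_left 1 _
  have hKℓ : 11 * ℓ + 512 ≤ K := by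
    have : 1 * ℓ ≤ p * ℓ := Nat.mul_le_mul_right ℓ hp0
    rw [hK, mul_assoc]
    omega
  have hKT : p * Fintype.card V ≤ K * T := by
    have h1 : Fintype.card V ≤ ℓ * T := by
      rw [hT]
      have := Nat.div_add_mod (Fintype.card V) ℓ
      have := Nat.mod_lt (Fintype.card V) hℓ
      nlinarith
    have h2 : p * Fintype.card V ≤ p * (ℓ * T) := Nat.mul_le_mul_left p h1
    rw [hK]
    nlinarith
  let x : V → ℤ := fun u => if u ∈ Lo.X then 10 ^ 6 * (m + Lo.line u) else Lo.grp u
  let y : V → ℤ := fun u => if u ∈ Lo.X then -(Y + (Lo.line u : ℤ) ^ 2) else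
    11 * (τ u + 1000 * T * (Lo.grp u : ℤ) ^ 2) + (Lo.grp u : ℤ) ^ 2
  -- In group `i` the columns rise with slope `K (i + 1)`, up to the remainder `R u % ℓ`; the last
  -- multiple of `K * T` separates the heights of the groups.
  let z : V → ℤ := fun u => if u ∈ Lo.X then p * r u + (Lo.line u : ℤ) ^ 3 % p else
    11 * (K * (Lo.grp u + 1) * τ u + (R u % ℓ : ℕ) + 10 * (K * T) * Lo.grp u) +
      (Lo.grp u : ℤ) ^ 3
  have hx : ∀ u ∈ Lo.X, x u = 10 ^ 6 * (m + Lo.line u) := fun u hu => if_pos hu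
  have hy : ∀ u ∈ Lo.X, y u = -(Y + (Lo.line u : ℤ) ^ 2) := fun u hu => if_pos hu
  have hz : ∀ u ∈ Lo.X, z u = p * r u + (Lo.line u : ℤ) ^ 3 % p := fun u hu => if_pos hu
  have hx' : ∀ u, u ∉ Lo.X → x u = Lo.grp u := fun u hu => if_neg hu
  have hy' : ∀ u, u ∉ Lo.X → y u =
    11 * (τ u + 1000 * T * (Lo.grp u : ℤ) ^ 2) + (Lo.grp u : ℤ) ^ 2 := fun u hu => if_neg hu
  have hz' : ∀ u, u ∉ Lo.X → z u =
    11 * (K * (Lo.grp u + 1) * τ u + (R u % ℓ : ℕ) + 10 * (K * T) * Lo.grp u) +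
      (Lo.grp u : ℤ) ^ 3 := fun u hu => if_neg hu
  clear_value x y z
  have hpos : (0 : ℤ) < p := by exact_mod_cast hp0
  have h11 : (11 : ZMod 11) = 0 := by decide
  have hzX : ∀ u ∈ Lo.X, 0 ≤ z u ∧ z u ≤ K * T := by
    intro u hu
    rw [hz u hu]
    have h1 := Int.emod_nonneg ((Lo.line u : ℤ) ^ 3) hpos.ne'
    have h2 := Int.emod_lt_of_pos ((Lo.line u : ℤ) ^ 3) hpos
    refine ⟨by positivity, ?_⟩
    have h3 : (p : ℤ) * (r u + 1) ≤ p * Fintype.card V :=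
      mul_le_mul_of_nonneg_left (by exact_mod_cast hrn u) hpos.le
    have h4 : (p : ℤ) * Fintype.card V ≤ K * T := by exact_mod_cast hKT
    linarith
  refine ⟨x, y, z, ⟨⟨by exact_mod_cast hm, by exact_mod_cast hT1, ?_, by linarith, ?_, ?_⟩, hp, ?_,
    hx', fun u hu => ⟨Lo.grp_lt u hu, ?_, ?_, ?_, ?_⟩, fun u hu => ?_, fun u hu => ?_,
    fun u hu v hv hg => ?_, hx, fun u hu => ?_, fun u hu => ?_, fun u hu => ?_, fun u hu => ?_,
    fun u hu v hv hl ho => ?_⟩⟩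
  · exact_mod_cast (by omega : 1 ≤ K)
  · have : (1 : ℝ) ≤ T := by exact_mod_cast hT1
    linarith
  · rw [hY]; push_cast; norm_num
  · exact_mod_cast (by omega : 2 * ℓ < K)
  · rw [hy' u hu]
    push_cast
    have : (0 : ℝ) ≤ τ u := Nat.cast_nonneg _
    linarith
  · rw [hy' u hu]
    push_cast
    have : (τ u : ℝ) + 1 ≤ T := by exact_mod_cast hτ u hu
    linarith
  · rw [hz' u hu]
    have : 110 * (K * T) * Lo.grp u ≤
        11 * (K * (Lo.grp u + 1) * τ u + R u % ℓ + 10 * (K * T) * Lo.grp u) + Lo.grp u ^ 3 := by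
      have : 110 * (K * T) * Lo.grp u = 11 * (10 * (K * T) * Lo.grp u) := by ring
      omega
    exact_mod_cast this
  · rw [hz' u hu]
    -- These terms contribute `99 K T` to the height; the remainder and the cube add at most `11 * ℓ
    -- + 8 ^ 3 ≤ K`.
    have b1 : K * (Lo.grp u + 1) * τ u ≤ K * 9 * T :=
      Nat.mul_le_mul (Nat.mul_le_mul_left _ (Lo.grp_lt u hu)) (by have := hτ u hu; omega)
    have b2 := hmod u
    have b3 : Lo.grp u ^ 3 ≤ 8 ^ 3 := Nat.pow_le_pow_left (by have := Lo.grp_lt u hu; omega) 3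
    have b4 : K * 1 ≤ K * T := Nat.mul_le_mul_left K hT1
    have : 11 * (K * (Lo.grp u + 1) * τ u + R u % ℓ + 10 * (K * T) * Lo.grp u) + Lo.grp u ^ 3 ≤
        110 * (K * T) * Lo.grp u + 101 * (K * T) := by
      have : K * 9 * T = 9 * (K * T) := by ring
      have : 110 * (K * T) * Lo.grp u = 11 * (10 * (K * T) * Lo.grp u) := by ring
      omega
    exact_mod_cast this
  · rw [hy' u hu]
    push_cast
    rw [h11]
    ring
  · rw [hz' u hu]
    push_cast
    rw [h11]
    ring
  · rw [hy' u hu, hy' v hv, hz' u hu, hz' v hv, hg]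
    by_cases hττ : τ u = τ v
    · left
      have htrk : Lo.trk u = Lo.trk v := by
        simp only [τ] at hττ
        rcases lt_trichotomy (Lo.trk u) (Lo.trk v) with h | h | h
        · have := Nat.div_le_div_right (c := ℓ) (hR1 u v h).le
          omega
        · exact h
        · have := Nat.div_le_div_right (c := ℓ) (hR1 v u h).le
          omega
      refine ⟨by rw [hττ], htrk, fun ho => ?_⟩
      have h1 := hR2 u v htrk ho
      have h2 : R u / ℓ = R v / ℓ := by
        simp only [τ] at hττ
        omega
      have h3 := Nat.div_add_mod (R u) ℓ
      have h4 := Nat.div_add_mod (R v) ℓ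
      rw [h2] at h3
      have h5 : ((R u % ℓ : ℕ) : ℤ) < (R v % ℓ : ℕ) := by exact_mod_cast (by omega)
      rw [hττ]
      linarith
    · right
      have hne : (τ u : ℤ) - τ v ≠ 0 := sub_ne_zero.2 (by exact_mod_cast hττ)
      refine ⟨fun e => hne (by linarith), ?_⟩
      have h1 : (1 : ℤ) ≤ |(τ u : ℤ) - τ v| := Int.one_le_abs hne
      have h1' : (1 : ℝ) ≤ |(τ u : ℝ) - τ v| := by exact_mod_cast h1
      have h2 : |((R u % ℓ : ℕ) : ℝ) - (R v % ℓ : ℕ)| ≤ ℓ := by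
        have c1 : ((R u % ℓ : ℕ) : ℝ) ≤ ℓ := by exact_mod_cast (hmod u).le
        have c2 : ((R v % ℓ : ℕ) : ℝ) ≤ ℓ := by exact_mod_cast (hmod v).le
        have c3 : (0 : ℝ) ≤ (R u % ℓ : ℕ) := Nat.cast_nonneg _
        have c4 : (0 : ℝ) ≤ (R v % ℓ : ℕ) := Nat.cast_nonneg _
        exact abs_le.2 ⟨by linarith, by linarith⟩
      -- The deviation from the slope is at most `11 * ℓ`, and different columns are at least 11
      -- apart in `y`.
      simp only [Int.cast_add, Int.cast_mul, Int.cast_pow, Int.cast_natCast, Int.cast_ofNat,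
        Int.cast_one]
      have e1 : (11 * ((τ u : ℝ) + 1000 * T * (Lo.grp v : ℝ) ^ 2) + (Lo.grp v : ℝ) ^ 2) -
          (11 * (τ v + 1000 * T * (Lo.grp v : ℝ) ^ 2) + (Lo.grp v : ℝ) ^ 2) =
          11 * ((τ u : ℝ) - τ v) := by ring
      have e2 : (11 * ((K : ℝ) * (Lo.grp v + 1) * τ u + (R u % ℓ : ℕ) + 10 * (K * T) * Lo.grp v) +
          (Lo.grp v : ℝ) ^ 3) - (11 * ((K : ℝ) * (Lo.grp v + 1) * τ v + (R v % ℓ : ℕ) +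
          10 * (K * T) * Lo.grp v) + (Lo.grp v : ℝ) ^ 3) -
          K * (Lo.grp v + 1) * (11 * ((τ u : ℝ) - τ v)) =
          11 * (((R u % ℓ : ℕ) : ℝ) - (R v % ℓ : ℕ)) := by ring
      rw [e1, e2, abs_mul, abs_mul, abs_of_pos (by norm_num : (0 : ℝ) < 11)]
      have hℓ0 : (0 : ℝ) ≤ ℓ := Nat.cast_nonneg ℓ
      nlinarith
  · rw [hy u hu]; push_cast; rfl
  · exact_mod_cast (hzX u hu).1
  · exact_mod_cast (hzX u hu).2
  · rw [hz u hu]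
    push_cast
    rw [CharP.cast_eq_zero, zero_mul, zero_add]
  · rw [hz u hu, hz v hv, hl]
    have h1 : (r u : ℤ) < r v := by exact_mod_cast hr u v ho
    have h2 := mul_lt_mul_of_pos_left h1 hpos
    linarith

end SimpleGraph.TrackLayout

/-! ### From a placement to a grid drawing and its volume -/

namespace SimpleGraph.TrackLayout.Placement

variable {V : Type*} {G : SimpleGraph V} {m t : ℕ} {Lo : G.TrackLayout m t} {p : ℕ}
  {T K α Y ℓ : ℝ} {x y z : V → ℤ}

theorem x_ne_of_adj (P : Lo.Placement p T K α Y ℓ x y z) {u v : V} (h : G.Adj u v) :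
    x u ≠ x v := by
  by_cases hu : u ∈ Lo.X <;> by_cases hv : v ∈ Lo.X
  · rw [P.x_line u hu, P.x_line v hv]
    have := Lo.line_ne u hu v hv h
    omega
  · exact (P.x_group_lt_x_line hv hu).ne'
  · exact (P.x_group_lt_x_line hu hv).ne
  · rw [P.x_group u hu, P.x_group v hv]
    have := Lo.grp_ne u hu v hv h
    omega

theorem eq_of_coords_eq (P : Lo.Placement p T K α Y ℓ x y z) {u v : V} (hx : x u = x v)
    (hy : y u = y v) (hz : z u = z v) : u = v := by
  have hs : SameTrack Lo u v := by
    by_cases hu : u ∈ Lo.X <;> by_cases hv : v ∈ Lo.X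
    · rw [P.x_line u hu, P.x_line v hv] at hx
      exact Or.inl ⟨hu, hv, by omega⟩
    · exact absurd hx (P.x_group_lt_x_line hv hu).ne'
    · exact absurd hx (P.x_group_lt_x_line hu hv).ne
    · rw [P.x_group u hu, P.x_group v hv] at hx
      have hg : Lo.grp u = Lo.grp v := by omega
      rcases P.diff_group u hu v hv hg with h | h
      · exact Or.inr ⟨hu, hv, hg, h.2.1⟩
      · exact absurd hy h.1
  rcases lt_trichotomy (Lo.ord u) (Lo.ord v) with h | h | h
  · exact absurd hz (P.z_lt_of_sameTrack hs hy h).ne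
  · exact hs.eq h
  · exact absurd hz (P.z_lt_of_sameTrack hs.symm hy.symm h).ne'

/-- The grid point of a vertex. -/
def point (x y z : V → ℤ) (u : V) : Fin 3 → ℤ := ![x u, y u, z u]

theorem mem_openSegment_point {q : Fin 3 → ℝ} {u v : V}
    (h : q ∈ openSegment ℝ (gridToReal (point x y z u)) (gridToReal (point x y z v))) :
    ∃ s : ℝ, 0 < s ∧ s < 1 ∧ q 0 = x u + s * (x v - x u) ∧ q 1 = y u + s * (y v - y u) ∧
      q 2 = z u + s * (z v - z u) := by
  rw [openSegment_eq_image] at h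
  obtain ⟨s, hs, rfl⟩ := h
  refine ⟨s, hs.1, hs.2, ?_, ?_, ?_⟩ <;> simp [point, gridToReal] <;> ring

theorem notMem_inter_openSegment (P : Lo.Placement p T K α Y ℓ x y z) (hp : p.Prime)
    {u v u' v' : V} (ha : G.Adj u v) (ha' : G.Adj u' v') (hxv : x u < x v) (hxv' : x u' < x v')
    (hne : ¬ (u = u' ∧ v = v')) {q : Fin 3 → ℝ}
    (h : q ∈ openSegment ℝ (gridToReal (point x y z u)) (gridToReal (point x y z v)))
    (h' : q ∈ openSegment ℝ (gridToReal (point x y z u')) (gridToReal (point x y z v'))) :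
    False := by
  obtain ⟨s, hs0, hs, hx, hy, hz⟩ := mem_openSegment_point h
  obtain ⟨r, hr0, hr, hx', hy', hz'⟩ := mem_openSegment_point h'
  rw [hx] at hx'
  rw [hy] at hy'
  rw [hz] at hz'
  rcases lt_trichotomy (x u) (x u') with hlt | heq | hlt
  · exact P.disjoint_of_x_lt hp ha ha' hxv hxv' hlt hs0 hs hr0 hr hx' hy' hz'
  · exact P.disjoint_of_x_eq ha ha' hxv hxv' heq hne hs0 hs hr0 hx' hy' hz'
  · exact P.disjoint_of_x_lt hp ha' ha hxv' hxv hlt hr0 hr hs0 hs hx'.symm hy'.symm hz'.symm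

theorem exists_orientation (P : Lo.Placement p T K α Y ℓ x y z) {u v : V} (h : G.Adj u v) :
    ∃ a b, G.Adj a b ∧ x a < x b ∧ s(a, b) = s(u, v) ∧
      openSegment ℝ (gridToReal (point x y z u)) (gridToReal (point x y z v)) =
        openSegment ℝ (gridToReal (point x y z a)) (gridToReal (point x y z b)) := by
  rcases (P.x_ne_of_adj h).lt_or_gt with hlt | hlt
  · exact ⟨u, v, h, hlt, rfl, rfl⟩
  · exact ⟨v, u, h.symm, hlt, Sym2.eq_swap, openSegment_symm _ _ _⟩

/-- The grid drawing given by a placement. -/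
def toGridDrawing (P : Lo.Placement p T K α Y ℓ x y z) (hp : p.Prime) : GridDrawing G where
  pos := point x y z
  pos_injective u v h :=
    P.eq_of_coords_eq (congrFun h 0) (congrFun h 1) (congrFun h 2)
  edges_disjoint u v u' v' h h' hne := by
    obtain ⟨a, b, hab, hx, e, hs⟩ := P.exists_orientation h
    obtain ⟨a', b', hab', hx', e', hs'⟩ := P.exists_orientation h'
    rw [hs, hs', Set.disjoint_left]
    refine fun q hq hq' => P.notMem_inter_openSegment hp hab hab' hx hx' ?_ hq hq'
    rintro ⟨rfl, rfl⟩
    exact hne (e.symm.trans e')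
  vertex_not_mem_edge u v w h hw := by
    obtain ⟨a, b, hab, hx, e, hs⟩ := P.exists_orientation h
    rw [hs] at hw
    obtain ⟨s, hs0, hs1, h0, h1, -⟩ := mem_openSegment_point hw
    exact P.vertex_not_on_edge hab hx hs0 hs1 h0 h1

theorem x_mem (P : Lo.Placement p T K α Y ℓ x y z) (u : V) :
    0 ≤ x u ∧ x u ≤ 2 * 10 ^ 6 * m := by
  have hm : (1 : ℤ) ≤ m := by exact_mod_cast P.one_le_m
  by_cases hu : u ∈ Lo.X
  · rw [P.x_line u hu]
    have := Lo.line_lt u hu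
    omega
  · rw [P.x_group u hu]
    have := Lo.grp_lt u hu
    omega

theorem y_mem (P : Lo.Placement p T K α Y ℓ x y z) (u : V) :
    -(Y + m ^ 2) ≤ y u ∧ (y u : ℝ) ≤ 10 ^ 6 * T := by
  have hB := P.bounds
  have h1 := hB.one_le_T
  have h2 := hB.one_le_m
  have h3 := hB.le_Y
  have h4 : 0 ≤ Y := le_trans (by positivity) h3
  by_cases hu : u ∈ Lo.X
  · rw [P.y_line u hu]
    have h5 := P.line_le hu
    have h6 : (Lo.line u : ℝ) ^ 2 ≤ m ^ 2 := by
      gcongr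
      exact (Lo.line_lt u hu).le
    exact ⟨by linarith, by nlinarith [sq_nonneg (Lo.line u : ℝ)]⟩
  · have h5 := (P.point_group u hu).y_nonneg hB
    have h6 := (P.point_group u hu).y_lt hB
    exact ⟨by nlinarith, h6.le⟩

theorem z_mem (P : Lo.Placement p T K α Y ℓ x y z) (u : V) :
    (0 : ℝ) ≤ z u ∧ (z u : ℝ) ≤ 1000 * (K * T) := by
  have hB := P.bounds
  have h1 := hB.one_le_T
  have h2 := hB.one_le_K
  by_cases hu : u ∈ Lo.X
  · refine ⟨P.z_line_nonneg u hu, (P.z_line_le u hu).trans ?_⟩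
    nlinarith [mul_pos (zero_lt_one.trans_le h2) (zero_lt_one.trans_le h1)]
  · exact ⟨(P.point_group u hu).z_nonneg hB, (P.point_group u hu).z_le' hB⟩

end SimpleGraph.TrackLayout.Placement

theorem GridDrawing.volume_le {V : Type*} {G : SimpleGraph V} (D : GridDrawing G)
    (a b c d : ℕ) (h0 : ∀ u, 0 ≤ D.pos u 0 ∧ D.pos u 0 ≤ a)
    (h1 : ∀ u, -(b : ℤ) ≤ D.pos u 1 ∧ D.pos u 1 ≤ c) (h2 : ∀ u, 0 ≤ D.pos u 2 ∧ D.pos u 2 ≤ d) :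
    D.volume ≤ (a + 1) * (b + c + 1) * (d + 1) := by
  have hsub : D.box ⊆ (Finset.Icc ![0, -(b : ℤ), 0] ![(a : ℤ), c, d] : Finset (Fin 3 → ℤ)) := by
    intro q hq
    rw [Finset.coe_Icc, Set.mem_Icc, Pi.le_def, Pi.le_def]
    refine ⟨fun i => ?_, fun i => ?_⟩
    · obtain ⟨v, hv⟩ := (hq i).1
      refine le_trans ?_ hv
      fin_cases i
      · exact (h0 v).1
      · exact (h1 v).1
      · exact (h2 v).1
    · obtain ⟨v, hv⟩ := (hq i).2
      refine le_trans hv ?_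
      fin_cases i
      · exact (h0 v).2
      · exact (h1 v).2
      · exact (h2 v).2
  refine (Set.ncard_le_ncard hsub (Finset.finite_toSet _)).trans ?_
  rw [Set.ncard_coe_finset, Pi.card_Icc, Fin.prod_univ_three]
  simp only [Int.card_Icc, Matrix.cons_val_zero, Matrix.cons_val_one, Matrix.cons_val]
  apply le_of_eq
  congr 1
  congr 1
  omega

/-- The sides are `O(m)` for `m` lines, `O(m (m + L))` for `Y`, and `O(p ℓ T) = O(m n)` for the
heights, with `p ≤ 2 m` by Bertrand's postulate. -/
theorem SimpleGraph.TrackLayout.exists_gridDrawing {V : Type*} [Fintype V] {G : SimpleGraph V}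
    {m L : ℕ} (Lo : G.TrackLayout m (3 * L)) (hm : 1 ≤ m) (hL : 1 ≤ L)
    (hLn : L ≤ Fintype.card V) :
    ∃ D : GridDrawing G, D.volume ≤ 10 ^ 28 * m ^ 3 * (m + L) * Fintype.card V := by
  obtain ⟨p, hp, hmp, hpm⟩ := Nat.exists_prime_lt_and_le_two_mul m (by omega)
  set n := Fintype.card V with hn
  -- With this length, cutting the tracks adds at most `L` columns, so `T = O(L)`, while `ℓ * L ≤ 2
  -- * n`.
  set ℓ := n / L + 1 with hℓ
  set T := 3 * L + n / ℓ + 1 with hT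
  set K := 1000 * p * ℓ with hK
  set Y := 2 * 10 ^ 12 * m * T + 18 * m ^ 2 with hY
  obtain ⟨x, y, z, P⟩ := Lo.exists_placement hm hmp (ℓ := ℓ) (Nat.le_add_left 1 _) hT hK hY
  have hdiv : n / ℓ ≤ L := by
    apply Nat.div_le_of_le_mul
    have h1 := Nat.div_add_mod n L
    have h2 := Nat.mod_lt n hL
    rw [hℓ, add_mul, one_mul, mul_comm]
    omega
  have hT5 : T ≤ 5 * L := by omega
  have hℓL : ℓ * L ≤ 2 * n := by
    have h1 := Nat.div_mul_le_self n L
    rw [hℓ, add_mul, one_mul]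
    omega
  have hKT : K * T ≤ 20000 * (m * n) := by
    calc K * T ≤ 1000 * (2 * m) * ℓ * (5 * L) := by rw [hK]; gcongr
      _ = 10000 * m * (ℓ * L) := by ring
      _ ≤ 10000 * m * (2 * n) := by gcongr
      _ = 20000 * (m * n) := by ring
  have hmL : m * T ≤ 5 * (m * L) := by
    calc m * T ≤ m * (5 * L) := by gcongr
      _ = 5 * (m * L) := by ring
  have hmL1 : 1 * L ≤ m * L := Nat.mul_le_mul_right L hm
  have hmn1 : 1 * 1 ≤ m * n := Nat.mul_le_mul hm (hL.trans hLn)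
  refine ⟨P.toGridDrawing hp, (GridDrawing.volume_le _ (2 * 10 ^ 6 * m) (Y + m ^ 2) (10 ^ 6 * T)
    (1000 * (K * T)) (fun u => ?_) (fun u => ?_) fun u => ?_).trans ?_⟩
  · have := P.x_mem u
    exact ⟨this.1, by exact_mod_cast this.2⟩
  · have := P.y_mem u
    exact ⟨by exact_mod_cast this.1, by exact_mod_cast this.2⟩
  · have := P.z_mem u
    exact ⟨by exact_mod_cast this.1, by exact_mod_cast this.2⟩
  · have h1 : 2 * 10 ^ 6 * m + 1 ≤ 3 * 10 ^ 6 * m := by omega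
    have h2 : Y + m ^ 2 + 10 ^ 6 * T + 1 ≤ 11 * 10 ^ 12 * (m * (m + L)) := by
      have e1 : Y = 2 * 10 ^ 12 * (m * T) + 18 * m ^ 2 := by rw [hY]; ring
      have e2 : m * (m + L) = m ^ 2 + m * L := by ring
      rw [e2, e1]
      omega
    have h3 : 1000 * (K * T) + 1 ≤ 21 * 10 ^ 6 * (m * n) := by omega
    calc (2 * 10 ^ 6 * m + 1) * (Y + m ^ 2 + 10 ^ 6 * T + 1) * (1000 * (K * T) + 1)
        ≤ 3 * 10 ^ 6 * m * (11 * 10 ^ 12 * (m * (m + L))) * (21 * 10 ^ 6 * (m * n)) := by gcongr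
      _ = 693 * 10 ^ 24 * (m ^ 3 * (m + L) * n) := by ring
      _ ≤ 10 ^ 28 * (m ^ 3 * (m + L) * n) := by gcongr; norm_num
      _ = 10 ^ 28 * m ^ 3 * (m + L) * n := by ring

/-! ### The theorem -/

theorem GridDrawing.exists_of_isEmpty {V : Type*} [IsEmpty V] (G : SimpleGraph V) :
    ∃ D : GridDrawing G, D.volume = 0 := by
  refine ⟨⟨isEmptyElim, isEmptyElim, isEmptyElim, isEmptyElim⟩, ?_⟩
  have : GridDrawing.box (G := G) ⟨isEmptyElim, isEmptyElim, isEmptyElim, isEmptyElim⟩ = ∅ := by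
    ext q
    simp [GridDrawing.box]
  rw [GridDrawing.volume, this, Set.ncard_empty]

theorem Nat.log_two_le_two_mul_log {n : ℕ} (hn : 1 ≤ n) :
    (Nat.log 2 n : ℝ) ≤ 2 * Real.log n := by
  have h1 : ((2 : ℝ) ^ Nat.log 2 n) ≤ n := by
    exact_mod_cast Nat.pow_log_le_self 2 (by omega)
  have h2 := Real.log_le_log (by positivity) h1
  rw [Real.log_pow] at h2
  have h3 := Real.log_two_gt_d9
  have h4 : (0 : ℝ) ≤ Nat.log 2 n := Nat.cast_nonneg _
  nlinarith

theorem mainTheorem10 :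
    ∃ C : ℝ, ∀ (V : Type*) [Fintype V] (G : SimpleGraph V) (g : ℕ), G.HasEulerGenus g →
      ∃ D : GridDrawing G, (D.volume : ℝ) ≤
        C * ((max g 1 : ℕ) : ℝ) ^ (7 / 2 : ℝ) *
          (((max g 1 : ℕ) : ℝ) + Real.log (Fintype.card V : ℝ)) * (Fintype.card V : ℝ) := by
  refine ⟨10 ^ 32, fun V _ G g hg => ?_⟩
  rcases isEmpty_or_nonempty V with hV | hV
  · obtain ⟨D, hD⟩ := GridDrawing.exists_of_isEmpty G
    exact ⟨D, by simp [hD]⟩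
  obtain ⟨D⟩ := hg.1.exists_layeredTreeDecomposition
  have hn : 1 ≤ Fintype.card V := Fintype.card_pos
  set n := Fintype.card V with hn'
  set h := max g 1 with hh
  set L := Nat.log 2 n + 1 with hL
  obtain ⟨Lo⟩ := D.exists_trackLayout L (by
    rw [Nat.card_eq_fintype_card]
    exact Nat.lt_pow_succ_log_self (by norm_num) n)
  have hLn : L ≤ n := by
    have := Nat.log_lt_self 2 (by omega : n ≠ 0)
    omega
  -- `X` occupies `3 * (2 * g)` tracks. For `g = 0` there are none, and empty ones are added, as the
  -- drawing needs `1 ≤ m`.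
  obtain ⟨Dr, hDr⟩ := (Lo.mono (m' := 6 * h) (by omega)).exists_gridDrawing (by omega)
    (by omega) hLn
  refine ⟨Dr, ?_⟩
  have h1 : (1 : ℝ) ≤ h := by exact_mod_cast (by omega : 1 ≤ h)
  have hlog : (0 : ℝ) ≤ Real.log n := Real.log_natCast_nonneg n
  have hmL : (6 * (h : ℝ) + L) ≤ 7 * (h + Real.log n) := by
    have := Nat.log_two_le_two_mul_log hn
    rw [hL]
    push_cast
    linarith
  -- The drawing has the exponent 3; it is weakened to `7 / 2` here.
  have hpow : (h : ℝ) ^ 3 ≤ (h : ℝ) ^ (7 / 2 : ℝ) := by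
    rw [← Real.rpow_natCast]
    exact Real.rpow_le_rpow_of_exponent_le h1 (by norm_num)
  calc (Dr.volume : ℝ) ≤ 10 ^ 28 * (6 * (h : ℝ)) ^ 3 * (6 * h + L) * n := by exact_mod_cast hDr
    _ = 216 * 10 ^ 28 * (h : ℝ) ^ 3 * (6 * h + L) * n := by ring
    _ ≤ 216 * 10 ^ 28 * (h : ℝ) ^ (7 / 2 : ℝ) * (7 * (h + Real.log n)) * n := by gcongr
    _ = 1512 * 10 ^ 28 * ((h : ℝ) ^ (7 / 2 : ℝ) * (h + Real.log n) * n) := by ring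
    _ ≤ 10 ^ 32 * ((h : ℝ) ^ (7 / 2 : ℝ) * (h + Real.log n) * n) := by
      gcongr
      norm_num
    _ = 10 ^ 32 * (h : ℝ) ^ (7 / 2 : ℝ) * (h + Real.log n) * n := by ring
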